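/- **Model.** Let $m\ge 1$, let $V_1,\dots,V_m$ be disjoint finite vertex sets (communities) of sizes $n_i=|V_i|\ge 1$, let $E$ be a symmetric $m\times m$ matrix of non-negative integers with even diagonal, and let $\deg^{\rm int},\deg^{\rm out}:\bigcup_i V_i\to\mathbb N_0$ satisfy $\sum_{v\in V_i}\deg^{\rm int}(v)=E_{i,i}$ and $\sum_{v\in V_i}\deg^{\rm out}(v)=\sum_{j\ne i}E_{i,j}$ for all $i$. Put $\deg=\deg^{\rm int}+\deg^{\rm out}$ and $Q(i,j)=E_{i,j}/\sum_\ell E_{i,\ell}$. Assume that $Q$ is irreducible, with invariant distribution $\pi_Q$, that $\deg^{\rm int}(v)\ge 3$ for all $v$, and that $\deg(v)\le\Delta$ for all $v$. Let $$\Phi_*^Q=\min_{A:\,0<\pi_Q(A)\le 1/2}\frac{\sum_{x\in A,\,y\notin A}\pi_Q(x)Q(x,y)}{\pi_Q(A)}$$ be the Cheeger constant of $Q$ (with $\Phi_*^Q=\infty$ and $C/\Phi_*^Q=0$ if $m=1$). **Tree.** Let $T$ be the following random rooted tree with node types in $\{1,\dots,m\}$. The root has type $i$ with probability $\nu(i)$,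 where $\nu$ is any probability distribution on $\{1,\dots,m\}$; given its type $i$, it picks $v\in V_i$ with probability $\deg(v)/\sum_{u\in V_i}\deg(u)$ and has $\deg^{\rm int}(v)$ internal and $\deg^{\rm out}(v)$ outgoing children. A non-root node of type $i$ whose parent has type $i$ picks $v\in V_i$ with probability $\deg^{\rm int}(v)/E_{i,i}$ and has $\deg^{\rm int}(v)-1$ internal and $\deg^{\rm out}(v)$ outgoing children. A node of type $i$ whose parent has a type $j\neq i$ picks $v\in V_i$ with probability $\deg^{\rm out}(v)/\sum_{k\ne i}E_{i,k}$ and has $\deg^{\rm int}(v)$ internal and $\deg^{\rm out}(v)-1$ outgoing children. Internal children of a node of type $i$ have type $i$; each outgoing child has type $s\ne i$ with probability $E_{i,s}/\sum_{k\neq i}E_{i,k}$. All choices are independent given the types of the node and of its parent. **Types chain.** Given $T$, let $X$ be the lazy simple random walk on $T$ (holding probability $1/2$) started at the root. A time $\sigma\ge 1$ is a regeneration time if $X$ crosses the edge $\{X_{\sigma-1},X_\sigma\}$ at time $\sigma$ and at no other time, $X_{\sigma-1}$ is not the root, and $X_\sigma$, $X_{\sigma-1}$ and the parent of $X_{\sigma-1}$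 all have the same type; if this type is $i$, then the regeneration time has type $(i,i)$. Fix $K\ge 0$ and let $\sigma_1<\sigma_2<\cdots$ be the regeneration times at which $X_\sigma$ has distance more than $K$ from the root. The types chain $\Sigma$ is the Markov chain on $\{(i,i):1\le i\le m\}$ with transition probabilities $$\Sigma(\theta_1,\theta_2)=\mathbb P\big(\sigma_2\text{ has type }\theta_2\,\big|\,\sigma_1\text{ has type }\theta_1\big).$$ **Proposition.** The matrix $\Sigma$ is stochastic and has a unique invariant distribution $\pi_\Sigma$. Moreover, for every $m$, $\Delta$ and $r>0$ there is a constant $C$, depending only on $m$, $\Delta$ and $r$, such that whenever $\min_{i,j}n_i/n_j\ge r$ (and for all $\nu$ and $K$), the total variation mixing time $$t_{\rm mix}^{\Sigma}=\min\Big\{t\ge 0:\ \max_\theta\tfrac12\sum_{\theta'}\big|\Sigma^t(\theta,\theta')-\pi_\Sigma(\theta')\big|\le\tfrac14\Big\}$$ satisfies $$t_{\rm mix}^{\Sigma}\le\frac{C}{\Phi_*^Q}.$$ -/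

import Mathlib

open scoped ENNReal NNReal

noncomputable section

namespace MultiCommunity

/-! ### Finite Markov chains -/

/-- `π` is an invariant probability distribution of the matrix `P`. -/
structure IsInvariantDistribution {S : Type*} [Fintype S] (P : Matrix S S ℝ) (π : S → ℝ) :
    Prop where
  nonneg : ∀ x, 0 ≤ π x
  sum_eq_one : ∑ x, π x = 1
  invariant : ∀ y, ∑ x, π x * P x y = π y

/-- Total variation distance of two probability vectors. -/
def tvDist {S : Type*} [Fintype S] (μ ν : S → ℝ) : ℝ :=
  (1 / 2) * ∑ x, |μ x - ν x|

/-- The `ε`-mixing time `min {t ≥ 0 : max_x ‖P^t(x,·) - π‖_TV ≤ ε}`, which is `⊤` if there is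
no such `t`. -/
def mixingTime {S : Type*} [Fintype S] [DecidableEq S] (P : Matrix S S ℝ) (π : S → ℝ) (ε : ℝ) :
    ℕ∞ :=
  ⨅ (t : ℕ) (_ : ∀ x, tvDist ((P ^ t) x) π ≤ ε), (t : ℕ∞)

/-- The Cheeger constant: the minimum of `(∑_{x ∈ A, y ∉ A} π(x) P(x,y)) / π(A)` over the sets
`A` with `0 < π(A) ≤ 1/2`, which is `⊤` if there is no such set (a single state). -/
def cheeger {S : Type*} [Fintype S] [DecidableEq S] (P : Matrix S S ℝ) (π : S → ℝ) : ℝ≥0∞ :=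
  ⨅ (A : Finset S) (_ : 0 < ∑ x ∈ A, π x) (_ : ∑ x ∈ A, π x ≤ 1 / 2),
    ENNReal.ofReal ((∑ x ∈ A, ∑ y ∈ Aᶜ, π x * P x y) / ∑ x ∈ A, π x)

/-! ### The parameters of the random graph with `m` communities -/

/-- The data of the `m`-communities model; the vertices of community `i` are `Fin (n i)`. -/
structure Model (m : ℕ) where
  /-- community sizes -/
  n : Fin m → ℕ
  n_pos : ∀ i, 0 < n i
  /-- numbers of half-edges between the communities -/
  E : Matrix (Fin m) (Fin m) ℕ
  E_symm : ∀ i j, E i j = E j i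
  E_even : ∀ i, Even (E i i)
  /-- internal degrees -/
  degInt : (i : Fin m) → Fin (n i) → ℕ
  /-- outgoing degrees -/
  degOut : (i : Fin m) → Fin (n i) → ℕ
  sum_degInt : ∀ i, ∑ v, degInt i v = E i i
  sum_degOut : ∀ i, ∑ v, degOut i v = ∑ j ∈ Finset.univ.erase i, E i j

/-- The probability distribution on a finite set proportional to the weights `w`.
(If all weights vanish, the point mass at `a₀`.) -/
def weighted {α : Type*} [Fintype α] (w : α → ℕ) (a₀ : α) : PMF α :=
  open Classical in
  if h : ∑ a, w a = 0 then PMF.pure a₀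
  else PMF.ofFintype (fun a => (w a : ℝ≥0∞) / ((∑ b, w b : ℕ) : ℝ≥0∞)) (by
    simp only [div_eq_mul_inv]
    rw [← Finset.sum_mul, ← Nat.cast_sum]
    exact ENNReal.mul_inv_cancel (by exact_mod_cast h) (ENNReal.natCast_ne_top _))

/-- The law of a list of `k` independent samples of `μ`. -/
def iidList {α : Type*} (μ : PMF α) : ℕ → PMF (List α)
  | 0 => PMF.pure []
  | k + 1 => μ.bind fun a => (iidList μ k).map fun l => a :: l

namespace Model

variable {m : ℕ} (M : Model m)

/-- The transition matrix `Q(i,j) = E_{i,j} / ∑_ℓ E_{i,ℓ}` on the communities. -/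
def Q : Matrix (Fin m) (Fin m) ℝ :=
  Matrix.of fun i j => (M.E i j : ℝ) / ∑ l, (M.E i l : ℝ)

/-- The degree of a vertex. -/
def deg (i : Fin m) (v : Fin (M.n i)) : ℕ := M.degInt i v + M.degOut i v

/-- The type of the endpoint of an outgoing edge of a vertex of type `i`: it is `s ≠ i` with
probability `E_{i,s} / ∑_{k ≠ i} E_{i,k}`. -/
def outType (i : Fin m) : PMF (Fin m) :=
  weighted (fun s => if s = i then 0 else M.E i s) i

/-- The list of types of `a` internal children and `b` outgoing children of a vertex of
type `i`. -/
def childrenLaw (i : Fin m) (a b : ℕ) : PMF (List (Fin m)) :=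
  (iidList (M.outType i) b).map fun l => List.replicate a i ++ l

/-- The law of the list of types of the children of a node of the limiting tree, given the pair
(type of its parent, its own type); the first entry is `none` for the root. -/
def offspringLaw : Option (Fin m) × Fin m → PMF (List (Fin m))
  | (none, i) =>
      (weighted (M.deg i) ⟨0, M.n_pos i⟩).bind fun v =>
        M.childrenLaw i (M.degInt i v) (M.degOut i v)
  | (some j, i) =>
      if j = i then
        (weighted (M.degInt i) ⟨0, M.n_pos i⟩).bind fun v =>
          M.childrenLaw i (M.degInt i v - 1) (M.degOut i v)
      else
        (weighted (M.degOut i) ⟨0, M.n_pos i⟩).bind fun v =>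
          M.childrenLaw i (M.degInt i v) (M.degOut i v - 1)

end Model

/-! ### Typed trees -/

/-- Nodes of a rooted ordered tree: `[]` is the root and `k :: u` is the child of `u` with
index `k`. Hence the parent of `u ≠ []` is `u.tail` and its depth is `u.length`. -/
abbrev Node := List ℕ

/-- A reservoir of offspring: for every node `u` and every pair `p` (type of the parent of `u`,
type of `u`), the list of types of the children that `u` gets if its pair of types is `p`. -/
abbrev Reservoir (m : ℕ) := Node × (Option (Fin m) × Fin m) → List (Fin m)

/-- The (type of the parent, type) of a node in the tree with root type `r` that is grown from
the reservoir `ω`. (The value is irrelevant for nodes that are not in the tree.) -/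
def typePair {m : ℕ} (r : Fin m) (ω : Reservoir m) : Node → Option (Fin m) × Fin m
  | [] => (none, r)
  | k :: u =>
      (some (typePair r ω u).2, (ω (u, typePair r ω u)).getD k (typePair r ω u).2)

/-- The type `Θ(u)` of a node. -/
def nodeType {m : ℕ} (r : Fin m) (ω : Reservoir m) (u : Node) : Fin m := (typePair r ω u).2

/-- The neighbours of a node `u` of the tree: its children, and its parent if `u` is not the
root. -/
def neighbours {m : ℕ} (r : Fin m) (ω : Reservoir m) (u : Node) : List Node :=
  (List.range (ω (u, typePair r ω u)).length).map (fun k => k :: u) ++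
    (if u = [] then [] else [u.tail])

/-- The randomness of the lazy walk: a coin for every time `t`, and, for every time `t` and
every `d`, a choice among `d + 1` items. -/
abbrev WalkSeed := (ℕ → Bool) × ((p : ℕ × ℕ) → Fin (p.2 + 1))

/-- The lazy simple random walk on the tree started from the root: at each step, depending on
the coin, it stays put or moves to a uniformly chosen neighbour of its current position. -/
def walk {m : ℕ} (r : Fin m) (ω : Reservoir m) (ξ : WalkSeed) : ℕ → Node
  | 0 => []
  | t + 1 =>
      let u := walk r ω ξ t
      if ξ.1 t then u
      else (neighbours r ω u).getD (ξ.2 (t, (neighbours r ω u).length - 1)) u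

/-! ### The joint law of the tree and the walk -/

/-- Lists of types carry the discrete σ-algebra. -/
instance {m : ℕ} : MeasurableSpace (List (Fin m)) := ⊤

/-- Sample points: the type of the root, the reservoir of offspring and the randomness of the
walk. -/
abbrev Sample (m : ℕ) := Fin m × Reservoir m × WalkSeed

/-- The joint law of the multi-type random tree whose root type has law `ν` and of the lazy
simple random walk on it: all the entries of the sample are independent, so that, given the
types down to some level, the nodes of that level get children independently with the law
`offspringLaw`, and, given the tree, the walk is a lazy simple random walk. -/
def law {m : ℕ} (M : Model m) (ν : PMF (Fin m)) : MeasureTheory.Measure (Sample m) :=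
  ν.toMeasure.prod
    ((MeasureTheory.Measure.infinitePi
        fun x : Node × (Option (Fin m) × Fin m) => (M.offspringLaw x.2).toMeasure).prod
      ((MeasureTheory.Measure.infinitePi fun _ : ℕ => (PMF.uniformOfFintype Bool).toMeasure).prod
        (MeasureTheory.Measure.infinitePi
          fun p : ℕ × ℕ => (PMF.uniformOfFintype (Fin (p.2 + 1))).toMeasure)))

/-! ### Regeneration times and the types chain -/

/-- The position of the walk at time `t`. -/
def Sample.X {m : ℕ} (s : Sample m) (t : ℕ) : Node := walk s.1 s.2.1 s.2.2 t

/-- The type of a node. -/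
def Sample.type {m : ℕ} (s : Sample m) (u : Node) : Fin m := nodeType s.1 s.2.1 u

/-- `σ` is a regeneration time with `d(ρ, X_σ) > K`: the edge `{X_{σ-1}, X_σ}` is crossed for
the first and last time at time `σ`, and the nodes `p(X_{σ-1})`, `X_{σ-1}`, `X_σ` have the same
type (in particular `X_{σ-1}` has a parent). -/
structure IsRegeneration {m : ℕ} (K : ℕ) (s : Sample m) (σ : ℕ) : Prop where
  pos : 1 ≤ σ
  crosses : s.X (σ - 1) ≠ s.X σ
  unique_crossing : ∀ t, 1 ≤ t → s(s.X (t - 1), s.X t) = s(s.X (σ - 1), s.X σ) → t = σ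
  ne_root : s.X (σ - 1) ≠ []
  type_parent : s.type (s.X (σ - 1)).tail = s.type (s.X (σ - 1))
  type_eq : s.type (s.X (σ - 1)) = s.type (s.X σ)
  depth : K < (s.X σ).length

/-- `σ` is the `k`-th regeneration time `σ_k` (`k ≥ 1`) with `d(ρ, X_σ) > K`. -/
def IsNthRegeneration {m : ℕ} (K : ℕ) (s : Sample m) (k σ : ℕ) : Prop :=
  IsRegeneration K s σ ∧ {τ | τ < σ ∧ IsRegeneration K s τ}.ncard + 1 = k

/-- The event that `σ_k` exists and that the regeneration edge `(X_{σ_k - 1}, X_{σ_k})` has the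
types `θ`. -/
def regenerationType {m : ℕ} (K k : ℕ) (θ : Fin m × Fin m) : Set (Sample m) :=
  {s | ∃ σ, IsNthRegeneration K s k σ ∧ (s.type (s.X (σ - 1)), s.type (s.X σ)) = θ}

/-- `Σ(θ₁, θ₂) = P(Θ(X_{σ_2}) = θ₂ | Θ(X_{σ_1}) = θ₁)`. -/
def typesTransition {m : ℕ} (M : Model m) (ν : PMF (Fin m)) (K : ℕ) :
    Matrix (Fin m × Fin m) (Fin m × Fin m) ℝ :=
  Matrix.of fun θ₁ θ₂ =>
    (ProbabilityTheory.cond (law M ν) (regenerationType K 1 θ₁)).real (regenerationType K 2 θ₂)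

/-- The types Markov chain `Σ`. A regeneration edge always has a type of the form `(i,i)`, so
the state space is `{(i,i) : i}`, indexed by `i`. -/
def typesChain {m : ℕ} (M : Model m) (ν : PMF (Fin m)) (K : ℕ) : Matrix (Fin m) (Fin m) ℝ :=
  (typesTransition M ν K).submatrix (fun i => (i, i)) (fun i => (i, i))

end MultiCommunity

end

set_option linter.unusedSectionVars false

open scoped ENNReal NNReal

noncomputable section

namespace MultiCommunity

open MeasureTheory Filter

/-! ### Mixing of finite chains that dominate a chain with a large Cheeger constant -/

section FiniteChain

variable {S : Type*} [Fintype S] [DecidableEq S]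

/-! The bound is linear in the inverse Cheeger constant `φ` of `Q` because the number `m` of states
is fixed. Suppose that a chain `P` dominates `c₁ Q` entrywise, holds with probability at least `δ`,
and that the invariant distributions of `P` and `Q` are bounded below. Some gap between consecutive
values of a function is at least `1/m` of its range, so the Dirichlet form is at least a constant
times `φ` times the squared range, and one step of `P` contracts variances by a factor `1 - const ·
φ`. No reversibility of `P` is needed (`mixing_of_dominates`). It remains to bound the types chain
and its invariant distribution from below.

Let `q i` be the probability that the walk below a node with type pair `(i,i)` never leaves through
the parent (`esc`), and let `G i j` be the total mass of the path segments between consecutive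
regeneration nodes (`goodWeight`). Disjoint parts of the tree and disjoint periods of time are
independent, so the types chain is `G i j * q j / q i`; the initial segment, with `ν` and `K`,
cancels (`typesChain_eq`). All nodes have at least two children, whence `q ≥ 1/2`, and straight
walks of at most three steps bound `G i i` below by a constant and `G i j` by a constant times `E i
j / E i i ≥ Q i j`.

The invariant distribution comes from a finer chain that satisfies detailed balance. It records the
nodes that share the type of their parent and after which the walk never returns to the parent. On a
fixed tree the probability to hit a node is the reciprocal of a continuant of weights along the path
(`hitV_missV_eq`), and continuants are invariant under reversal. The joint law of the weights and
types is reversible with respect to `E`, by exchange of the two half-edges of a vertex on the path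
(`removal_reversible`). So the Green function on each level is symmetric up to the factors `E i i`
(`mass_bot_symm`). The renewal equation `U = W + W * U` passes the symmetry to its kernel
(`renewal_symm`). Every level carries a mass bounded below, so the Green function diverges, and a
reversible kernel with a divergent Green function loses no mass (`renewal_stochastic`).

Finally the kernel is split as `g + b`, where `g` collects the nodes whose grandparent also has the
same type. Then `G = g + b * G`: the types chain is the finer chain watched at its `g`-transitions.
Its invariant distribution is explicit and at least a constant times `E j j / ∑ E i i`
(`exists_invariant_of_watched`), which the comparable community sizes bound below. -/

theorem mem_of_closed_of_isIrreducible {P : Matrix S S ℝ} (hP : P.IsIrreducible) {A : Set S}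
    (hA : A.Nonempty) (hcl : ∀ i ∈ A, ∀ j, 0 < P i j → j ∈ A) (j : S) : j ∈ A := by
  obtain ⟨i, hi⟩ := hA
  let : Quiver S := Matrix.toQuiver P
  obtain ⟨p, -⟩ := hP.connected i j
  induction p with
  | nil => exact hi
  | cons p e ih => exact hcl _ ih _ e.down

/-- A harmonic function of an irreducible stochastic matrix is constant. -/
theorem harmonic_const {P : Matrix S S ℝ} (hP : P.IsIrreducible) (hrow : ∀ i, ∑ j, P i j = 1)
    {g : S → ℝ} (hg : ∀ i, ∑ j, P i j * g j = g i) (i j : S) : g i = g j := by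
  have : Nonempty S := ⟨i⟩
  obtain ⟨x, hx⟩ := Finite.exists_max g
  have key := mem_of_closed_of_isIrreducible hP (A := {y | g y = g x}) ⟨x, rfl⟩ (by
    intro y hy z hyz
    have h0 : ∑ w, P y w * (g x - g w) = 0 := by
      simp only [mul_sub, Finset.sum_sub_distrib, ← Finset.sum_mul, hrow, hg]
      have : g y = g x := hy
      linarith
    have := (Finset.sum_eq_zero_iff_of_nonneg (fun w _ => mul_nonneg (hP.nonneg y w)
      (sub_nonneg.2 (hx w)))).1 h0 z (Finset.mem_univ _)
    rcases mul_eq_zero.1 this with h | h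
    · exact absurd h hyz.ne'
    · exact (sub_eq_zero.1 h).symm)
  exact (key i).trans (key j).symm

/-- The invariant distribution of an irreducible chain satisfying detailed balance. -/
theorem invariant_eq_of_reversible {P : Matrix S S ℝ} (hP : P.IsIrreducible)
    (hrow : ∀ i, ∑ j, P i j = 1) {D : S → ℝ} (hD : ∀ i, 0 < D i)
    (hrev : ∀ i j, D i * P i j = D j * P j i) {π : S → ℝ} (hπ : IsInvariantDistribution P π)
    (i : S) : π i = D i / ∑ j, D j := by
  -- Detailed balance turns invariance of `π` into harmonicity of the density `π / D`.
  have hharm : ∀ i, ∑ j, P i j * (π j / D j) = π i / D i := by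
    intro i
    rw [eq_div_iff (hD i).ne', Finset.sum_mul]
    conv_rhs => rw [← hπ.invariant i]
    refine Finset.sum_congr rfl fun j _ => ?_
    have := hrev i j
    have hj := (hD j).ne'
    field_simp
    linear_combination π j * this
  have hc : ∀ j, π j = π i / D i * D j := fun j => by
    rw [← harmonic_const hP hrow hharm j i, div_mul_cancel₀ _ (hD j).ne']
  have h1 : π i / D i * ∑ j, D j = 1 := by
    rw [Finset.mul_sum, ← hπ.sum_eq_one]
    exact Finset.sum_congr rfl fun j _ => (hc j).symm
  have hS : 0 < ∑ j, D j := Finset.sum_pos (fun j _ => hD j) ⟨i, Finset.mem_univ _⟩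
  rw [eq_div_iff hS.ne']
  have := hD i
  field_simp at h1
  linarith

/-- This stands in for a spectral argument when the chain is not reversible: the variance of `f`
after one step from `x` controls the local energy times the holding probability. Since `f - f x`
vanishes at `x`, Cauchy–Schwarz only sees the mass `1 - p x`, and the missing `p x` is the gain. -/
theorem variance_ge {p : S → ℝ} (hp : ∀ y, 0 ≤ p y) (hsum : ∑ y, p y = 1) (f : S → ℝ) (x : S) :
    (∑ y, p y * f y) ^ 2 + p x * ∑ z, p z * (f x - f z) ^ 2 ≤ ∑ y, p y * f y ^ 2 := by
  set a : S → ℝ := fun z => f z - f x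
  set w : S → ℝ := fun z => if z = x then 0 else p z
  have hw : ∀ z, 0 ≤ w z := fun z => by simp only [w]; split_ifs <;> simp [hp]
  have hwa : ∀ z, w z * a z = p z * a z := fun z => by
    simp only [w, a]; split_ifs with h <;> simp [h]
  have hwa2 : ∀ z, w z * a z ^ 2 = p z * a z ^ 2 := fun z => by
    simp only [w, a]; split_ifs with h <;> simp [h]
  have hws : ∑ z, w z = 1 - p x := by
    have : ∀ z, w z = p z - if z = x then p x else 0 := fun z => by
      simp only [w]; split_ifs with h <;> simp [h]
    simp only [this, Finset.sum_sub_distrib, hsum]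
    simp
  have cs : (∑ z, p z * a z) ^ 2 ≤ (1 - p x) * ∑ z, p z * a z ^ 2 := by
    rw [← hws]
    simp only [← hwa, ← hwa2]
    refine Finset.sum_sq_le_sum_mul_sum_of_sq_le_mul _ (fun i _ => hw i)
      (fun i _ => mul_nonneg (hw i) (sq_nonneg _)) fun i _ => le_of_eq (by ring)
  have e1 : ∑ z, p z * a z = ∑ z, p z * f z - f x := by
    simp only [a, mul_sub, Finset.sum_sub_distrib, ← Finset.sum_mul, hsum, one_mul]
  have e2 : ∑ z, p z * a z ^ 2 = ∑ z, p z * f z ^ 2 - 2 * f x * ∑ z, p z * f z + f x ^ 2 := by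
    have : ∀ z, p z * a z ^ 2 = p z * f z ^ 2 - 2 * f x * (p z * f z) + p z * f x ^ 2 :=
      fun z => by simp only [a]; ring
    simp only [this, Finset.sum_add_distrib, Finset.sum_sub_distrib, ← Finset.mul_sum,
      ← Finset.sum_mul, hsum, one_mul]
  have e3 : ∑ z, p z * (f x - f z) ^ 2 = ∑ z, p z * a z ^ 2 :=
    Finset.sum_congr rfl fun z _ => by simp only [a]; ring
  rw [e3]
  rw [e1] at cs
  nlinarith [cs, e2]

/-- Among the values of a function on a set with `m` elements there is a gap of length at least
`1 / m` times the range. -/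
theorem exists_gap [Nonempty S] (f : S → ℝ) {x₀ x₁ : S} (hlt : f x₀ < f x₁) :
    ∃ A : Set S, x₀ ∈ A ∧ x₁ ∉ A ∧
      ∀ x ∈ A, ∀ y ∉ A, (f x₁ - f x₀) / Fintype.card S ≤ f y - f x := by
  classical
  set N := Fintype.card S
  set R := f x₁ - f x₀ with hR
  have hRpos : 0 < R := sub_pos.2 hlt
  have hN : 0 < (N : ℝ) := by exact_mod_cast Fintype.card_pos
  by_contra hcon
  push Not at hcon
  -- If no cut works, each of `N` consecutive intervals of length `R / N` contains a value of `f`;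
  -- below an empty one there would be a cut.
  have hex : ∀ l : Fin N, ∃ y, f x₀ + l * (R / N) ≤ f y ∧ f y < f x₀ + (l + 1) * (R / N) := by
    intro l
    by_contra hl
    push Not at hl
    obtain ⟨x, hx, y, hy, hxy⟩ := hcon {x | f x < f x₀ + l * (R / N)} (by
      have hl0 : (0 : ℝ) ≤ l * (R / N) := by positivity
      rcases hl0.lt_or_eq with h | h
      · simp only [Set.mem_ofPred_eq]; linarith
      · exfalso
        have h2 := hl x₀ (by linarith)
        have h3 : 0 < R / N := by positivity
        nlinarith) (by
      simp only [Set.mem_ofPred_eq, not_lt]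
      have : (l : ℝ) * (R / N) ≤ R := by
        have hl' : (l : ℝ) ≤ N := by exact_mod_cast l.2.le
        calc (l : ℝ) * (R / N) ≤ N * (R / N) := by gcongr
          _ = R := by field_simp
      linarith)
    simp only [Set.mem_ofPred_eq, not_lt] at hx hy
    have := hl y hy
    have e : (l + 1 : ℝ) * (R / N) = l * (R / N) + R / N := by ring
    linarith
  choose g hg using hex
  have hinj : Function.Injective g := by
    intro l l' hll
    have a := hg l
    have b := hg l'
    rw [hll] at a
    have h3 : 0 < R / N := by positivity
    have c1 : (l : ℝ) * (R / N) < (l' + 1) * (R / N) := by linarith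
    have c2 : (l' : ℝ) * (R / N) < (l + 1) * (R / N) := by linarith
    have d1 := lt_of_mul_lt_mul_right c1 h3.le
    have d2 := lt_of_mul_lt_mul_right c2 h3.le
    have d1' : (l : ℕ) < l' + 1 := by exact_mod_cast d1
    have d2' : (l' : ℕ) < l + 1 := by exact_mod_cast d2
    exact Fin.ext (by omega)
  -- The `N` disjoint intervals use up all `N` points, yet `f x₁` is the right end of the last
  -- interval and lies in none of them.
  have hsurj : Function.Surjective g :=
    ((Fintype.bijective_iff_injective_and_card g).2 ⟨hinj, by simp [N]⟩).2
  obtain ⟨l, hl⟩ := hsurj x₁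
  have := (hg l).2
  rw [hl] at this
  have hl' : (l + 1 : ℝ) ≤ N := by exact_mod_cast l.2
  have : (l + 1 : ℝ) * (R / N) ≤ R := by
    calc (l + 1 : ℝ) * (R / N) ≤ N * (R / N) := by gcongr
      _ = R := by field_simp
  linarith

/-- A Poincaré inequality for a chain with `m` states in terms of its conductance. -/
theorem range_sq_le_dirichlet [Nonempty S] {Q : Matrix S S ℝ} {πQ : S → ℝ}
    (hQ : ∀ x y, 0 ≤ Q x y) (hsum : ∑ x, πQ x = 1) {φ p : ℝ} (hφ0 : 0 ≤ φ) (hp : 0 < p)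
    (hπp : ∀ x, p ≤ πQ x)
    (hφ : ∀ A : Finset S, 0 < ∑ x ∈ A, πQ x → ∑ x ∈ A, πQ x ≤ 1 / 2 →
      φ * ∑ x ∈ A, πQ x ≤ ∑ x ∈ A, ∑ y ∈ Aᶜ, πQ x * Q x y)
    (f : S → ℝ) {x₀ x₁ : S} (h₀ : ∀ y, f x₀ ≤ f y) :
    φ * p * ((f x₁ - f x₀) / Fintype.card S) ^ 2 ≤
      ∑ x, ∑ y, πQ x * Q x y * (f x - f y) ^ 2 := by
  classical
  have hπ0 : ∀ x, 0 < πQ x := fun x => hp.trans_le (hπp x)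
  have hnn : ∀ x y, 0 ≤ πQ x * Q x y * (f x - f y) ^ 2 := fun x y =>
    mul_nonneg (mul_nonneg (hπ0 x).le (hQ x y)) (sq_nonneg _)
  rcases (h₀ x₁).lt_or_eq with hlt | heq
  swap
  · rw [heq]
    simpa using Finset.sum_nonneg fun x _ => Finset.sum_nonneg fun y _ => hnn x y
  obtain ⟨A, hA0, hA1, hA⟩ := exists_gap f hlt
  set r := (f x₁ - f x₀) / Fintype.card S
  have hr : 0 ≤ r := div_nonneg (sub_nonneg.2 hlt.le) (Nat.cast_nonneg _)
  -- Either side of the cut may serve, and the conductance applies to the one of mass at most `1/2`.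
  -- That mass is at least `p`, which yields a bound linear in `φ` instead of the `φ ^ 2` of the
  -- general Cheeger inequality.
  have main : ∀ B : Finset S, B.Nonempty → ∑ x ∈ B, πQ x ≤ 1 / 2 →
      (∀ x ∈ B, ∀ y ∈ Bᶜ, r ^ 2 ≤ (f x - f y) ^ 2) →
      φ * p * r ^ 2 ≤ ∑ x, ∑ y, πQ x * Q x y * (f x - f y) ^ 2 := by
    intro B hB hhalf hgap
    have hBp : p ≤ ∑ x ∈ B, πQ x := by
      obtain ⟨x, hx⟩ := hB
      exact (hπp x).trans (Finset.single_le_sum (fun y _ => (hπ0 y).le) hx)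
    calc φ * p * r ^ 2 ≤ (φ * ∑ x ∈ B, πQ x) * r ^ 2 := by gcongr
      _ ≤ (∑ x ∈ B, ∑ y ∈ Bᶜ, πQ x * Q x y) * r ^ 2 := by
        gcongr; exact hφ B (hp.trans_le hBp) hhalf
      _ = ∑ x ∈ B, ∑ y ∈ Bᶜ, πQ x * Q x y * r ^ 2 := by simp only [Finset.sum_mul]
      _ ≤ ∑ x ∈ B, ∑ y ∈ Bᶜ, πQ x * Q x y * (f x - f y) ^ 2 := by
        refine Finset.sum_le_sum fun x hx => Finset.sum_le_sum fun y hy => ?_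
        exact mul_le_mul_of_nonneg_left (hgap x hx y hy) (mul_nonneg (hπ0 x).le (hQ x y))
      _ ≤ ∑ x ∈ B, ∑ y, πQ x * Q x y * (f x - f y) ^ 2 :=
        Finset.sum_le_sum fun x _ =>
          Finset.sum_le_sum_of_subset_of_nonneg (Finset.subset_univ _) fun y _ _ => hnn x y
      _ ≤ _ := Finset.sum_le_sum_of_subset_of_nonneg (Finset.subset_univ _)
        fun x _ _ => Finset.sum_nonneg fun y _ => hnn x y
  set B := Finset.univ.filter (· ∈ A)
  have hadd : ∑ x ∈ B, πQ x + ∑ x ∈ Bᶜ, πQ x = 1 := by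
    rw [Finset.sum_add_sum_compl, hsum]
  rcases le_total (∑ x ∈ B, πQ x) (1 / 2) with h | h
  · refine main B ⟨x₀, by simpa [B] using hA0⟩ h fun x hx y hy => ?_
    have := hA x (by simpa [B] using hx) y (by simpa [B] using hy)
    nlinarith
  · refine main Bᶜ ⟨x₁, by simpa [B] using hA1⟩ (by linarith) fun x hx y hy => ?_
    have := hA y (by simpa [B] using hy) x (by simpa [B] using hx)
    nlinarith

/-- One step of a chain contracts the variance if it dominates a chain with conductance `φ`. -/
theorem variance_contraction [Nonempty S] {P Q : Matrix S S ℝ} {π πQ : S → ℝ}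
    (hP0 : ∀ x y, 0 ≤ P x y) (hPsum : ∀ x, ∑ y, P x y = 1) (hπ : IsInvariantDistribution P π)
    (hQ : ∀ x y, 0 ≤ Q x y) (hQsum : ∑ x, πQ x = 1) {φ p c₀ c₁ δ : ℝ} (hφ0 : 0 ≤ φ) (hp : 0 < p)
    (hπp : ∀ x, p ≤ πQ x) (hc₀ : 0 < c₀) (hc₁ : 0 < c₁) (hδ : 0 < δ)
    (hπ0 : ∀ x, c₀ ≤ π x) (hPQ : ∀ x y, c₁ * Q x y ≤ P x y) (hPδ : ∀ x, δ ≤ P x x)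
    (hφ : ∀ A : Finset S, 0 < ∑ x ∈ A, πQ x → ∑ x ∈ A, πQ x ≤ 1 / 2 →
      φ * ∑ x ∈ A, πQ x ≤ ∑ x ∈ A, ∑ y ∈ Aᶜ, πQ x * Q x y)
    (f : S → ℝ) (hf : ∑ x, π x * f x = 0) :
    ∑ x, π x * (∑ y, P x y * f y) ^ 2 ≤
      (1 - δ * c₀ * c₁ * p / (Fintype.card S) ^ 2 * φ) * ∑ x, π x * f x ^ 2 := by
  obtain ⟨x₁, h₁⟩ := Finite.exists_max f
  obtain ⟨x₀, h₀⟩ := Finite.exists_min f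
  have hπnn : ∀ x, 0 ≤ π x := hπ.nonneg
  have hmin : f x₀ ≤ 0 := by
    have : ∑ x, π x * f x₀ ≤ ∑ x, π x * f x :=
      Finset.sum_le_sum fun x _ => mul_le_mul_of_nonneg_left (h₀ x) (hπnn x)
    rwa [← Finset.sum_mul, hπ.sum_eq_one, one_mul, hf] at this
  have hmax : 0 ≤ f x₁ := by
    have : ∑ x, π x * f x ≤ ∑ x, π x * f x₁ :=
      Finset.sum_le_sum fun x _ => mul_le_mul_of_nonneg_left (h₁ x) (hπnn x)
    rwa [← Finset.sum_mul, hπ.sum_eq_one, one_mul, hf] at this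
  set R := f x₁ - f x₀
  have hvar : ∑ x, π x * f x ^ 2 ≤ R ^ 2 := by
    calc ∑ x, π x * f x ^ 2 ≤ ∑ x, π x * R ^ 2 := by
          refine Finset.sum_le_sum fun x _ => mul_le_mul_of_nonneg_left ?_ (hπnn x)
          have := h₀ x
          have := h₁ x
          exact sq_le_sq' (by simp only [R]; linarith) (by simp only [R]; linarith)
      _ = R ^ 2 := by rw [← Finset.sum_mul, hπ.sum_eq_one, one_mul]
  have hQle : ∀ x, πQ x ≤ 1 := fun x => by
    rw [← hQsum]
    exact Finset.single_le_sum (fun y _ => hp.le.trans (hπp y)) (Finset.mem_univ x)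
  have hdir := range_sq_le_dirichlet hQ hQsum hφ0 hp hπp hφ f (x₁ := x₁) h₀
  have h2 : δ * c₀ * c₁ * ∑ x, ∑ y, πQ x * Q x y * (f x - f y) ^ 2 ≤
      ∑ x, π x * (P x x * ∑ z, P x z * (f x - f z) ^ 2) := by
    rw [Finset.mul_sum]
    refine Finset.sum_le_sum fun x _ => ?_
    have a1 : c₁ * ∑ y, Q x y * (f x - f y) ^ 2 ≤ ∑ z, P x z * (f x - f z) ^ 2 := by
      rw [Finset.mul_sum]
      refine Finset.sum_le_sum fun z _ => ?_
      rw [← mul_assoc]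
      exact mul_le_mul_of_nonneg_right (hPQ x z) (sq_nonneg _)
    have a0 : 0 ≤ ∑ y, Q x y * (f x - f y) ^ 2 :=
      Finset.sum_nonneg fun y _ => mul_nonneg (hQ x y) (sq_nonneg _)
    have e : ∑ y, πQ x * Q x y * (f x - f y) ^ 2 = πQ x * ∑ y, Q x y * (f x - f y) ^ 2 := by
      rw [Finset.mul_sum]; exact Finset.sum_congr rfl fun y _ => by ring
    rw [e]
    calc δ * c₀ * c₁ * (πQ x * ∑ y, Q x y * (f x - f y) ^ 2)
        ≤ δ * c₀ * c₁ * (1 * ∑ y, Q x y * (f x - f y) ^ 2) := by gcongr; exact hQle x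
      _ = c₀ * (δ * (c₁ * ∑ y, Q x y * (f x - f y) ^ 2)) := by ring
      _ ≤ π x * (P x x * ∑ z, P x z * (f x - f z) ^ 2) := by
        have := hπ0 x
        have := hPδ x
        have h4 : 0 ≤ P x x := hP0 x x
        have h5 : 0 ≤ π x := hπnn x
        gcongr
  -- By invariance the mean of `f ^ 2` is the same one step later, so the loss of variance is the
  -- mean conditional variance.
  have h3 : ∑ x, π x * ((∑ y, P x y * f y) ^ 2 + P x x * ∑ z, P x z * (f x - f z) ^ 2) ≤
      ∑ x, π x * f x ^ 2 := by
    calc _ ≤ ∑ x, π x * ∑ y, P x y * f y ^ 2 :=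
          Finset.sum_le_sum fun x _ =>
            mul_le_mul_of_nonneg_left (variance_ge (hP0 x) (hPsum x) f x) (hπnn x)
      _ = ∑ y, (∑ x, π x * P x y) * f y ^ 2 := by
        simp only [Finset.mul_sum, Finset.sum_mul]
        rw [Finset.sum_comm]
        exact Finset.sum_congr rfl fun y _ => Finset.sum_congr rfl fun x _ => by ring
      _ = _ := by simp only [hπ.invariant]
  simp only [mul_add, Finset.sum_add_distrib] at h3
  have hN : (0 : ℝ) < Fintype.card S := by exact_mod_cast Fintype.card_pos
  have h4 : δ * c₀ * c₁ * p / (Fintype.card S) ^ 2 * φ * ∑ x, π x * f x ^ 2 ≤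
      δ * c₀ * c₁ * ∑ x, ∑ y, πQ x * Q x y * (f x - f y) ^ 2 := by
    calc _ ≤ δ * c₀ * c₁ * p / (Fintype.card S) ^ 2 * φ * R ^ 2 := by gcongr
      _ = δ * c₀ * c₁ * (φ * p * (R / Fintype.card S) ^ 2) := by field_simp
      _ ≤ _ := by gcongr
  linarith

/-- The contraction is iterated on the column `P ^ t · y - π y`, which has mean zero at every `t`. A
pointwise bound costs the factor `1 / c₀`. -/
theorem pow_sub_sq_le [Nonempty S] {P : Matrix S S ℝ} {π : S → ℝ}
    (hPsum : ∀ x, ∑ y, P x y = 1) (hπ : IsInvariantDistribution P π)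
    {c₀ γ : ℝ} (hc₀ : 0 < c₀) (hπ0 : ∀ x, c₀ ≤ π x) (hγ : 0 ≤ 1 - γ)
    (hcon : ∀ f : S → ℝ, ∑ x, π x * f x = 0 →
      ∑ x, π x * (∑ y, P x y * f y) ^ 2 ≤ (1 - γ) * ∑ x, π x * f x ^ 2) (t : ℕ) (x y : S) :
    ((P ^ t) x y - π y) ^ 2 ≤ (1 - γ) ^ t / c₀ := by
  have key : ∀ t : ℕ, ∑ x, π x * ((P ^ t) x y - π y) = 0 ∧
      ∑ x, π x * ((P ^ t) x y - π y) ^ 2 ≤ (1 - γ) ^ t := by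
    intro t
    induction t with
    | zero =>
      have h1 : ∑ x, π x * ((P ^ 0) x y - π y) = 0 := by
        simp [mul_sub, Finset.sum_sub_distrib, Matrix.one_apply, ← Finset.sum_mul, hπ.sum_eq_one]
      refine ⟨h1, ?_⟩
      have hy1 : π y ≤ 1 := by
        rw [← hπ.sum_eq_one]
        exact Finset.single_le_sum (fun z _ => hπ.nonneg z) (Finset.mem_univ y)
      calc ∑ x, π x * ((P ^ 0) x y - π y) ^ 2 ≤ ∑ x, π x * 1 := by
            refine Finset.sum_le_sum fun x _ => mul_le_mul_of_nonneg_left ?_ (hπ.nonneg x)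
            have := hπ.nonneg y
            simp only [pow_zero, Matrix.one_apply]
            split_ifs <;> nlinarith
        _ = (1 - γ) ^ 0 := by simp [hπ.sum_eq_one]
    | succ t ih =>
      have e : ∀ x, (P ^ (t + 1)) x y - π y = ∑ z, P x z * ((P ^ t) z y - π y) := by
        intro x
        rw [pow_succ', Matrix.mul_apply]
        simp [mul_sub, Finset.sum_sub_distrib, ← Finset.sum_mul, hPsum]
      simp only [e]
      constructor
      · rw [← ih.1]
        simp only [Finset.mul_sum]
        rw [Finset.sum_comm]
        refine Finset.sum_congr rfl fun z _ => ?_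
        rw [← hπ.invariant z, Finset.sum_mul]
        exact Finset.sum_congr rfl fun x _ => by ring
      · calc _ ≤ (1 - γ) * ∑ x, π x * ((P ^ t) x y - π y) ^ 2 := hcon _ ih.1
          _ ≤ (1 - γ) * (1 - γ) ^ t := by gcongr; exact ih.2
          _ = _ := by ring
  rw [le_div_iff₀ hc₀]
  calc ((P ^ t) x y - π y) ^ 2 * c₀ ≤ π x * ((P ^ t) x y - π y) ^ 2 := by
        rw [mul_comm]; gcongr; exact hπ0 x
    _ ≤ ∑ x, π x * ((P ^ t) x y - π y) ^ 2 :=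
        Finset.single_le_sum (f := fun x => π x * ((P ^ t) x y - π y) ^ 2)
          (fun z _ => mul_nonneg (hπ.nonneg z) (sq_nonneg _)) (Finset.mem_univ x)
    _ ≤ _ := (key t).2

/-- The constant in the bound on the mixing time of a dominating chain. -/
def mixConst (N : ℕ) (c₀ c₁ δ p : ℝ) : ℝ :=
  Real.log (4 * N ^ 2 / c₀) / (δ * c₀ * c₁ * p / N ^ 2) + 1

theorem mixing_of_dominates [Nonempty S] {P Q : Matrix S S ℝ} {π πQ : S → ℝ}
    (hP : P ∈ Matrix.rowStochastic ℝ S) (hπ : IsInvariantDistribution P π)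
    (hQ : Q.IsIrreducible) (hQrow : ∀ x, ∑ y, Q x y = 1) (hπQ : IsInvariantDistribution Q πQ)
    {p c₀ c₁ δ : ℝ} (hp : 0 < p) (hp1 : p ≤ 1)
    (hπp : ∀ x, p ≤ πQ x) (hc₀ : 0 < c₀) (hc₁ : 0 < c₁) (hc₁1 : c₁ ≤ 1) (hδ : 0 < δ)
    (hπ0 : ∀ x, c₀ ≤ π x) (hPQ : ∀ x y, c₁ * Q x y ≤ P x y) (hPδ : ∀ x, δ ≤ P x x) :
    (∀ π', IsInvariantDistribution P π' → π' = π) ∧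
    ((mixingTime P π (1 / 4) : ℕ∞) : ℝ≥0∞) ≤
      ENNReal.ofReal (mixConst (Fintype.card S) c₀ c₁ δ p) / cheeger Q πQ := by
  have hP0 : ∀ x y, 0 ≤ P x y := hP.1
  have hPsum : ∀ x, ∑ y, P x y = 1 := Matrix.sum_row_of_mem_rowStochastic hP
  set N := Fintype.card S with hNdef
  have hN : (1 : ℝ) ≤ N := by exact_mod_cast Fintype.card_pos
  have hπp0 : ∀ x, 0 < πQ x := fun x => hp.trans_le (hπp x)
  -- With one state no set has mass in `(0, 1/2]`, so the Cheeger constant is `⊤` and the right side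
  -- is zero: the mixing time has to vanish.
  rcases subsingleton_or_nontrivial S with hS | hS
  · have hone : ∀ π', IsInvariantDistribution P π' → π' = fun _ => 1 := by
      intro π' h
      funext x
      have := h.sum_eq_one
      rwa [Fintype.sum_subsingleton _ x] at this
    refine ⟨fun π' h => (hone π' h).trans (hone π hπ).symm, ?_⟩
    have : mixingTime P π (1 / 4) = 0 := by
      refine le_antisymm ?_ bot_le
      refine iInf₂_le_of_le 0 (fun x => ?_) (by simp)
      rw [hone π hπ]
      simp only [tvDist, Fintype.sum_subsingleton _ x, pow_zero, Matrix.one_apply_eq]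
      norm_num
    rw [this]
    simp
  have hcard2 : (2 : ℝ) ≤ N := by exact_mod_cast Fintype.one_lt_card (α := S)
  -- the conductance as a real number
  have hex : ∃ φ : ℝ, 0 < φ ∧ φ ≤ 1 ∧ cheeger Q πQ = ENNReal.ofReal φ ∧
      ∀ A : Finset S, 0 < ∑ x ∈ A, πQ x → ∑ x ∈ A, πQ x ≤ 1 / 2 →
      φ * ∑ x ∈ A, πQ x ≤ ∑ x ∈ A, ∑ y ∈ Aᶜ, πQ x * Q x y := by
    set g : Finset S → ℝ := fun A => (∑ x ∈ A, ∑ y ∈ Aᶜ, πQ x * Q x y) / ∑ x ∈ A, πQ x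
    set F : Finset (Finset S) := Finset.univ.filter
      fun A => 0 < ∑ x ∈ A, πQ x ∧ ∑ x ∈ A, πQ x ≤ 1 / 2
    have hF : F.Nonempty := by
      obtain ⟨x, y, hxy⟩ := exists_pair_ne S
      have h2 : πQ x + πQ y ≤ 1 := by
        rw [← hπQ.sum_eq_one, ← Finset.sum_pair hxy]
        exact Finset.sum_le_sum_of_subset_of_nonneg (Finset.subset_univ _)
          fun z _ _ => hπQ.nonneg z
      rcases le_total (πQ x) (1 / 2) with h | h
      · exact ⟨{x}, by simp only [F, Finset.mem_filter, Finset.sum_singleton]; simp [hπp0]; linarith⟩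
      · exact ⟨{y}, by simp only [F, Finset.mem_filter, Finset.sum_singleton]; simp [hπp0]; linarith⟩
    obtain ⟨B, hBF, hB⟩ := Finset.exists_min_image F g hF
    have hB' : 0 < ∑ x ∈ B, πQ x ∧ ∑ x ∈ B, πQ x ≤ 1 / 2 := by simpa [F] using hBF
    have hnn : ∀ x y, 0 ≤ πQ x * Q x y := fun x y => mul_nonneg (hπp0 x).le (hQ.nonneg x y)
    refine ⟨g B, ?_, ?_, ?_, ?_⟩
    -- A minimising set without outgoing flow would be closed under `Q`, hence the whole space, of
    -- mass `1 > 1/2`.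
    · refine div_pos ?_ hB'.1
      by_contra hcon
      have h0 : ∑ x ∈ B, ∑ y ∈ Bᶜ, πQ x * Q x y = 0 := le_antisymm (not_lt.1 hcon)
        (Finset.sum_nonneg fun x _ => Finset.sum_nonneg fun y _ => hnn x y)
      have hBne : B.Nonempty := by
        rw [Finset.nonempty_iff_ne_empty]; rintro rfl; simp at hB'
      have hall := mem_of_closed_of_isIrreducible hQ (A := (B : Set S)) hBne (by
        intro x hx y hxy
        by_contra hy
        have h1 := (Finset.sum_eq_zero_iff_of_nonneg
          (fun x _ => Finset.sum_nonneg fun y _ => hnn x y)).1 h0 x hx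
        have h2 := (Finset.sum_eq_zero_iff_of_nonneg (fun y _ => hnn x y)).1 h1 y
          (by simpa using hy)
        exact (mul_pos (hπp0 x) hxy).ne' h2)
      have : B = Finset.univ := Finset.eq_univ_iff_forall.2 fun x => hall x
      rw [this, hπQ.sum_eq_one] at hB'
      linarith [hB'.2]
    · rw [div_le_one hB'.1]
      refine Finset.sum_le_sum fun x _ => ?_
      rw [← Finset.mul_sum]
      refine mul_le_of_le_one_right (hπp0 x).le ?_
      rw [← hQrow x]
      exact Finset.sum_le_sum_of_subset_of_nonneg (Finset.subset_univ _)
        fun y _ _ => hQ.nonneg x y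
    · refine le_antisymm ?_ ?_
      · exact iInf₂_le_of_le B hB'.1 (iInf_le_of_le hB'.2 le_rfl)
      · refine le_iInf fun A => le_iInf fun h1 => le_iInf fun h2 => ?_
        exact ENNReal.ofReal_le_ofReal (hB A (by simp [F, h1]; linarith))
    · intro A h1 h2
      have := hB A (by simp [F, h1]; linarith)
      rwa [le_div_iff₀ h1] at this
  obtain ⟨φ, hφ0, hφ1, hcφ, hφ⟩ := hex
  set γ₀ := δ * c₀ * c₁ * p / (N : ℝ) ^ 2 with hγ₀
  have hγ₀pos : 0 < γ₀ := by positivity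
  have hc₀1 : c₀ ≤ 1 := by
    obtain ⟨x⟩ := (inferInstance : Nonempty S)
    refine (hπ0 x).trans ?_
    rw [← hπ.sum_eq_one]
    exact Finset.single_le_sum (fun z _ => hπ.nonneg z) (Finset.mem_univ x)
  have hδ1 : δ ≤ 1 := by
    obtain ⟨x⟩ := (inferInstance : Nonempty S)
    refine (hPδ x).trans ?_
    rw [← hPsum x]
    exact Finset.single_le_sum (fun z _ => hP0 x z) (Finset.mem_univ x)
  have hγ1 : γ₀ ≤ 1 := by
    rw [hγ₀, div_le_one (by positivity)]
    calc δ * c₀ * c₁ * p ≤ 1 * 1 * 1 * 1 := by gcongr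
      _ ≤ (N : ℝ) ^ 2 := by nlinarith
  set γ := γ₀ * φ
  have hγpos : 0 < γ := mul_pos hγ₀pos hφ0
  have hγle : γ ≤ 1 := mul_le_one₀ hγ1 hφ0.le hφ1
  have hbound := pow_sub_sq_le hPsum hπ hc₀ hπ0 (sub_nonneg.2 hγle)
    (fun f hf => variance_contraction hP0 hPsum hπ hQ.nonneg hπQ.sum_eq_one hφ0.le hp hπp hc₀
      hc₁ hδ hπ0 hPQ hPδ hφ f hf)
  constructor
  · intro π' h
    have hpow : ∀ (t : ℕ) y, ∑ x, π' x * (P ^ t) x y = π' y := by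
      intro t
      induction t with
      | zero => intro y; simp [Matrix.one_apply]
      | succ t ih =>
        intro y
        calc ∑ x, π' x * (P ^ (t + 1)) x y = ∑ z, (∑ x, π' x * (P ^ t) x z) * P z y := by
              simp only [pow_succ, Matrix.mul_apply, Finset.mul_sum, Finset.sum_mul]
              rw [Finset.sum_comm]
              exact Finset.sum_congr rfl fun z _ => Finset.sum_congr rfl fun x _ => by ring
          _ = π' y := by simp only [ih, h.invariant]
    funext y
    have hle : ∀ t : ℕ, |π' y - π y| ≤ Real.sqrt ((1 - γ) ^ t / c₀) := by
      intro t
      have e : π' y - π y = ∑ x, π' x * ((P ^ t) x y - π y) := by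
        simp [mul_sub, Finset.sum_sub_distrib, ← Finset.sum_mul, h.sum_eq_one, hpow]
      rw [e]
      calc |∑ x, π' x * ((P ^ t) x y - π y)| ≤ ∑ x, |π' x * ((P ^ t) x y - π y)| :=
            Finset.abs_sum_le_sum_abs _ _
        _ ≤ ∑ x, π' x * Real.sqrt ((1 - γ) ^ t / c₀) := by
            refine Finset.sum_le_sum fun x _ => ?_
            rw [abs_mul, abs_of_nonneg (h.nonneg x)]
            refine mul_le_mul_of_nonneg_left ?_ (h.nonneg x)
            exact Real.abs_le_sqrt (hbound t x y)
        _ = _ := by rw [← Finset.sum_mul, h.sum_eq_one, one_mul]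
    have hlim : Filter.Tendsto (fun t : ℕ => Real.sqrt ((1 - γ) ^ t / c₀)) Filter.atTop
        (nhds 0) := by
      have := ((tendsto_pow_atTop_nhds_zero_of_lt_one (sub_nonneg.2 hγle)
        (by linarith : 1 - γ < 1)).div_const c₀).sqrt
      simpa using this
    have : |π' y - π y| ≤ 0 := ge_of_tendsto' hlim hle
    exact sub_eq_zero.1 (abs_eq_zero.1 (le_antisymm this (abs_nonneg _)))
  · set L := Real.log (4 * (N : ℝ) ^ 2 / c₀) with hL
    have hLpos : 0 ≤ L := by
      refine Real.log_nonneg ?_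
      rw [one_le_div hc₀]
      nlinarith
    set t := ⌈L / γ⌉₊
    have ht : L ≤ γ * t := by
      have := Nat.le_ceil (L / γ)
      rwa [div_le_iff₀' hγpos] at this
    -- With this choice every entry of `P ^ t` is within `1 / (2 N)` of `π`, so the total variation
    -- distance is at most `1/4`.
    have hpow : (1 - γ) ^ t ≤ c₀ / (4 * (N : ℝ) ^ 2) := by
      calc (1 - γ) ^ t ≤ (Real.exp (-γ)) ^ t := by
            refine pow_le_pow_left₀ (by linarith) ?_ t
            linarith [Real.add_one_le_exp (-γ)]
        _ = Real.exp (-(γ * t)) := by rw [← Real.exp_nat_mul]; congr 1; ring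
        _ ≤ Real.exp (-L) := by gcongr
        _ = c₀ / (4 * (N : ℝ) ^ 2) := by
            rw [Real.exp_neg, hL, Real.exp_log (by positivity), inv_div]
    have hmix : mixingTime P π (1 / 4) ≤ t := by
      refine iInf₂_le_of_le t (fun x => ?_) le_rfl
      have h1 : ∀ y, |(P ^ t) x y - π y| ≤ 1 / (2 * N) := by
        intro y
        refine abs_le_of_sq_le_sq ?_ (by positivity)
        calc ((P ^ t) x y - π y) ^ 2 ≤ (1 - γ) ^ t / c₀ := hbound t x y
          _ ≤ c₀ / (4 * (N : ℝ) ^ 2) / c₀ := by gcongr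
          _ = (1 / (2 * (N : ℝ))) ^ 2 := by field_simp; norm_num
      calc tvDist ((P ^ t) x) π ≤ 1 / 2 * ∑ _y : S, 1 / (2 * (N : ℝ)) := by
            unfold tvDist
            gcongr with y
            exact h1 y
        _ = 1 / 4 := by
            rw [Finset.sum_const, Finset.card_univ, ← hNdef, nsmul_eq_mul]
            field_simp
            norm_num
    calc ((mixingTime P π (1 / 4) : ℕ∞) : ℝ≥0∞) ≤ ((t : ℕ∞) : ℝ≥0∞) := by exact_mod_cast hmix
      _ = ENNReal.ofReal t := by simp
      _ ≤ ENNReal.ofReal (mixConst N c₀ c₁ δ p / φ) := by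
          refine ENNReal.ofReal_le_ofReal ?_
          have h1 := (Nat.ceil_lt_add_one (div_nonneg hLpos hγpos.le)).le
          -- Rounding up costs `1 ≤ 1 / φ`, which is the summand `1` in `mixConst`.
          calc (t : ℝ) ≤ L / γ + 1 := h1
            _ ≤ L / γ + 1 / φ := by gcongr; rw [one_le_div hφ0]; exact hφ1
            _ = mixConst N c₀ c₁ δ p / φ := by
                unfold mixConst
                rw [← hγ₀, ← hL]
                simp only [γ]
                field_simp
      _ = _ := by rw [hcφ, ENNReal.ofReal_div_of_pos hφ0]

end FiniteChain

/-! ### Trees with a general pair of root types and the walk with an exit above the root -/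

section Walk

variable {m : ℕ}

/-- (type of the parent, type) of a node. -/
abbrev Pair (m : ℕ) := Option (Fin m) × Fin m

/-- The pair of types of a node, in the tree whose root has the pair `p`. -/
def tp (p : Pair m) (ω : Reservoir m) : Node → Pair m
  | [] => p
  | k :: u => (some (tp p ω u).2, (ω (u, tp p ω u)).getD k (tp p ω u).2)

/-- The reservoir of the subtree at `v`. -/
def shift (v : Node) (ω : Reservoir m) : Reservoir m := fun x => ω (x.1 ++ v, x.2)

/-- The randomness of the walk after time `t`. -/
def seedShift (t : ℕ) (ξ : WalkSeed) : WalkSeed :=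
  (fun s => ξ.1 (t + s), fun q => ξ.2 (t + q.1, q.2))

/-- The list of the types of the children of a node. -/
def kids (p : Pair m) (ω : Reservoir m) (u : Node) : List (Fin m) := ω (u, tp p ω u)

/-- The parent of a node; `none` stands for the parent of the root. -/
def up : Node → Option Node
  | [] => none
  | _ :: u => some u

/-- The neighbours of a node; the root has the additional neighbour `none` if it has a parent. -/
def nbrs (p : Pair m) (ω : Reservoir m) (u : Node) : List (Option Node) :=
  (List.range (kids p ω u).length).map (fun k => some (k :: u)) ++
    (if u = [] ∧ p.1 = none then [] else [up u])

/-- One step of the walk, which is absorbed at `none`. -/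
def move (p : Pair m) (ω : Reservoir m) (b : Bool) (c : (d : ℕ) → Fin (d + 1)) :
    Option Node → Option Node
  | none => none
  | some u => if b then some u
      else (nbrs p ω u).getD (c ((nbrs p ω u).length - 1)) (some u)

/-- The position at time `t` of the walk started from `o`. -/
def pos (p : Pair m) (ω : Reservoir m) (ξ : WalkSeed) (o : Option Node) : ℕ → Option Node
  | 0 => o
  | t + 1 => move p ω (ξ.1 t) (fun d => ξ.2 (t, d)) (pos p ω ξ o t)

/-- Positions in the subtree at `v` as positions in the tree. -/
def lift (v : Node) : Option Node → Option Node
  | none => up v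
  | some a => some (a ++ v)

/-- The position `o` is in the subtree at `v`. -/
def InSub (v : Node) (o : Option Node) : Prop := ∃ u, o = some u ∧ v <:+ u

variable {p : Pair m} {ω ω₂ : Reservoir m} {ξ ξ₂ : WalkSeed} {o : Option Node} {u v w a : Node}
  {t t₁ t₂ s : ℕ}

theorem typePair_eq_tp (r : Fin m) (ω : Reservoir m) (u : Node) :
    typePair r ω u = tp (none, r) ω u := by
  induction u with
  | nil => rfl
  | cons k u ih => simp only [typePair, tp, ih]

theorem tp_append (p : Pair m) (ω : Reservoir m) (u v : Node) :
    tp p ω (u ++ v) = tp (tp p ω v) (shift v ω) u := by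
  induction u with
  | nil => rfl
  | cons k u ih => simp only [List.cons_append, tp, ih, shift]

theorem shift_append (u v : Node) (ω : Reservoir m) : shift (u ++ v) ω = shift u (shift v ω) := by
  funext x; simp [shift, List.append_assoc]

theorem seedShift_add (t s : ℕ) (ξ : WalkSeed) :
    seedShift (t + s) ξ = seedShift s (seedShift t ξ) := by
  unfold seedShift
  refine Prod.ext ?_ ?_
  · funext x; simp [add_assoc]
  · funext x
    have key : ∀ y z : ℕ, y = z →
        @Eq (Fin (x.2 + 1)) (ξ.2 (y, x.2)) (ξ.2 (z, x.2)) := by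
      rintro y z rfl; rfl
    exact key _ _ (add_assoc _ _ _)

theorem kids_append (p : Pair m) (ω : Reservoir m) (u v : Node) :
    kids p ω (u ++ v) = kids (tp p ω v) (shift v ω) u := by
  simp only [kids, tp_append, shift]

/-- The subtree at `v` is a tree of the same kind, whose exit `none` becomes the parent of `v`. This
self-similarity is the reason for walks with an exit above the root. -/
theorem nbrs_append (p : Pair m) (ω : Reservoir m) (u v : Node) :
    nbrs p ω (u ++ v) = (nbrs (tp p ω v) (shift v ω) u).map (lift v) := by
  unfold nbrs
  rw [kids_append, List.map_append, List.map_map]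
  congr 1
  cases v with
  | nil =>
    rw [List.append_nil]
    by_cases h : u = [] ∧ p.1 = none
    · rw [if_pos h, if_pos (show u = [] ∧ (tp p ω []).1 = none from h)]; rfl
    · rw [if_neg h, if_neg (show ¬ (u = [] ∧ (tp p ω []).1 = none) from h)]
      cases u <;> simp [lift, up]
  | cons k v => cases u <;> simp [lift, up, tp]

theorem move_lift (b : Bool) (c : (d : ℕ) → Fin (d + 1)) (a v : Node) :
    move p ω b c (some (a ++ v)) = lift v (move (tp p ω v) (shift v ω) b c (some a)) := by
  simp only [move]
  split_ifs
  · rfl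
  · rw [nbrs_append, List.length_map]
    rw [show some (a ++ v) = lift v (some a) from rfl, List.getD_map]

theorem pos_none (p : Pair m) (ω : Reservoir m) (ξ : WalkSeed) (t : ℕ) :
    pos p ω ξ none t = none := by
  induction t with
  | zero => rfl
  | succ t ih => simp [pos, ih, move]

theorem pos_add (p : Pair m) (ω : Reservoir m) (ξ : WalkSeed) (o : Option Node) (t s : ℕ) :
    pos p ω ξ o (t + s) = pos p ω (seedShift t ξ) (pos p ω ξ o t) s := by
  induction s with
  | zero => rfl
  | succ s ih =>
    rw [← add_assoc]
    simp only [pos, ih]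
    rfl

theorem pos_ne_none_of_le (h : pos p ω ξ o t ≠ none) (hs : s ≤ t) : pos p ω ξ o s ≠ none := by
  intro h0
  obtain ⟨r, rfl⟩ := Nat.exists_eq_add_of_le hs
  rw [pos_add, h0, pos_none] at h
  exact h rfl

theorem up_not_inSub (v : Node) : ¬ InSub v (up v) := by
  rintro ⟨u, hu, hv⟩
  cases v with
  | nil => simp [up] at hu
  | cons k v =>
    simp only [up, Option.some.injEq] at hu
    subst hu
    have := hv.length_le
    simp at this

theorem inSub_lift_iff {o : Option Node} : InSub v (lift v o) ↔ o ≠ none := by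
  cases o with
  | none => simp [lift, up_not_inSub v]
  | some a => simp [lift, InSub]

theorem lift_eq_some_append {o : Option Node} (ho : o ≠ none) :
    lift v o = some (a ++ v) ↔ o = some a := by
  cases o with
  | none => exact absurd rfl ho
  | some b => simp [lift]

theorem InSub.of_suffix (h : InSub w o) (hs : v <:+ w) : InSub v o := by
  obtain ⟨u, hu, hw⟩ := h
  exact ⟨u, hu, hs.trans hw⟩

theorem inSub_some : InSub v (some u) ↔ v <:+ u := by simp [InSub]

/-- With a common seed the walk in the subtree and the walk in the tree move together until the
former is absorbed at its exit. -/
theorem pos_eq_lift (h : pos (tp p ω v) (shift v ω) ξ (some a) t ≠ none) :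
    pos p ω ξ (some (a ++ v)) t = lift v (pos (tp p ω v) (shift v ω) ξ (some a) t) := by
  induction t with
  | zero => rfl
  | succ t ih =>
    have h' := pos_ne_none_of_le h (Nat.le_succ t)
    obtain ⟨b, hb⟩ := Option.ne_none_iff_exists'.1 h'
    simp only [pos, ih h', hb]
    exact move_lift _ _ b v

theorem forall_inSub_iff : (∀ s ≤ t, InSub v (pos p ω ξ (some (a ++ v)) s)) ↔
    pos (tp p ω v) (shift v ω) ξ (some a) t ≠ none := by
  constructor
  · intro h
    induction t with
    | zero => simp [pos]
    | succ t ih =>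
      intro h0
      have h' := ih fun s hs => h s (by omega)
      have h1 := h (t + 1) le_rfl
      obtain ⟨b, hb⟩ := Option.ne_none_iff_exists'.1 h'
      simp only [pos, hb] at h0
      simp only [pos, pos_eq_lift h', hb, lift] at h1
      rw [move_lift, h0] at h1
      exact up_not_inSub v h1
  · intro h s hs
    have h' := pos_ne_none_of_le h hs
    rw [pos_eq_lift h', inSub_lift_iff]
    exact h'

theorem move_cases (p : Pair m) (ω : Reservoir m) (b : Bool) (c : (d : ℕ) → Fin (d + 1))
    (u : Node) :
    move p ω b c (some u) = some u ∨ (∃ k, move p ω b c (some u) = some (k :: u)) ∨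
      move p ω b c (some u) = up u := by
  simp only [move]
  split_ifs
  · exact Or.inl rfl
  · set i := (c ((nbrs p ω u).length - 1) : ℕ)
    by_cases hi : i < (nbrs p ω u).length
    · right
      have hmem := List.getElem_mem hi
      rw [List.getD_eq_getElem _ _ hi]
      set x := (nbrs p ω u)[i]
      unfold nbrs at hmem
      simp only [List.mem_append, List.mem_map] at hmem
      rcases hmem with ⟨k, -, hk⟩ | h
      · exact Or.inl ⟨k, hk.symm⟩
      · right
        split_ifs at h
        · simp at h
        · simpa using h
    · left
      rw [List.getD_eq_default _ _ (not_lt.1 hi)]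

/-- In a tree the edge from `up v` to `v` is the only way into the subtree at `v`. -/
theorem eq_of_enter {b : Bool} {c : (d : ℕ) → Fin (d + 1)} (h0 : ¬ InSub v o)
    (h1 : InSub v (move p ω b c o)) : move p ω b c o = some v ∧ o = up v := by
  cases o with
  | none => simp [move, InSub] at h1
  | some u =>
    rw [inSub_some] at h0
    rcases move_cases p ω b c u with h | ⟨k, h⟩ | h
    · rw [h, inSub_some] at h1
      exact absurd h1 h0
    · rw [h, inSub_some] at h1
      rcases List.suffix_cons_iff.1 h1 with h2 | h2
      · rw [h, h2]; exact ⟨rfl, rfl⟩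
      · exact absurd h2 h0
    · rw [h] at h1
      cases u with
      | nil => simp [up, InSub] at h1
      | cons k u =>
        rw [up, inSub_some] at h1
        exact absurd (h1.trans (List.suffix_cons k u)) h0

/-- The walk from the root enters the subtree at `v` through `v`. -/
theorem exists_pos_eq_of_inSub (h : InSub v (pos p ω ξ (some []) t)) :
    ∃ s ≤ t, pos p ω ξ (some []) s = some v := by
  induction t with
  | zero =>
    refine ⟨0, le_rfl, ?_⟩
    simp only [pos, inSub_some, List.suffix_nil] at h
    rw [h]; rfl
  | succ t ih =>
    by_cases h' : InSub v (pos p ω ξ (some []) t)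
    · obtain ⟨s, hs, e⟩ := ih h'
      exact ⟨s, by omega, e⟩
    · exact ⟨t + 1, le_rfl, (eq_of_enter h' h).1⟩

/-- `v` is visited for the first time at time `t`. -/
def FirstHit (p : Pair m) (ω : Reservoir m) (ξ : WalkSeed) (v : Node) (t : ℕ) : Prop :=
  pos p ω ξ (some []) t = some v ∧ ∀ s < t, pos p ω ξ (some []) s ≠ some v

theorem FirstHit.not_inSub (h : FirstHit p ω ξ v t) (hs : s < t) :
    ¬ InSub v (pos p ω ξ (some []) s) := fun hin => by
  obtain ⟨r, hr, e⟩ := exists_pos_eq_of_inSub hin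
  exact h.2 r (by omega) e

theorem FirstHit.unique (h : FirstHit p ω ξ v t) (h' : FirstHit p ω ξ v s) : t = s := by
  rcases lt_trichotomy t s with hlt | heq | hlt
  · exact absurd h.1 (h'.2 t hlt)
  · exact heq
  · exact absurd h'.1 (h.2 s hlt)

/-- The walk visits `w` for the first time at time `t₁` and stays in its subtree until `t`. -/
def CutUpTo (p : Pair m) (ω : Reservoir m) (ξ : WalkSeed) (w : Node) (t₁ t : ℕ) : Prop :=
  FirstHit p ω ξ w t₁ ∧ ∀ s, t₁ ≤ s → s ≤ t → InSub w (pos p ω ξ (some []) s)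

/-- Properties of nodes that depend on the types of the parent and of the node. -/
abbrev Mark (m : ℕ) := Pair m → Pair m → Prop

/-- The node has the property `P`. -/
def Marked (P : Mark m) (p : Pair m) (ω : Reservoir m) : Node → Prop
  | [] => False
  | k :: u => P (tp p ω u) (tp p ω (k :: u))

theorem Marked.mono {S R : Mark m} (h : ∀ x y, S x y → R x y) {u : Node}
    (hu : Marked S p ω u) : Marked R p ω u := by
  cases u with
  | nil => exact hu
  | cons k u => exact h _ _ hu

theorem marked_append (P : Mark m) (ha : a ≠ []) :
    Marked P p ω (a ++ v) ↔ Marked P (tp p ω v) (shift v ω) a := by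
  cases a with
  | nil => exact absurd rfl ha
  | cons k a =>
    simp only [List.cons_append, Marked]
    rw [← List.cons_append, tp_append, tp_append]

/-- The node `v` of depth larger than `K` has the property `P` and is visited for the first time
at time `t`, and up to this time the walk has no node with the property `S`, of depth larger
than `K`, in whose subtree it stayed since its first visit. -/
def Past (K : ℕ) (S P : Mark m) (p : Pair m) (ω : Reservoir m) (ξ : WalkSeed) (v : Node)
    (t : ℕ) : Prop :=
  FirstHit p ω ξ v t ∧ K < v.length ∧ Marked P p ω v ∧
    ∀ w t₁, t₁ < t → K < w.length → Marked S p ω w → ¬ CutUpTo p ω ξ w t₁ t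

/-- Two samples agree outside the subtree of `v` and before time `t`. -/
structure Agree (v : Node) (t : ℕ) (ω ω₂ : Reservoir m) (ξ ξ₂ : WalkSeed) : Prop where
  out : ∀ u q, ¬ v <:+ u → ω (u, q) = ω₂ (u, q)
  coin : ∀ s < t, ξ.1 s = ξ₂.1 s
  choice : ∀ s < t, ∀ d, ξ.2 (s, d) = ξ₂.2 (s, d)

theorem Agree.symm (h : Agree v t ω ω₂ ξ ξ₂) : Agree v t ω₂ ω ξ₂ ξ :=
  ⟨fun u q hu => (h.out u q hu).symm, fun s hs => (h.coin s hs).symm,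
    fun s hs d => (h.choice s hs d).symm⟩

theorem Agree.tp_eq (h : Agree v t ω ω₂ ξ ξ₂) (p : Pair m) {u : Node}
    (hu : u = v ∨ ¬ v <:+ u) : tp p ω u = tp p ω₂ u := by
  induction u with
  | nil => rfl
  | cons k u ih =>
    have hn : ¬ v <:+ u := by
      rcases hu with rfl | hu
      · intro hs
        have := hs.length_le
        simp at this
      · exact fun hs => hu (hs.trans (List.suffix_cons k u))
    simp only [tp, ← ih (Or.inr hn), h.out _ _ hn]

theorem Agree.pos_eq (h : Agree v t ω ω₂ ξ ξ₂) (p : Pair m) {n : ℕ} (hn : n ≤ t)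
    (hs : ∀ s < n, ¬ InSub v (pos p ω ξ o s)) : pos p ω ξ o n = pos p ω₂ ξ₂ o n := by
  induction n with
  | zero => rfl
  | succ n ih =>
    have e := ih (by omega) fun s hs' => hs s (by omega)
    have hin := hs n (by omega)
    simp only [pos, ← e]
    cases hx : pos p ω ξ o n with
    | none => rfl
    | some u =>
      rw [hx, inSub_some] at hin
      have e1 : kids p ω u = kids p ω₂ u := by
        simp only [kids, ← h.tp_eq p (Or.inr hin), h.out _ _ hin]
      have e2 : nbrs p ω u = nbrs p ω₂ u := by simp only [nbrs, e1]
      simp only [move, h.coin n (by omega), h.choice n (by omega)]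
      rw [e2]

theorem Agree.firstHit (h : Agree v t ω ω₂ ξ ξ₂) (hv : FirstHit p ω ξ v t) :
    FirstHit p ω₂ ξ₂ v t ∧ ∀ s ≤ t, pos p ω ξ (some []) s = pos p ω₂ ξ₂ (some []) s := by
  have e : ∀ s ≤ t, pos p ω ξ (some []) s = pos p ω₂ ξ₂ (some []) s := fun s hs =>
    h.pos_eq p hs fun r hr => hv.not_inSub (by omega)
  exact ⟨⟨(e t le_rfl).symm.trans hv.1, fun s hs => by rw [← e s hs.le]; exact hv.2 s hs⟩, e⟩

/-- The event is decided by what has been explored: before the first visit to `v` the walk has used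
only offspring outside the subtree of `v`, and a competing node `w` is a strict ancestor of `v`,
whose types are fixed there too. -/
theorem Agree.past {K : ℕ} {S P : Mark m} (h : Agree v t ω ω₂ ξ ξ₂)
    (hv : Past K S P p ω ξ v t) : Past K S P p ω₂ ξ₂ v t := by
  obtain ⟨hf, hK, hP, hS⟩ := hv
  obtain ⟨hf₂, e⟩ := h.firstHit hf
  refine ⟨hf₂, hK, ?_, ?_⟩
  · cases v with
    | nil => exact hP
    | cons k v =>
      simp only [Marked] at hP ⊢
      rwa [← h.tp_eq p (Or.inl rfl), ← h.tp_eq p (Or.inr _)]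
      intro hs
      have := hs.length_le
      simp at this
  · intro w t₁ ht hw hSw hc
    have hwv : w <:+ v := by
      have := hc.2 t ht.le le_rfl
      rwa [hf₂.1, inSub_some] at this
    have hne : w ≠ v := by
      rintro rfl
      exact hf₂.2 t₁ ht hc.1.1
    have hlen : ∀ u, u <:+ w → ¬ v <:+ u := fun u hu hvu =>
      hne (hwv.eq_of_length_le ((hvu.trans hu).length_le))
    refine hS w t₁ ht hw ?_ ⟨⟨by rw [e t₁ ht.le]; exact hc.1.1,
      fun s hs => by rw [e s (by omega)]; exact hc.1.2 s hs⟩,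
      fun s h1 h2 => by rw [e s h2]; exact hc.2 s h1 h2⟩
    cases w with
    | nil => exact hSw
    | cons k w =>
      simp only [Marked] at hSw ⊢
      rwa [h.tp_eq p (Or.inr (hlen _ (List.suffix_refl _))),
        h.tp_eq p (Or.inr (hlen _ (List.suffix_cons k w)))]

/-! ### Restarting the walk at a first visit -/

theorem FirstHit.pos_add (h : FirstHit p ω ξ v t) (s : ℕ) :
    pos p ω ξ (some []) (t + s) = pos p ω (seedShift t ξ) (some ([] ++ v)) s := by
  rw [MultiCommunity.pos_add, h.1]; rfl

theorem FirstHit.stay_iff (h : FirstHit p ω ξ v t) {n : ℕ} :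
    (∀ s, t ≤ s → s ≤ t + n → InSub v (pos p ω ξ (some []) s)) ↔
      pos (tp p ω v) (shift v ω) (seedShift t ξ) (some []) n ≠ none := by
  rw [← forall_inSub_iff]
  constructor
  · intro h' s hs
    rw [← h.pos_add]
    exact h' _ (by omega) (by omega)
  · intro h' s h1 h2
    obtain ⟨r, rfl⟩ := Nat.exists_eq_add_of_le h1
    rw [h.pos_add]
    exact h' r (by omega)

theorem FirstHit.pos_eq_some_iff (h : FirstHit p ω ξ v t) {n : ℕ}
    (hn : pos (tp p ω v) (shift v ω) (seedShift t ξ) (some []) n ≠ none) :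
    pos p ω ξ (some []) (t + n) = some (a ++ v) ↔
      pos (tp p ω v) (shift v ω) (seedShift t ξ) (some []) n = some a := by
  rw [h.pos_add, pos_eq_lift hn, lift_eq_some_append hn]

theorem FirstHit.inSub_iff (h : FirstHit p ω ξ v t) {n : ℕ}
    (hn : pos (tp p ω v) (shift v ω) (seedShift t ξ) (some []) n ≠ none) :
    InSub (a ++ v) (pos p ω ξ (some []) (t + n)) ↔
      InSub a (pos (tp p ω v) (shift v ω) (seedShift t ξ) (some []) n) := by
  obtain ⟨b, hb⟩ := Option.ne_none_iff_exists'.1 hn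
  rw [(h.pos_eq_some_iff hn).2 hb, hb, inSub_some, inSub_some]
  constructor
  · rintro ⟨l, hl⟩
    exact ⟨l, by simpa [← List.append_assoc] using hl⟩
  · rintro ⟨l, rfl⟩
    exact ⟨l, by simp⟩

theorem FirstHit.shift_iff (h : FirstHit p ω ξ v t) {n : ℕ} :
    FirstHit (tp p ω v) (shift v ω) (seedShift t ξ) a n ↔
      FirstHit p ω ξ (a ++ v) (t + n) ∧
        pos (tp p ω v) (shift v ω) (seedShift t ξ) (some []) n ≠ none := by
  constructor
  · intro ha
    have hne : pos (tp p ω v) (shift v ω) (seedShift t ξ) (some []) n ≠ none := by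
      rw [ha.1]; simp
    refine ⟨⟨(h.pos_eq_some_iff hne).2 ha.1, fun s hs e => ?_⟩, hne⟩
    rcases lt_or_ge s t with hlt | hge
    · exact h.not_inSub hlt (e ▸ ⟨_, rfl, List.suffix_append a v⟩)
    · obtain ⟨r, rfl⟩ := Nat.exists_eq_add_of_le hge
      exact ha.2 r (by omega) ((h.pos_eq_some_iff (pos_ne_none_of_le hne (by omega))).1 e)
  · rintro ⟨ha, hne⟩
    refine ⟨(h.pos_eq_some_iff hne).1 ha.1, fun s hs e => ?_⟩
    exact ha.2 (t + s) (by omega)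
      ((h.pos_eq_some_iff (pos_ne_none_of_le hne hs.le)).2 e)

theorem FirstHit.cutUpTo_shift_iff (h : FirstHit p ω ξ v t) {s₁ n : ℕ} (hs : s₁ ≤ n) :
    CutUpTo (tp p ω v) (shift v ω) (seedShift t ξ) a s₁ n ↔
      CutUpTo p ω ξ (a ++ v) (t + s₁) (t + n) ∧
        pos (tp p ω v) (shift v ω) (seedShift t ξ) (some []) n ≠ none := by
  constructor
  · intro ha
    have hne : pos (tp p ω v) (shift v ω) (seedShift t ξ) (some []) n ≠ none := by
      obtain ⟨u, hu, -⟩ := ha.2 n hs le_rfl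
      rw [hu]; simp
    refine ⟨⟨(h.shift_iff.1 ha.1).1, fun s h1 h2 => ?_⟩, hne⟩
    obtain ⟨r, rfl⟩ := Nat.exists_eq_add_of_le (show t ≤ s by omega)
    exact (h.inSub_iff (pos_ne_none_of_le hne (by omega))).2 (ha.2 r (by omega) (by omega))
  · rintro ⟨ha, hne⟩
    refine ⟨h.shift_iff.2 ⟨ha.1, pos_ne_none_of_le hne hs⟩, fun s h1 h2 => ?_⟩
    exact (h.inSub_iff (pos_ne_none_of_le hne h2)).1 (ha.2 _ (by omega) (by omega))

theorem CutUpTo.suffix (h : CutUpTo p ω ξ w t₁ t) (ht : t₁ ≤ t)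
    (hv : pos p ω ξ (some []) t = some v) : w <:+ v := by
  have := h.2 t ht le_rfl
  rwa [hv, inSub_some] at this

theorem CutUpTo.extend (h : CutUpTo p ω ξ w t₁ t) (ht : t₁ ≤ t)
    (h' : CutUpTo p ω ξ v t t₂) : CutUpTo p ω ξ w t₁ t₂ := by
  refine ⟨h.1, fun s h1 h2 => ?_⟩
  rcases le_total s t with hs | hs
  · exact h.2 s h1 hs
  · exact (h'.2 s hs h2).of_suffix (h.suffix ht h'.1.1)

/-- Decomposition at the first node with the property `R` in whose subtree the walk stays. -/
theorem past_iff {S R P : Mark m} (hSR : ∀ x y, S x y → R x y) :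
    Past 0 S P p ω ξ a t ↔ Past 0 R P p ω ξ a t ∨
      ∃ w t₁ a' t', a = a' ++ w ∧ t = t₁ + t' ∧
        Past 0 R (fun x y => R x y ∧ ¬ S x y) p ω ξ w t₁ ∧
        Past 0 S P (tp p ω w) (shift w ω) (seedShift t₁ ξ) a' t' := by
  classical
  constructor
  · rintro ⟨hf, hK, hP, hS⟩
    by_cases hex : ∃ t₁, t₁ < t ∧ ∃ w, Marked R p ω w ∧ CutUpTo p ω ξ w t₁ t
    · right
      -- The earliest cut with the property `R` is taken, so that no other precedes it. It cannot
      -- have the property `S`, by the condition on `a`.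
      obtain ⟨t₁, ⟨hlt, w, hR, hc⟩, hmin⟩ : ∃ t₁, (t₁ < t ∧ ∃ w, Marked R p ω w ∧
          CutUpTo p ω ξ w t₁ t) ∧ ∀ s < t₁, ¬ (s < t ∧ ∃ w, Marked R p ω w ∧
          CutUpTo p ω ξ w s t) :=
        ⟨Nat.find hex, Nat.find_spec hex, fun s hs => Nat.find_min hex hs⟩
      have hw0 : w ≠ [] := by rintro rfl; exact hR
      have hwK : 0 < w.length := List.length_pos_iff.2 hw0
      have hnS : ¬ Marked S p ω w := fun h => hS w t₁ hlt hwK h hc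
      obtain ⟨a', rfl⟩ := hc.suffix hlt.le hf.1
      obtain ⟨t', rfl⟩ := Nat.exists_eq_add_of_le hlt.le
      have ha'0 : a' ≠ [] := by
        rintro rfl
        have := hf.unique hc.1
        omega
      have hne := hc.1.stay_iff.1 hc.2
      refine ⟨w, t₁, a', t', rfl, rfl, ⟨hc.1, hwK, ?_, ?_⟩, ?_, List.length_pos_iff.2 ha'0, ?_, ?_⟩
      · cases w with
        | nil => exact hR
        | cons k w => exact ⟨hR, hnS⟩
      · intro w₂ t₂ h2 _ hR2 hc2
        exact hmin t₂ h2 ⟨by omega, w₂, hR2, hc2.extend h2.le hc⟩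
      · exact hc.1.shift_iff.2 ⟨hf, hne⟩
      · exact (marked_append P ha'0).1 hP
      · intro w₂ s hs hw2 hS2 hc2
        have hw20 := List.length_pos_iff.1 hw2
        refine hS (w₂ ++ w) (t₁ + s) (by omega) (by simp; omega) ((marked_append S hw20).2 hS2) ?_
        exact ((hc.1.cutUpTo_shift_iff hs.le).1 hc2).1
    · left
      refine ⟨hf, hK, hP, fun w t₁ h1 _ h3 h4 => hex ⟨t₁, h1, w, h3, h4⟩⟩
  · rintro (⟨hf, hK, hP, hR⟩ | ⟨w, t₁, a', t', rfl, rfl, ⟨hw, hwK, hwR, hwn⟩, ha, haK, haP, haS⟩)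
    · exact ⟨hf, hK, hP, fun w t₁ h1 h2 h3 => hR w t₁ h1 h2 (Marked.mono hSR h3)⟩
    · have ha0 := List.length_pos_iff.1 haK
      obtain ⟨hfa, hne⟩ := hw.shift_iff.1 ha
      refine ⟨hfa, by simp; omega, (marked_append P ha0).2 haP, ?_⟩
      intro w₂ t₂ h2 hw2 hS2 hc2
      -- A cut with the property `S` is impossible before `w` by the first segment, at `w` by `¬ S`,
      -- and after `w` by the second segment.
      rcases lt_trichotomy t₂ t₁ with hlt | heq | hgt
      · refine hwn w₂ t₂ hlt hw2 (Marked.mono hSR hS2) ⟨hc2.1, fun s h1 h3 => hc2.2 s h1 (by omega)⟩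
      · subst heq
        have : w₂ = w := by
          have := hc2.1.1.symm.trans hw.1
          simpa using this
        subst this
        cases w₂ with
        | nil => exact hS2
        | cons k w => exact hwR.2 hS2
      · obtain ⟨s, rfl⟩ := Nat.exists_eq_add_of_lt hgt
        have hin := hw.stay_iff.2 hne (t₁ + s + 1) (by omega) (by omega)
        rw [hc2.1.1, inSub_some] at hin
        obtain ⟨b, rfl⟩ := hin
        have hb0 : b ≠ [] := by
          rintro rfl
          have := hc2.1.unique hw
          omega
        exact haS b (s + 1) (by omega) (List.length_pos_iff.2 hb0) ((marked_append S hb0).1 hS2)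
          ((hw.cutUpTo_shift_iff (by omega)).2 ⟨by simpa [add_assoc] using hc2, hne⟩)

/-- The node in the decomposition `past_iff` is unique. -/
theorem past_node_unique {R P₁ P₂ : Mark m} {K : ℕ} {w₁ w₂ : Node} {s₁ s₂ : ℕ}
    (hR₁ : ∀ x y, P₁ x y → R x y) (hR₂ : ∀ x y, P₂ x y → R x y)
    (h₁ : Past K R P₁ p ω ξ w₁ t₁) (h₂ : Past K R P₂ p ω ξ w₂ t₂)
    (hne₁ : pos (tp p ω w₁) (shift w₁ ω) (seedShift t₁ ξ) (some []) s₁ ≠ none)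
    (hne₂ : pos (tp p ω w₂) (shift w₂ ω) (seedShift t₂ ξ) (some []) s₂ ≠ none)
    (h12 : t₂ ≤ t₁ + s₁) (h21 : t₁ ≤ t₂ + s₂) : w₁ = w₂ ∧ t₁ = t₂ := by
  rcases lt_trichotomy t₁ t₂ with hlt | heq | hgt
  · exact absurd ⟨h₁.1, fun s a b => h₁.1.stay_iff.2 hne₁ s a (by omega)⟩
      (h₂.2.2.2 w₁ t₁ hlt h₁.2.1 (Marked.mono hR₁ h₁.2.2.1))
  · subst heq
    refine ⟨?_, rfl⟩
    have := h₁.1.1.symm.trans h₂.1.1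
    simpa using this
  · exact absurd ⟨h₂.1, fun s a b => h₂.1.stay_iff.2 hne₂ s a (by omega)⟩
      (h₁.2.2.2 w₂ t₂ hgt h₂.2.1 (Marked.mono hR₂ h₂.2.2.1))

end Walk

/-! ### Replacing a part of the coordinates of a product measure -/

section Splice

/-- The coordinates in `S` are read from an independent copy at the index `e i`. As `e` is injective
on `S`, no coordinate of the copy is read twice, and the product structure survives. The maps `φ`
transport the dependent factors. -/
theorem measurePreserving_replace {ι : Type*} {X : ι → Type*} [∀ i, MeasurableSpace (X i)]
    (μ : ∀ i, Measure (X i)) [∀ i, IsProbabilityMeasure (μ i)] (S : Set ι) [DecidablePred (· ∈ S)]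
    (e : ι → ι) (he : Set.InjOn e S) (φ : ∀ i, X (e i) → X i)
    (hφ : ∀ i, MeasurePreserving (φ i) (μ (e i)) (μ i)) :
    MeasurePreserving
      (fun (z : (∀ i, X i) × (∀ i, X i)) i => if i ∈ S then φ i (z.2 (e i)) else z.1 i)
      ((Measure.infinitePi μ).prod (Measure.infinitePi μ)) (Measure.infinitePi μ) := by
  classical
  have hmeas : Measurable
      (fun (z : (∀ i, X i) × (∀ i, X i)) i => if i ∈ S then φ i (z.2 (e i)) else z.1 i) := by
    refine measurable_pi_lambda _ fun i => ?_
    split_ifs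
    · exact (hφ i).measurable.comp ((measurable_pi_apply _).comp measurable_snd)
    · exact (measurable_pi_apply _).comp measurable_fst
  refine ⟨hmeas, Measure.eq_infinitePi _ fun s t ht => ?_⟩
  rw [Measure.map_apply hmeas (MeasurableSet.pi s.countable_toSet fun i _ => ht i)]
  set t' : ∀ j, Set (X j) := fun j => {x | ∀ i, i ∈ s → i ∈ S → ∀ h : j = e i, φ i (h ▸ x) ∈ t i}
  have ht' : ∀ i ∈ s, i ∈ S → t' (e i) = φ i ⁻¹' t i := by
    intro i hi hiS
    ext x
    constructor
    · intro hx
      exact hx i hi hiS rfl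
    · intro hx i' hi' hiS' h
      obtain rfl := he hiS hiS' h
      exact hx
  have hpre : (fun (z : (∀ i, X i) × (∀ i, X i)) i => if i ∈ S then φ i (z.2 (e i)) else z.1 i) ⁻¹'
      (Set.pi s t) = (Set.pi (s.filter (· ∉ S) : Finset ι) t) ×ˢ
        (Set.pi ((s.filter (· ∈ S)).image e : Finset ι) t') := by
    ext ⟨x, y⟩
    simp only [Set.mem_preimage, Set.mem_pi, Finset.mem_coe, Set.mem_prod, Finset.mem_filter,
      Finset.mem_image]
    constructor
    · intro h
      refine ⟨fun i hi => by simpa [hi.2] using h i hi.1, ?_⟩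
      rintro _ ⟨i, hi, rfl⟩
      rw [ht' i hi.1 hi.2]
      simpa [hi.2] using h i hi.1
    · rintro ⟨h1, h2⟩ i hi
      by_cases hiS : i ∈ S
      · have := h2 (e i) ⟨i, ⟨hi, hiS⟩, rfl⟩
        rw [ht' i hi hiS] at this
        simpa [hiS] using this
      · simpa [hiS] using h1 i ⟨hi, hiS⟩
  rw [hpre, Measure.prod_prod, Measure.infinitePi_pi _ fun i _ => ht i, Measure.infinitePi_pi]
  · rw [Finset.prod_image]
    · rw [← Finset.prod_filter_mul_prod_filter_not s (· ∈ S), mul_comm]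
      congr 1
      refine Finset.prod_congr rfl fun i hi => ?_
      rw [Finset.mem_filter] at hi
      rw [ht' i hi.1 hi.2, (hφ i).measure_preimage (ht i).nullMeasurableSet]
    · intro i hi j hj h
      simp only [Finset.coe_filter, Set.mem_ofPred] at hi hj
      exact he hi.2 hj.2 h
  · intro j hj
    obtain ⟨i, hi, rfl⟩ := Finset.mem_image.1 hj
    rw [Finset.mem_filter] at hi
    rw [ht' i hi.1 hi.2]
    exact (hφ i).measurable (ht i)

theorem measurePreserving_prod_shuffle {α β : Type*} [MeasurableSpace α] [MeasurableSpace β]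
    {μ : Measure α} {ν : Measure β} [IsProbabilityMeasure μ] [IsProbabilityMeasure ν]
    {f : α × α → α} {g : β × β → β} (hf : MeasurePreserving f (μ.prod μ) μ)
    (hg : MeasurePreserving g (ν.prod ν) ν) :
    MeasurePreserving (fun z : (α × β) × (α × β) => (f (z.1.1, z.2.1), g (z.1.2, z.2.2)))
      ((μ.prod ν).prod (μ.prod ν)) (μ.prod ν) := by
  have hm : Measurable (fun z : (α × β) × (α × β) => (f (z.1.1, z.2.1), g (z.1.2, z.2.2))) := by
    have := hf.measurable
    have := hg.measurable
    fun_prop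
  refine ⟨hm, (Measure.prod_eq fun s t hs ht => ?_).symm⟩
  rw [Measure.map_apply hm (hs.prod ht), Measure.prod_apply (hm (hs.prod ht))]
  have h1 : ∀ z : α × β, (μ.prod ν) (Prod.mk z ⁻¹'
      ((fun z : (α × β) × (α × β) => (f (z.1.1, z.2.1), g (z.1.2, z.2.2))) ⁻¹' s ×ˢ t)) =
      μ (Prod.mk z.1 ⁻¹' (f ⁻¹' s)) * ν (Prod.mk z.2 ⁻¹' (g ⁻¹' t)) := by
    intro z
    rw [← Measure.prod_prod]
    rfl
  simp only [h1]
  have m1 := hf.measurable hs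
  have m2 := hg.measurable ht
  rw [lintegral_prod_mul (measurable_measure_prodMk_left m1).aemeasurable
    (measurable_measure_prodMk_left m2).aemeasurable, ← Measure.prod_apply m1,
    ← Measure.prod_apply m2, hf.measure_preimage hs.nullMeasurableSet,
    hg.measure_preimage ht.nullMeasurableSet]

end Splice

/-! ### The law of the reservoir and of the randomness of the walk -/

section Law

variable {m : ℕ}

instance {α : Type*} : MeasurableSpace (Option α) := ⊤

instance {α : Type*} : DiscreteMeasurableSpace (Option α) := ⟨fun _ => trivial⟩

instance : DiscreteMeasurableSpace (List (Fin m)) := ⟨fun _ => trivial⟩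

/-- The law of the reservoir. -/
def resLaw (M : Model m) : Measure (Reservoir m) :=
  Measure.infinitePi fun x : Node × (Option (Fin m) × Fin m) => (M.offspringLaw x.2).toMeasure

/-- The law of the randomness of the walk. -/
def seedLaw : Measure WalkSeed :=
  (Measure.infinitePi fun _ : ℕ => (PMF.uniformOfFintype Bool).toMeasure).prod
    (Measure.infinitePi fun p : ℕ × ℕ => (PMF.uniformOfFintype (Fin (p.2 + 1))).toMeasure)

instance (M : Model m) : IsProbabilityMeasure (resLaw M) := by unfold resLaw; infer_instance

instance : IsProbabilityMeasure seedLaw := by unfold seedLaw; infer_instance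

/-- The joint law of the reservoir and of the randomness of the walk. -/
def jointLaw (M : Model m) : Measure (Reservoir m × WalkSeed) := (resLaw M).prod seedLaw

instance (M : Model m) : IsProbabilityMeasure (jointLaw M) := by unfold jointLaw; infer_instance

theorem law_eq (M : Model m) (ν : PMF (Fin m)) : law M ν = ν.toMeasure.prod (jointLaw M) := rfl

/-- The reservoir `ω`, with the subtree at `v` replaced by `ω'`. -/
def graft (v : Node) (ω ω' : Reservoir m) : Reservoir m := fun x =>
  if v <:+ x.1 then ω' (x.1.take (x.1.length - v.length), x.2) else ω x

/-- The randomness `ξ` until time `t`, followed by `ξ'`. -/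
def seedGraft (t : ℕ) (ξ ξ' : WalkSeed) : WalkSeed :=
  (fun s => if t ≤ s then ξ'.1 (s - t) else ξ.1 s,
    fun q => if t ≤ q.1 then ξ'.2 (q.1 - t, q.2) else ξ.2 q)

theorem shift_graft (v : Node) (ω ω' : Reservoir m) : shift v (graft v ω ω') = ω' := by
  funext x
  simp [shift, graft]

theorem seedShift_seedGraft (t : ℕ) (ξ ξ' : WalkSeed) : seedShift t (seedGraft t ξ ξ') = ξ' := by
  unfold seedShift seedGraft
  refine Prod.ext ?_ ?_
  · funext x; simp
  · funext x
    have key : ∀ y z : ℕ, y = z →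
        @Eq (Fin (x.2 + 1)) (ξ'.2 (y, x.2)) (ξ'.2 (z, x.2)) := by
      rintro y z rfl; rfl
    simp only [Nat.le_add_right, if_true]
    exact key _ _ (by simp)

theorem agree_graft (v : Node) (t : ℕ) (ω ω' : Reservoir m) (ξ ξ' : WalkSeed) :
    Agree v t ω (graft v ω ω') ξ (seedGraft t ξ ξ') where
  out u q hu := by simp [graft, hu]
  coin s hs := by simp [seedGraft, Nat.not_le.2 hs]
  choice s hs d := by simp [seedGraft, Nat.not_le.2 hs]

theorem measurePreserving_graft (M : Model m) (v : Node) :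
    MeasurePreserving (fun z : Reservoir m × Reservoir m => graft v z.1 z.2)
      ((resLaw M).prod (resLaw M)) (resLaw M) := by
  classical
  have := measurePreserving_replace
    (fun x : Node × (Option (Fin m) × Fin m) => (M.offspringLaw x.2).toMeasure)
    {x | v <:+ x.1} (fun x => (x.1.take (x.1.length - v.length), x.2)) (by
      rintro ⟨u, q⟩ hu ⟨u', q'⟩ hu' h
      obtain ⟨a, rfl⟩ : v <:+ u := hu
      obtain ⟨a', rfl⟩ : v <:+ u' := hu'
      simpa using h) (fun _ x => x) (fun x => MeasurePreserving.id _)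
  unfold resLaw
  convert this using 1
  funext z x
  simp only [graft]
  rfl

theorem measurePreserving_seedGraft (t : ℕ) :
    MeasurePreserving (fun z : WalkSeed × WalkSeed => seedGraft t z.1 z.2)
      (seedLaw.prod seedLaw) seedLaw := by
  classical
  have h1 := measurePreserving_replace
    (fun _ : ℕ => (PMF.uniformOfFintype Bool).toMeasure)
    {s | t ≤ s} (fun s => s - t) (by
      intro a ha b hb h
      simp only [Set.mem_ofPred_eq] at ha hb h
      omega) (fun _ x => x) (fun x => MeasurePreserving.id _)
  have h2 := measurePreserving_replace
    (fun p : ℕ × ℕ => (PMF.uniformOfFintype (Fin (p.2 + 1))).toMeasure)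
    {q | t ≤ q.1} (fun q => (q.1 - t, q.2)) (by
      rintro ⟨a, a'⟩ ha ⟨b, b'⟩ hb h
      simp only [Set.mem_ofPred_eq, Prod.mk.injEq] at ha hb h ⊢
      omega) (fun _ x => x) (fun x => MeasurePreserving.id _)
  exact measurePreserving_prod_shuffle h1 h2

theorem measurePreserving_jointGraft (M : Model m) (v : Node) (t : ℕ) :
    MeasurePreserving (fun z : (Reservoir m × WalkSeed) × (Reservoir m × WalkSeed) =>
      (graft v z.1.1 z.2.1, seedGraft t z.1.2 z.2.2))
      ((jointLaw M).prod (jointLaw M)) (jointLaw M) :=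
  measurePreserving_prod_shuffle (measurePreserving_graft M v) (measurePreserving_seedGraft t)

theorem measurable_shift (v : Node) : Measurable (shift v : Reservoir m → Reservoir m) :=
  measurable_pi_lambda _ fun _ => measurable_pi_apply _

theorem measurable_seedShift (t : ℕ) : Measurable (seedShift t) := by
  refine Measurable.prodMk (measurable_pi_lambda _ fun s => ?_) (measurable_pi_lambda _ fun q => ?_)
  · exact (measurable_pi_apply _).comp measurable_fst
  · exact (measurable_pi_apply (t + q.1, q.2)).comp measurable_snd

/-- Restarting at `v` and at time `t`: an event that is determined outside the subtree of `v` and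
before time `t` is independent of the subtree at `v` and of the walk after time `t`. -/
theorem jointLaw_restart (M : Model m) (v : Node) (t : ℕ) {A B : Set (Reservoir m × WalkSeed)}
    (hA : MeasurableSet A) (hB : MeasurableSet B)
    (hdet : ∀ ω ω₂ ξ ξ₂, Agree v t ω ω₂ ξ ξ₂ → (ω, ξ) ∈ A → (ω₂, ξ₂) ∈ A) :
    jointLaw M {z | z ∈ A ∧ (shift v z.1, seedShift t z.2) ∈ B} = jointLaw M A * jointLaw M B := by
  have hmp := measurePreserving_jointGraft M v t
  have hm : MeasurableSet {z : Reservoir m × WalkSeed |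
      z ∈ A ∧ (shift v z.1, seedShift t z.2) ∈ B} := by
    refine hA.inter ?_
    exact (((measurable_shift v).comp measurable_fst).prodMk
      ((measurable_seedShift t).comp measurable_snd)) hB
  -- After grafting an independent copy the event is a rectangle: `A` reads only the first sample
  -- and `B` only the second.
  rw [← hmp.measure_preimage hm.nullMeasurableSet, ← Measure.prod_prod]
  congr 1
  ext ⟨z, z'⟩
  simp only [Set.mem_preimage, Set.mem_ofPred_eq, Set.mem_prod, shift_graft, seedShift_seedGraft]
  have hag := agree_graft v t z.1 z'.1 z.2 z'.2
  exact and_congr_left fun _ => ⟨fun h => hdet _ _ _ _ hag.symm h, fun h => hdet _ _ _ _ hag h⟩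

/-- The counterpart of `jointLaw_restart` on a fixed tree. -/
theorem seedLaw_restart (t : ℕ) {A B : Set WalkSeed}
    (hA : MeasurableSet A) (hB : MeasurableSet B)
    (hdet : ∀ ξ ξ₂ : WalkSeed, (∀ s < t, ξ.1 s = ξ₂.1 s) →
      (∀ s < t, ∀ d, ξ.2 (s, d) = ξ₂.2 (s, d)) → ξ ∈ A → ξ₂ ∈ A) :
    seedLaw {ξ | ξ ∈ A ∧ seedShift t ξ ∈ B} = seedLaw A * seedLaw B := by
  have hmp := measurePreserving_seedGraft t
  have hm : MeasurableSet {ξ : WalkSeed | ξ ∈ A ∧ seedShift t ξ ∈ B} :=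
    hA.inter (measurable_seedShift t hB)
  rw [← hmp.measure_preimage hm.nullMeasurableSet, ← Measure.prod_prod]
  congr 1
  ext ⟨z, z'⟩
  simp only [Set.mem_preimage, Set.mem_ofPred_eq, Set.mem_prod, seedShift_seedGraft]
  -- Only the clauses on the seed are used, so a trivial reservoir suffices.
  have hag := agree_graft (m := 0) [] t (fun _ => []) (fun _ => []) z z'
  exact and_congr_left fun _ => ⟨fun h => hdet _ _ hag.symm.coin hag.symm.choice h,
    fun h => hdet _ _ hag.coin hag.choice h⟩

/-! ### Measurability -/

theorem measurable_apply_countable {α β γ : Type*} [MeasurableSpace α] [MeasurableSpace γ]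
    [Countable β] [MeasurableSpace β] [MeasurableSingletonClass β] {f : β → α → γ}
    (hf : ∀ b, Measurable (f b)) {g : α → β} (hg : Measurable g) :
    Measurable fun x => f (g x) x :=
  (measurable_from_prod_countable_right (f := fun z : β × α => f z.1 z.2) hf).comp
    (hg.prodMk measurable_id)

theorem measurable_tp (p : Pair m) (u : Node) : Measurable fun ω : Reservoir m => tp p ω u := by
  induction u with
  | nil => exact measurable_const
  | cons k u ih =>
    refine measurable_apply_countable
      (f := fun (q : Pair m) (ω : Reservoir m) => ((some q.2, (ω (u, q)).getD k q.2) : Pair m))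
      (fun q => ?_) ih
    exact (measurable_of_countable fun l : List (Fin m) => ((some q.2, l.getD k q.2) : Pair m)).comp
      (measurable_pi_apply (u, q))

theorem measurable_kids (p : Pair m) (u : Node) :
    Measurable fun ω : Reservoir m => kids p ω u :=
  measurable_apply_countable (f := fun (q : Pair m) (ω : Reservoir m) => ω (u, q))
    (fun q => measurable_pi_apply (u, q)) (measurable_tp p u)

theorem measurable_pos (p : Pair m) (o : Option Node) (t : ℕ) :
    Measurable fun z : Reservoir m × WalkSeed => pos p z.1 z.2 o t := by
  induction t with
  | zero => exact measurable_const
  | succ t ih =>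
    refine measurable_apply_countable (f := fun (o : Option Node) (z : Reservoir m × WalkSeed) =>
      move p z.1 (z.2.1 t) (fun d => z.2.2 (t, d)) o) (fun o => ?_) ih
    cases o with
    | none => exact measurable_const
    | some u =>
      refine measurable_apply_countable (f := fun (l : List (Fin m))
        (z : Reservoir m × WalkSeed) =>
          if z.2.1 t then some u else
            ((List.range l.length).map (fun k => some (k :: u)) ++
              (if u = [] ∧ p.1 = none then [] else [up u])).getD
              (z.2.2 (t, ((List.range l.length).map (fun k => some (k :: u)) ++
              (if u = [] ∧ p.1 = none then [] else [up u])).length - 1)) (some u)) (fun l => ?_)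
        ((measurable_kids p u).comp measurable_fst)
      set L := (List.range l.length).map (fun k => some (k :: u)) ++
              (if u = [] ∧ p.1 = none then [] else [up u])
      refine Measurable.ite ?_ measurable_const ?_
      · have h : Measurable fun z : Reservoir m × WalkSeed => z.2.1 t :=
          (measurable_pi_apply t).comp (measurable_fst.comp measurable_snd)
        exact h (measurableSet_singleton true)
      · exact (measurable_of_countable fun i : Fin (L.length - 1 + 1) => L.getD i (some u)).comp
          ((measurable_pi_apply (t, L.length - 1)).comp (measurable_snd.comp measurable_snd))

theorem measurable_pos_mem (p : Pair m) (o : Option Node) (t : ℕ) (P : Option Node → Prop) :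
    Measurable fun z : Reservoir m × WalkSeed => P (pos p z.1 z.2 o t) :=
  (measurable_of_countable P).comp (measurable_pos p o t)

theorem measurable_firstHit (p : Pair m) (v : Node) (t : ℕ) :
    Measurable fun z : Reservoir m × WalkSeed => FirstHit p z.1 z.2 v t :=
  (measurable_pos_mem p _ t (· = some v)).and <| Measurable.forall fun s => Measurable.imp
    measurable_const (measurable_pos_mem p _ s (· ≠ some v))

theorem measurable_cutUpTo (p : Pair m) (v : Node) (t₁ t : ℕ) :
    Measurable fun z : Reservoir m × WalkSeed => CutUpTo p z.1 z.2 v t₁ t :=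
  (measurable_firstHit p v t₁).and <| Measurable.forall fun s => Measurable.imp
    measurable_const <| Measurable.imp measurable_const (measurable_pos_mem p _ s (InSub v))

theorem measurable_marked (P : Mark m) (p : Pair m) (v : Node) :
    Measurable fun ω : Reservoir m => Marked P p ω v := by
  cases v with
  | nil => exact measurable_const
  | cons k u =>
    exact (measurable_of_countable fun x : Pair m × Pair m => P x.1 x.2).comp
      ((measurable_tp p u).prodMk (measurable_tp p (k :: u)))

theorem measurable_past (K : ℕ) (S P : Mark m) (p : Pair m) (v : Node) (t : ℕ) :
    Measurable fun z : Reservoir m × WalkSeed => Past K S P p z.1 z.2 v t :=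
  (measurable_firstHit p v t).and <| measurable_const.and <|
    ((measurable_marked P p v).comp measurable_fst).and <|
    Measurable.forall fun w => Measurable.forall fun t₁ => Measurable.imp measurable_const <|
    Measurable.imp measurable_const <|
    Measurable.imp ((measurable_marked S p w).comp measurable_fst) (measurable_cutUpTo p w t₁ t).not

end Law

/-! ### Masses of path segments and their renewal decomposition. -/

section Renewal

variable {m : ℕ}

/-- The walk never leaves through the parent of the root. -/
def Alive (p : Pair m) (ω : Reservoir m) (ξ : WalkSeed) : Prop :=
  ∀ t, pos p ω ξ (some []) t ≠ none

theorem measurable_alive (p : Pair m) :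
    Measurable fun z : Reservoir m × WalkSeed => Alive p z.1 z.2 :=
  Measurable.forall fun t => measurable_pos_mem p _ t (· ≠ none)

/-- The probability that the walk never leaves through the parent of the root. -/
def esc (M : Model m) (p : Pair m) : ℝ≥0∞ := jointLaw M {z | Alive p z.1 z.2}

/-- The probability of `Past`, as a function of the node and of the time. -/
def pastMass (M : Model m) (K : ℕ) (S P : Mark m) (p : Pair m) (x : Node × ℕ) : ℝ≥0∞ :=
  jointLaw M {z | Past K S P p z.1 z.2 x.1 x.2}

/-- The property `P` of nodes of type `e` whose parent has type `e`. -/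
def Mark.at (P : Mark m) (e : Fin m) : Mark m := fun x y => P x y ∧ y = (some e, e)

theorem FirstHit.alive {p : Pair m} {ω : Reservoir m} {ξ : WalkSeed} {v : Node} {t : ℕ}
    (h : FirstHit p ω ξ v t) (ha : Alive (tp p ω v) (shift v ω) (seedShift t ξ)) :
    Alive p ω ξ := by
  intro s
  rcases le_total s t with hs | hs
  · exact pos_ne_none_of_le (t := t) (by rw [h.1]; simp) hs
  · obtain ⟨n, rfl⟩ := Nat.exists_eq_add_of_le hs
    obtain ⟨u, hu, -⟩ := h.stay_iff.2 (ha n) (t + n) (by omega) le_rfl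
    rw [hu]; simp

theorem Marked.tp_eq {P : Mark m} {q p : Pair m} (hP : ∀ x y, P x y → y = q) {ω : Reservoir m}
    {v : Node} (h : Marked P p ω v) : tp p ω v = q := by
  cases v with
  | nil => exact h.elim
  | cons k u => exact hP _ _ h

/-- `P` fixes the type pair `q` of the new root, and `Past` depends on the explored part only. So
the subtree with the later walk is a fresh sample started from `q`. -/
theorem jointLaw_past_restart (M : Model m) (K : ℕ) {S P : Mark m} (p : Pair m) {q : Pair m}
    (hP : ∀ x y, P x y → y = q) (x : Node × ℕ) {B : Pair m → Reservoir m → WalkSeed → Prop}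
    (hB : Measurable fun z : Reservoir m × WalkSeed => B q z.1 z.2) :
    jointLaw M {z | Past K S P p z.1 z.2 x.1 x.2 ∧
      B (tp p z.1 x.1) (shift x.1 z.1) (seedShift x.2 z.2)} =
      pastMass M K S P p x * jointLaw M {z | B q z.1 z.2} := by
  rw [pastMass, ← jointLaw_restart M x.1 x.2 (measurableSet_setOfPred.2 (measurable_past K S P p x.1 x.2))
    (measurableSet_setOfPred.2 hB)]
  · congr 1
    ext z
    simp only [Set.mem_ofPred_eq]
    refine and_congr_right fun h => ?_
    rw [h.2.2.1.tp_eq hP]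
  · intro ω ω₂ ξ ξ₂ hag h
    exact hag.past h

/-- The first node with the property `S` in whose subtree the walk stays forever. -/
theorem jointLaw_exists_past (M : Model m) (K : ℕ) {S P : Mark m} (p : Pair m) {q : Pair m}
    (hP : ∀ x y, P x y → y = q) (hPS : ∀ x y, P x y → S x y)
    {B : Pair m → Reservoir m → WalkSeed → Prop}
    (hB : Measurable fun z : Reservoir m × WalkSeed => B q z.1 z.2)
    (hBa : ∀ ω ξ, B q ω ξ → Alive q ω ξ) :
    jointLaw M {z | ∃ x : Node × ℕ, Past K S P p z.1 z.2 x.1 x.2 ∧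
      B (tp p z.1 x.1) (shift x.1 z.1) (seedShift x.2 z.2)} =
      (∑' x, pastMass M K S P p x) * jointLaw M {z | B q z.1 z.2} := by
  rw [← ENNReal.tsum_mul_right]
  simp only [← jointLaw_past_restart M K p hP _ hB]
  rw [← measure_iUnion]
  · congr 1
    ext z; simp
  -- If two nodes qualified, the walk would stay forever below the earlier one, which `Past` at the
  -- later one forbids.
  · intro x y hxy
    refine Set.disjoint_left.2 fun z hx hy => hxy ?_
    simp only [Set.mem_ofPred_eq] at hx hy
    have e1 := hx.1.2.2.1.tp_eq hP
    have e2 := hy.1.2.2.1.tp_eq hP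
    have a1 := e1 ▸ hBa _ _ (e1 ▸ hx.2)
    have a2 := e2 ▸ hBa _ _ (e2 ▸ hy.2)
    have := past_node_unique (s₁ := y.2) (s₂ := x.2) hPS hPS hx.1 hy.1 (a1 _) (a2 _) (by omega)
      (by omega)
    exact Prod.ext this.1 this.2
  · intro x
    have h1 : MeasurableSet {z : Reservoir m × WalkSeed | Past K S P p z.1 z.2 x.1 x.2 ∧
        B q (shift x.1 z.1) (seedShift x.2 z.2)} := by
      refine measurableSet_setOfPred.2 ((measurable_past K S P p x.1 x.2).and ?_)
      exact hB.comp (((measurable_shift x.1).comp measurable_fst).prodMk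
        ((measurable_seedShift x.2).comp measurable_snd))
    convert h1 using 1
    ext z
    simp only [Set.mem_ofPred_eq]
    refine and_congr_right fun h => ?_
    rw [h.2.2.1.tp_eq hP]

/-- Concatenation of a path from the root with a path in the subtree at its end. -/
def comb (x y : Node × ℕ) : Node × ℕ := (y.1 ++ x.1, x.2 + y.2)

/-- The probabilistic form of the decomposition `past_iff`. -/
theorem pastMass_decomp (M : Model m) {S R P : Mark m} (hSR : ∀ x y, S x y → R x y)
    (hR : ∀ x y, R x y → y.1 = some y.2) (p : Pair m) (z : Node × ℕ) :
    pastMass M 0 S P p z = pastMass M 0 R P p z +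
      ∑' (x : Node × ℕ) (y : Node × ℕ), if comb x y = z then
        ∑ e, pastMass M 0 R (Mark.at (fun x y => R x y ∧ ¬ S x y) e) p x *
          pastMass M 0 S P (some e, e) y else 0 := by
  classical
  set B : Mark m := fun x y => R x y ∧ ¬ S x y with hBdef
  -- The second alternative of `past_iff`, split according to the two segments and the type `e` at
  -- their junction.
  set D : (Node × ℕ) × (Node × ℕ) → Fin m → Set (Reservoir m × WalkSeed) := fun xy e =>
    {ζ | comb xy.1 xy.2 = z ∧ Past 0 R (B.at e) p ζ.1 ζ.2 xy.1.1 xy.1.2 ∧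
      Past 0 S P (tp p ζ.1 xy.1.1) (shift xy.1.1 ζ.1) (seedShift xy.1.2 ζ.2) xy.2.1 xy.2.2} with hD
  have hat : ∀ e x y, B.at e x y → y = (some e, e) := fun e x y h => h.2
  have hmD : ∀ xy e, MeasurableSet (D xy e) := by
    intro xy e
    have h1 : MeasurableSet {ζ : Reservoir m × WalkSeed | comb xy.1 xy.2 = z ∧
      Past 0 R (B.at e) p ζ.1 ζ.2 xy.1.1 xy.1.2 ∧
      Past 0 S P (some e, e) (shift xy.1.1 ζ.1) (seedShift xy.1.2 ζ.2) xy.2.1 xy.2.2} := by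
      refine measurableSet_setOfPred.2 (measurable_const.and
        ((measurable_past 0 R (B.at e) p _ _).and ?_))
      exact (measurable_past 0 S P (some e, e) xy.2.1 xy.2.2).comp
        (((measurable_shift _).comp measurable_fst).prodMk
        ((measurable_seedShift _).comp measurable_snd))
    convert h1 using 1
    ext ζ
    simp only [hD, Set.mem_ofPred_eq]
    refine and_congr_right fun _ => and_congr_right fun h => ?_
    rw [h.2.2.1.tp_eq (hat e)]
  have hset : {ζ : Reservoir m × WalkSeed | Past 0 S P p ζ.1 ζ.2 z.1 z.2} =
      {ζ | Past 0 R P p ζ.1 ζ.2 z.1 z.2} ∪ ⋃ w : ((Node × ℕ) × (Node × ℕ)) × Fin m, D w.1 w.2 := by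
    ext ζ
    rw [Set.mem_union, Set.mem_iUnion, Set.mem_ofPred_eq, Set.mem_ofPred_eq, past_iff hSR]
    refine or_congr_right ?_
    simp only [hD, Set.mem_ofPred_eq]
    constructor
    · rintro ⟨w, t₁, a', t', h1, h2, h3, h4⟩
      refine ⟨⟨((w, t₁), (a', t')), (tp p ζ.1 w).2⟩, Prod.ext h1.symm h2.symm, ?_, h4⟩
      refine ⟨h3.1, h3.2.1, ?_, h3.2.2.2⟩
      have hm := h3.2.2.1
      cases w with
      | nil => exact hm
      | cons k u =>
        refine ⟨hm, ?_⟩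
        have := hR _ _ hm.1
        exact Prod.ext this rfl
    · rintro ⟨⟨⟨⟨w, t₁⟩, ⟨a', t'⟩⟩, e⟩, h, h3, h4⟩
      refine ⟨w, t₁, a', t', ?_, ?_, ?_, h4⟩
      · rw [← h]; rfl
      · rw [← h]; rfl
      · exact ⟨h3.1, h3.2.1, h3.2.2.1.mono fun x y h => h.1, h3.2.2.2⟩
  have halive : ∀ xy e ζ, ζ ∈ D xy e → pos (tp p ζ.1 xy.1.1) (shift xy.1.1 ζ.1)
      (seedShift xy.1.2 ζ.2) (some []) xy.2.2 ≠ none := by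
    rintro xy e ζ ⟨-, -, h⟩
    rw [h.1.1]; simp
  have hR' : ∀ e x y, B.at e x y → R x y := fun e x y h => h.1.1
  have hdisj : Pairwise (Function.onFun Disjoint
      fun w : ((Node × ℕ) × (Node × ℕ)) × Fin m => D w.1 w.2) := by
    rintro ⟨⟨x, y⟩, e⟩ ⟨⟨x', y'⟩, e'⟩ hne
    refine Set.disjoint_left.2 fun ζ h h' => hne ?_
    have a1 := halive _ _ _ h
    have a2 := halive _ _ _ h'
    obtain ⟨c1, p1, -⟩ := h
    obtain ⟨c2, p2, -⟩ := h'
    have s1 : x.2 + y.2 = z.2 := by rw [← c1]; rfl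
    have s2 : x'.2 + y'.2 = z.2 := by rw [← c2]; rfl
    have hx := past_node_unique (hR' e) (hR' e') p1 p2 a1 a2 (by simp only; omega)
      (by simp only; omega)
    obtain rfl : x = x' := Prod.ext hx.1 hx.2
    have t1 := p1.2.2.1.tp_eq (hat e)
    have t2 := p2.2.2.1.tp_eq (hat e')
    obtain rfl : e = e' := by
      have := t1.symm.trans t2
      exact congrArg Prod.snd this
    have : comb x y = comb x y' := c1.trans c2.symm
    simp only [comb, Prod.mk.injEq, List.append_cancel_right_eq, Nat.add_left_cancel_iff] at this
    rw [Prod.ext this.1 this.2]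
  have hdisj0 : Disjoint {ζ : Reservoir m × WalkSeed | Past 0 R P p ζ.1 ζ.2 z.1 z.2}
      (⋃ w : ((Node × ℕ) × (Node × ℕ)) × Fin m, D w.1 w.2) := by
    refine Set.disjoint_left.2 fun ζ h h' => ?_
    obtain ⟨⟨⟨x, y⟩, e⟩, hw⟩ := Set.mem_iUnion.1 h'
    have a1 := halive _ _ _ hw
    obtain ⟨c, p1, p2⟩ := hw
    -- The second segment ends at positive depth and so takes positive time; the junction is then a
    -- cut strictly before the end.
    have hlt : 0 < y.2 := by
      by_contra h0
      have h00 : y.2 = 0 := by omega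
      have e1 := p2.1.1
      simp only [h00, pos, Option.some.injEq] at e1
      have := p2.2.1
      rw [← e1] at this
      simp at this
    have s1 : x.2 + y.2 = z.2 := by rw [← c]; rfl
    refine h.2.2.2 x.1 x.2 (by omega) p1.2.1 (p1.2.2.1.mono (hR' e)) ⟨p1.1, ?_⟩
    rw [← s1]
    exact p1.1.stay_iff.2 a1
  rw [pastMass, hset, measure_union hdisj0 (MeasurableSet.iUnion fun w => hmD _ _),
    measure_iUnion hdisj fun w => hmD _ _,
    ENNReal.tsum_prod (f := fun xy e => jointLaw M (D xy e)),
    ENNReal.tsum_prod (f := fun x y => ∑' e, jointLaw M (D (x, y) e))]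
  congr 1
  refine tsum_congr fun x => tsum_congr fun y => ?_
  rw [tsum_fintype]
  split_ifs with hc
  · refine Finset.sum_congr rfl fun e _ => ?_
    rw [pastMass, pastMass, ← pastMass,
      ← jointLaw_past_restart M 0 p (hat e) x (B := fun q ω ξ => Past 0 S P q ω ξ y.1 y.2)
        (measurable_past 0 S P _ _ _)]
    congr 1
    ext ζ
    simp [hD, hc]
  · simp [hD, hc]

/-- The sum of `pastMass` over the nodes of depth `k`. -/
def mass (M : Model m) (S P : Mark m) (p : Pair m) (k : ℕ) : ℝ≥0∞ :=
  ∑' x : Node × ℕ, if x.1.length = k then pastMass M 0 S P p x else 0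

theorem tsum_pastMass (M : Model m) (S P : Mark m) (p : Pair m) :
    ∑' x, pastMass M 0 S P p x = ∑' k, mass M S P p k := by
  simp only [mass]
  rw [ENNReal.tsum_comm]
  exact tsum_congr fun x => by simp

theorem mass_decomp (M : Model m) {S R P : Mark m} (hSR : ∀ x y, S x y → R x y)
    (hR : ∀ x y, R x y → y.1 = some y.2) (p : Pair m) (k : ℕ) :
    mass M S P p k = mass M R P p k + ∑ l ∈ Finset.HasAntidiagonal.antidiagonal k,
      ∑ e, mass M R (Mark.at (fun x y => R x y ∧ ¬ S x y) e) p l.1 *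
        mass M S P (some e, e) l.2 := by
  classical
  set f : Fin m → Node × ℕ → ℝ≥0∞ := fun e =>
    pastMass M 0 R (Mark.at (fun x y => R x y ∧ ¬ S x y) e) p
  set g : Fin m → Node × ℕ → ℝ≥0∞ := fun e => pastMass M 0 S P (some e, e)
  have h1 : mass M S P p k = mass M R P p k + ∑' (z : Node × ℕ) (x : Node × ℕ) (y : Node × ℕ),
      if z.1.length = k then (if comb x y = z then ∑ e, f e x * g e y else 0) else 0 := by
    simp only [mass]
    rw [← ENNReal.tsum_add]
    refine tsum_congr fun z => ?_
    split_ifs with h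
    · rw [pastMass_decomp M hSR hR]
    · simp
  rw [h1]
  congr 1
  calc _ = ∑' (x : Node × ℕ) (y : Node × ℕ), if (comb x y).1.length = k then
        ∑ e, f e x * g e y else 0 := by
        rw [ENNReal.tsum_comm]
        refine tsum_congr fun x => ?_
        rw [ENNReal.tsum_comm]
        refine tsum_congr fun y => ?_
        rw [tsum_eq_single (comb x y)]
        · simp
        · intro z hz
          simp [hz.symm]
    _ = ∑' (x : Node × ℕ) (y : Node × ℕ), ∑ l ∈ Finset.HasAntidiagonal.antidiagonal k, ∑ e,
        (if x.1.length = l.1 then f e x else 0) * (if y.1.length = l.2 then g e y else 0) := by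
        refine tsum_congr fun x => tsum_congr fun y => ?_
        simp only [comb, List.length_append]
        split_ifs with h
        · rw [Finset.sum_eq_single (x.1.length, y.1.length)]
          · simp
          · intro l _ hl
            refine Finset.sum_eq_zero fun e _ => ?_
            by_cases h1 : x.1.length = l.1
            · have h2 : y.1.length ≠ l.2 := fun h2 => hl (Prod.ext h1.symm h2.symm)
              simp [h2]
            · simp [h1]
          · intro hn
            exact absurd (Finset.HasAntidiagonal.mem_antidiagonal.2 (by omega)) hn
        · symm
          refine Finset.sum_eq_zero fun l hl => Finset.sum_eq_zero fun e _ => ?_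
          rw [Finset.HasAntidiagonal.mem_antidiagonal] at hl
          by_cases h1 : x.1.length = l.1
          · have h2 : y.1.length ≠ l.2 := by omega
            simp [h2]
          · simp [h1]
    _ = ∑ l ∈ Finset.HasAntidiagonal.antidiagonal k, ∑ e,
        (∑' x : Node × ℕ, if x.1.length = l.1 then f e x else 0) *
        (∑' y : Node × ℕ, if y.1.length = l.2 then g e y else 0) := by
        have hfin : ∀ {ι : Type} (s : Finset ι) (F : ι → Node × ℕ → ℝ≥0∞),
            ∑' x, ∑ i ∈ s, F i x = ∑ i ∈ s, ∑' x, F i x := fun s F =>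
          Summable.tsum_finsetSum fun i _ => ENNReal.summable
        simp only [hfin, ENNReal.tsum_mul_left, ENNReal.tsum_mul_right]

end Renewal

/-! ### Regeneration times -/

section Regeneration

variable {m : ℕ}

/-- The node and its parent have the same type. -/
def sgMark : Mark m := fun _ y => y.1 = some y.2

/-- The node, its parent and its grandparent have the same type. -/
def goodMark : Mark m := fun x y => x.1 = some x.2 ∧ y = (some x.2, x.2)

theorem sgMark_of_goodMark (x y : Pair m) (h : goodMark x y) : sgMark x y := by
  obtain ⟨-, rfl⟩ := h
  rfl

theorem pos_eq_walk (r : Fin m) (ω : Reservoir m) (ξ : WalkSeed) (t : ℕ) :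
    pos (none, r) ω ξ (some []) t = some (walk r ω ξ t) := by
  induction t with
  | zero => rfl
  | succ t ih =>
    simp only [pos, ih, walk, move]
    set u := walk r ω ξ t
    have hn : nbrs (none, r) ω u = (neighbours r ω u).map some := by
      unfold nbrs neighbours kids
      rw [typePair_eq_tp, List.map_append, List.map_map]
      congr 1
      cases u <;> simp [up]
    rw [hn, List.length_map, List.getD_map]
    split_ifs <;> rfl

theorem eq_of_leave {p : Pair m} {ω : Reservoir m} {b : Bool} {c : (d : ℕ) → Fin (d + 1)}
    {v : Node} {o : Option Node} (h0 : InSub v o)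
    (h1 : ¬ InSub v (move p ω b c o)) : o = some v ∧ move p ω b c o = up v := by
  obtain ⟨u, rfl, hu⟩ := h0
  rcases move_cases p ω b c u with h | ⟨k, h⟩ | h
  · rw [h, inSub_some] at h1
    exact absurd hu h1
  · rw [h, inSub_some] at h1
    exact absurd (hu.trans (List.suffix_cons k u)) h1
  · rw [h] at h1 ⊢
    cases u with
    | nil =>
      rw [List.suffix_nil] at hu
      subst hu
      exact ⟨rfl, rfl⟩
    | cons k u =>
      rw [up, inSub_some] at h1
      rcases List.suffix_cons_iff.1 hu with h2 | h2
      · subst h2; exact ⟨rfl, rfl⟩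
      · exact absurd h2 h1

/-- `v` is visited for the first time at time `t` and the walk stays in its subtree forever. -/
def CutEver (p : Pair m) (ω : Reservoir m) (ξ : WalkSeed) (v : Node) (t : ℕ) : Prop :=
  FirstHit p ω ξ v t ∧ ∀ s, t ≤ s → InSub v (pos p ω ξ (some []) s)

theorem cutEver_iff {p : Pair m} {ω : Reservoir m} {ξ : WalkSeed} {v : Node} {t : ℕ} :
    CutEver p ω ξ v t ↔
      FirstHit p ω ξ v t ∧ Alive (tp p ω v) (shift v ω) (seedShift t ξ) := by
  refine and_congr_right fun h => ⟨fun h' n => h.stay_iff.1 fun s h1 _ => h' s h1, fun h' s hs => ?_⟩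
  obtain ⟨n, rfl⟩ := Nat.exists_eq_add_of_le hs
  exact h.stay_iff.2 (h' n) _ hs le_rfl

theorem CutEver.cutUpTo {p : Pair m} {ω : Reservoir m} {ξ : WalkSeed} {v : Node} {t : ℕ}
    (h : CutEver p ω ξ v t) (n : ℕ) : CutUpTo p ω ξ v t n :=
  ⟨h.1, fun s h1 _ => h.2 s h1⟩

theorem CutUpTo.cutEver {p : Pair m} {ω : Reservoir m} {ξ : WalkSeed} {v w : Node} {t t₁ : ℕ}
    (h : CutUpTo p ω ξ w t₁ t) (ht : t₁ ≤ t) (hv : CutEver p ω ξ v t) : CutEver p ω ξ w t₁ :=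
  ⟨h.1, fun s hs => (h.extend ht (hv.cutUpTo s)).2 s hs le_rfl⟩

/-- The walk from the root makes the step to `v` when it enters the subtree at `v`. -/
theorem exists_crossing {p : Pair m} {ω : Reservoir m} {ξ : WalkSeed} {v : Node} {t : ℕ}
    (hv : v ≠ []) (h : InSub v (pos p ω ξ (some []) t)) :
    ∃ s, s + 1 ≤ t ∧ pos p ω ξ (some []) s = up v ∧ pos p ω ξ (some []) (s + 1) = some v := by
  induction t with
  | zero =>
    simp only [pos, inSub_some, List.suffix_nil] at h
    exact absurd h hv
  | succ t ih =>
    by_cases h' : InSub v (pos p ω ξ (some []) t)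
    · obtain ⟨s, hs, e⟩ := ih h'
      exact ⟨s, by omega, e⟩
    · have := eq_of_enter h' h
      exact ⟨t, le_rfl, this.2, this.1⟩

/-- A walk from the root that uses an edge only once crosses it downwards, at the first visit to the
lower end, and cannot come back. Regeneration times thus become first visits followed by survival in
the subtree. -/
theorem isRegeneration_iff {K : ℕ} {r : Fin m} {ω : Reservoir m} {ξ : WalkSeed} {σ : ℕ} :
    IsRegeneration K (r, ω, ξ) σ ↔ ∃ v, CutEver (none, r) ω ξ v σ ∧
      Marked goodMark (none, r) ω v ∧ K < v.length := by
  set s : Sample m := (r, ω, ξ)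
  have hX : ∀ t, pos (none, r) ω ξ (some []) t = some (s.X t) := pos_eq_walk r ω ξ
  have hT : ∀ u, s.type u = (tp (none, r) ω u).2 := fun u =>
    congrArg Prod.snd (typePair_eq_tp r ω u)
  constructor
  · rintro ⟨hpos, hcr, huniq, hroot, htp, hte, hd⟩
    obtain ⟨τ, rfl⟩ : ∃ τ, σ = τ + 1 := ⟨σ - 1, by omega⟩
    simp only [Nat.add_sub_cancel] at hcr huniq hroot htp hte
    set u := s.X τ with hu
    set v := s.X (τ + 1) with hv
    have hstep := move_cases (none, r) ω (ξ.1 τ) (fun d => ξ.2 (τ, d)) u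
    have hmv : move (none, r) ω (ξ.1 τ) (fun d => ξ.2 (τ, d)) (some u) = some v := by
      rw [hu, ← hX τ, hv, ← hX (τ + 1)]; rfl
    rw [hmv] at hstep
    -- a crossing of the edge at another time
    have hno : ∀ n, n ≠ τ → ¬ (s.X n = u ∧ s.X (n + 1) = v) := fun n hn h =>
      hn (by have := huniq (n + 1) (by omega) (by rw [Nat.add_sub_cancel, h.1, h.2]); omega)
    have hno' : ∀ n, n ≠ τ → ¬ (s.X n = v ∧ s.X (n + 1) = u) := fun n hn h =>
      hn (by
        have := huniq (n + 1) (by omega) (by rw [Nat.add_sub_cancel, h.1, h.2, Sym2.eq_swap])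
        omega)
    rcases hstep with h | ⟨k, h⟩ | h
    · exact absurd (Option.some.inj h).symm hcr
    · have hvu : v = k :: u := Option.some.inj h
      have hbefore : ∀ t < τ + 1, ¬ InSub v (pos (none, r) ω ξ (some []) t) := by
        intro t ht hin
        obtain ⟨n, hn, e1, e2⟩ := exists_crossing (by simp [hvu]) hin
        rw [hX, hvu, up] at e1
        rw [hX] at e2
        exact hno n (by omega) ⟨Option.some.inj e1, Option.some.inj e2⟩
      have hfirst : FirstHit (none, r) ω ξ v (τ + 1) :=
        ⟨hX _, fun t ht e => hbefore t ht (e ▸ ⟨v, rfl, List.suffix_refl v⟩)⟩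
      refine ⟨v, ⟨hfirst, ?_⟩, ?_, hd⟩
      · intro n hn
        induction n, hn using Nat.le_induction with
        | base => rw [hfirst.1]; exact ⟨v, rfl, List.suffix_refl v⟩
        | succ n hn ih =>
          by_contra hout
          have hl := eq_of_leave ih hout
          have e1 := hl.1
          have e2 : pos (none, r) ω ξ (some []) (n + 1) = up v := hl.2
          rw [hX] at e1
          rw [hX, hvu, up] at e2
          exact hno' n (by omega) ⟨Option.some.inj e1, Option.some.inj e2⟩
      · rw [hvu]
        rw [hT, hT] at htp hte
        rw [hvu] at hte
        obtain ⟨k', u', huu⟩ := List.exists_cons_of_ne_nil hroot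
        refine ⟨?_, ?_⟩
        · rw [← htp, huu]; rfl
        · exact Prod.ext rfl hte.symm
    -- An upward step needs an earlier downward step over the same edge.
    · exfalso
      obtain ⟨k', u', huu⟩ := List.exists_cons_of_ne_nil hroot
      rw [huu, up] at h
      have hvu := Option.some.inj h
      have hin : InSub u (pos (none, r) ω ξ (some []) τ) := by
        rw [hX]; exact ⟨u, rfl, List.suffix_refl u⟩
      obtain ⟨n, hn, e1, e2⟩ := exists_crossing hroot hin
      rw [hX, huu, up, ← hvu] at e1
      rw [hX] at e2
      exact hno' n (by omega) ⟨Option.some.inj e1, Option.some.inj e2⟩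
  · rintro ⟨v, hc, hm, hK⟩
    cases v with
    | nil => exact hm.elim
    | cons k u =>
      have hu0 : u ≠ [] := by
        rintro rfl
        have := hm.1
        simp [tp] at this
      have hXσ : s.X σ = k :: u := by
        have := hc.1.1
        rw [hX] at this
        exact Option.some.inj this
      obtain ⟨τ, rfl⟩ : ∃ τ, σ = τ + 1 := by
        cases σ with
        | zero => simp [Sample.X, walk] at hXσ
        | succ τ => exact ⟨τ, rfl⟩
      have hXτ : s.X τ = u := by
        have h1 := hc.1.not_inSub (s := τ) (by omega)
        have h2 : InSub (k :: u) (pos (none, r) ω ξ (some []) (τ + 1)) := hc.2 _ le_rfl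
        have := (eq_of_enter h1 h2).2
        rw [hX, up] at this
        exact Option.some.inj this
      have hnin : ¬ InSub (k :: u) (some u) := by
        have := up_not_inSub (k :: u)
        rwa [up] at this
      have hge : ∀ n, s.X n = k :: u → τ + 1 ≤ n := by
        intro n hn
        by_contra hlt
        exact hc.1.2 n (by omega) (by rw [hX, hn])
      have hnu : ∀ n, s.X n = u → n < τ + 1 := by
        intro n hn
        by_contra hlt
        have := hc.2 n (by omega)
        rw [hX, hn] at this
        exact hnin this
      refine ⟨by omega, ?_, ?_, ?_, ?_, ?_, ?_⟩
      · rw [Nat.add_sub_cancel, hXτ, hXσ]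
        intro h
        have := congrArg List.length h
        simp at this
      · intro t ht he
        obtain ⟨n, rfl⟩ : ∃ n, t = n + 1 := ⟨t - 1, by omega⟩
        rw [Nat.add_sub_cancel, Nat.add_sub_cancel, hXτ, hXσ, Sym2.eq_iff] at he
        rcases he with ⟨h1, h2⟩ | ⟨h1, h2⟩
        · have a := hge _ h2
          have b := hnu _ h1
          omega
        · have a := hge _ h1
          have b := hnu _ h2
          omega
      · rw [Nat.add_sub_cancel, hXτ]; exact hu0
      · rw [Nat.add_sub_cancel, hXτ, hT, hT]
        have h := hm.1
        cases u with
        | nil => exact absurd rfl hu0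
        | cons k' u' =>
          simp only [tp, Option.some.injEq] at h
          exact h
      · rw [Nat.add_sub_cancel, hXτ, hXσ, hT, hT]
        exact (congrArg Prod.snd hm.2).symm
      · rw [hXσ]; exact hK

end Regeneration

/-! ### Regenerations as renewals and the transition matrix of the types chain. -/

section Types

variable {m : ℕ} {r : Fin m} {ω : Reservoir m} {ξ : WalkSeed} {K : ℕ}

theorem isNthRegeneration_one_iff {s : Sample m} {σ : ℕ} :
    IsNthRegeneration K s 1 σ ↔ IsRegeneration K s σ ∧ ∀ τ < σ, ¬ IsRegeneration K s τ := by
  refine and_congr_right fun _ => ?_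
  have hfin : {τ | τ < σ ∧ IsRegeneration K s τ}.Finite :=
    (Set.finite_lt_nat σ).subset fun τ h => h.1
  rw [Nat.add_eq_right, Set.ncard_eq_zero hfin, Set.eq_empty_iff_forall_notMem]
  simp

theorem CutEver.type_eq {v : Node} {σ : ℕ} {i : Fin m} (h : CutEver (none, r) ω ξ v σ)
    (hm : Marked goodMark (none, r) ω v) :
    (Sample.type (r, ω, ξ) (Sample.X (r, ω, ξ) (σ - 1)),
      Sample.type (r, ω, ξ) (Sample.X (r, ω, ξ) σ)) = (i, i) ↔ tp (none, r) ω v = (some i, i) := by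
  have hX : ∀ t, pos (none, r) ω ξ (some []) t = some (Sample.X (r, ω, ξ) t) := pos_eq_walk r ω ξ
  have hT : ∀ u, Sample.type (r, ω, ξ) u = (tp (none, r) ω u).2 := fun u =>
    congrArg Prod.snd (typePair_eq_tp r ω u)
  obtain ⟨hpos, -, -, -, -, hte, -⟩ :=
    isRegeneration_iff.2 ⟨v, h, hm, (show 0 < v.length by
      cases v with
      | nil => exact hm.elim
      | cons k u => simp)⟩
  have hXσ : Sample.X (r, ω, ξ) σ = v := by
    have := h.1.1
    rw [hX] at this
    exact Option.some.inj this
  rw [hte, hXσ, hT]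
  constructor
  · intro h'
    have h2 := congrArg Prod.snd h'
    cases v with
    | nil => exact hm.elim
    | cons k u =>
      have := hm.2
      rw [this] at h2 ⊢
      simp only at h2
      rw [h2]
  · intro h'
    rw [h']

theorem Marked.at {P : Mark m} {p : Pair m} {v : Node} {e : Fin m} :
    Marked (P.at e) p ω v ↔ Marked P p ω v ∧ tp p ω v = (some e, e) := by
  cases v with
  | nil => simp [Marked]
  | cons k u => rfl

/-- Survival below `v` makes every earlier cut that lasts until the visit to `v` permanent. Hence it
is enough to exclude cuts up to that time, and the future enters through `Alive` alone. -/
theorem mem_regenerationType_one {i : Fin m} :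
    (r, ω, ξ) ∈ regenerationType K 1 (i, i) ↔ ∃ x : Node × ℕ,
      Past K goodMark (goodMark.at i) (none, r) ω ξ x.1 x.2 ∧
        Alive (tp (none, r) ω x.1) (shift x.1 ω) (seedShift x.2 ξ) := by
  constructor
  · rintro ⟨σ, hσ, hty⟩
    rw [isNthRegeneration_one_iff] at hσ
    obtain ⟨hreg, hno⟩ := hσ
    obtain ⟨v, hc, hm, hK⟩ := isRegeneration_iff.1 hreg
    rw [hc.type_eq hm] at hty
    refine ⟨(v, σ), ⟨hc.1, hK, Marked.at.2 ⟨hm, hty⟩, ?_⟩, (cutEver_iff.1 hc).2⟩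
    intro w t₁ ht hw hwm hcut
    exact hno t₁ ht (isRegeneration_iff.2 ⟨w, hcut.cutEver ht.le hc, hwm, hw⟩)
  · rintro ⟨⟨v, σ⟩, ⟨hf, hK, hm, hn⟩, ha⟩
    have hc := cutEver_iff.2 ⟨hf, ha⟩
    have hm' := Marked.at.1 hm
    refine ⟨σ, isNthRegeneration_one_iff.2 ⟨isRegeneration_iff.2 ⟨v, hc, hm'.1, hK⟩, ?_⟩,
      (hc.type_eq hm'.1).2 hm'.2⟩
    intro τ hτ hreg
    obtain ⟨w, hcw, hmw, hKw⟩ := isRegeneration_iff.1 hreg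
    exact hn w τ hτ hKw hmw (hcw.cutUpTo _)

/-- Below the first regeneration node all depths exceed `K`, so the second segment is described by
`Past 0`, independently of `K`. The root of the subtree is never `Marked` there, so the first
regeneration is not counted again. -/
theorem mem_regenerationType_one_two {i j : Fin m} :
    (r, ω, ξ) ∈ regenerationType K 1 (i, i) ∩ regenerationType K 2 (j, j) ↔ ∃ x : Node × ℕ,
      Past K goodMark (goodMark.at i) (none, r) ω ξ x.1 x.2 ∧ ∃ y : Node × ℕ,
        Past 0 goodMark (goodMark.at j) (tp (none, r) ω x.1) (shift x.1 ω) (seedShift x.2 ξ)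
          y.1 y.2 ∧
        Alive (tp (tp (none, r) ω x.1) (shift x.1 ω) y.1) (shift y.1 (shift x.1 ω))
          (seedShift y.2 (seedShift x.2 ξ)) := by
  constructor
  · rintro ⟨h1, σ₂, hσ₂, hty₂⟩
    obtain ⟨⟨v, σ₁⟩, ⟨hf, hK, hm, hn⟩, ha⟩ := mem_regenerationType_one.1 h1
    have hm' := Marked.at.1 hm
    have hc := cutEver_iff.2 ⟨hf, ha⟩
    have hreg₁ : IsRegeneration K (r, ω, ξ) σ₁ := isRegeneration_iff.2 ⟨v, hc, hm'.1, hK⟩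
    have hno₁ : ∀ τ < σ₁, ¬ IsRegeneration K (r, ω, ξ) τ := by
      intro τ hτ hreg
      obtain ⟨w, hcw, hmw, hKw⟩ := isRegeneration_iff.1 hreg
      exact hn w τ hτ hKw hmw (hcw.cutUpTo _)
    obtain ⟨hreg₂, hcard⟩ := hσ₂
    have hlt : σ₁ < σ₂ := by
      by_contra hge
      have hemp : {τ | τ < σ₂ ∧ IsRegeneration K (r, ω, ξ) τ} = ∅ :=
        Set.eq_empty_iff_forall_notMem.2 fun τ hτ => hno₁ τ (by have := hτ.1; omega) hτ.2
      rw [hemp, Set.ncard_empty] at hcard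
      omega
    have hset : ∀ τ < σ₂, IsRegeneration K (r, ω, ξ) τ → τ = σ₁ := by
      have h1 : {τ | τ < σ₂ ∧ IsRegeneration K (r, ω, ξ) τ}.ncard = 1 := by omega
      obtain ⟨a, ha⟩ := Set.ncard_eq_one.1 h1
      have h2 : σ₁ ∈ ({a} : Set ℕ) := ha ▸ ⟨hlt, hreg₁⟩
      intro τ hτ hreg
      have h3 : τ ∈ ({a} : Set ℕ) := ha ▸ ⟨hτ, hreg⟩
      rw [Set.mem_singleton_iff] at h2 h3
      rw [h2, h3]
    obtain ⟨v₂, hc₂, hm₂, hK₂⟩ := isRegeneration_iff.1 hreg₂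
    rw [hc₂.type_eq hm₂] at hty₂
    obtain ⟨n, rfl⟩ := Nat.exists_eq_add_of_le hlt.le
    obtain ⟨a, rfl⟩ : v <:+ v₂ := by
      have := hc.2 (σ₁ + n) hlt.le
      rwa [hc₂.1.1, inSub_some] at this
    have ha0 : a ≠ [] := by
      rintro rfl
      have := hc₂.1.unique hc.1
      omega
    refine ⟨(v, σ₁), ⟨hf, hK, hm, hn⟩, (a, n), ⟨hf.shift_iff.2 ⟨hc₂.1, ha n⟩,
      List.length_pos_iff.2 ha0, ?_, ?_⟩, ?_⟩
    · exact Marked.at.2 ⟨(marked_append _ ha0).1 hm₂, by rw [← tp_append]; exact hty₂⟩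
    · intro w t₁ ht hw hwm hcut
      have hw0 := List.length_pos_iff.1 hw
      have hK' : K < v.length := hK
      have hcut' := ((hf.cutUpTo_shift_iff ht.le).1 hcut).1
      have hreg : IsRegeneration K (r, ω, ξ) (σ₁ + t₁) := isRegeneration_iff.2
        ⟨w ++ v, hcut'.cutEver (by omega) hc₂, (marked_append _ hw0).2 hwm,
          by rw [List.length_append]; omega⟩
      have := hset _ (by omega) hreg
      have ht0 : t₁ = 0 := by omega
      have e := hcut.1.1
      rw [ht0] at e
      exact hw0 (Option.some.inj e).symm
    · have := (cutEver_iff.1 hc₂).2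
      rw [shift_append, seedShift_add, tp_append] at this
      exact this
  · rintro ⟨⟨v, σ₁⟩, hpast, ⟨a, n⟩, ⟨hfa, haK, ham, han⟩, haa⟩
    have hf := hpast.1
    have hax := hfa.alive haa
    refine ⟨mem_regenerationType_one.2 ⟨(v, σ₁), hpast, hax⟩, ?_⟩
    have hm' := Marked.at.1 hpast.2.2.1
    have ham' := Marked.at.1 ham
    have ha0 := List.length_pos_iff.1 haK
    have hc := cutEver_iff.2 ⟨hf, hax⟩
    have hreg₁ : IsRegeneration K (r, ω, ξ) σ₁ :=
      isRegeneration_iff.2 ⟨v, hc, hm'.1, hpast.2.1⟩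
    have hc₂ : CutEver (none, r) ω ξ (a ++ v) (σ₁ + n) := by
      refine cutEver_iff.2 ⟨(hf.shift_iff.1 hfa).1, ?_⟩
      rw [shift_append, seedShift_add, tp_append]
      exact haa
    have hm₂ : Marked goodMark (none, r) ω (a ++ v) := (marked_append _ ha0).2 ham'.1
    have hKv : K < v.length := hpast.2.1
    have hn0 : 0 < n := by
      by_contra h0
      have h00 : n = 0 := by omega
      subst h00
      exact ha0 (Option.some.inj hfa.1).symm
    refine ⟨σ₁ + n, ⟨isRegeneration_iff.2 ⟨a ++ v, hc₂, hm₂, by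
      rw [List.length_append]; omega⟩, ?_⟩, ?_⟩
    · have : {τ | τ < σ₁ + n ∧ IsRegeneration K (r, ω, ξ) τ} = {σ₁} := by
        ext τ
        simp only [Set.mem_ofPred_eq, Set.mem_singleton_iff]
        constructor
        · rintro ⟨hτ, hreg⟩
          obtain ⟨w, hcw, hmw, hKw⟩ := isRegeneration_iff.1 hreg
          rcases lt_trichotomy τ σ₁ with hlt | heq | hgt
          · exact absurd (hcw.cutUpTo _) (hpast.2.2.2 w τ hlt hKw hmw)
          · exact heq
          · exfalso
            obtain ⟨l, rfl⟩ := Nat.exists_eq_add_of_le hgt.le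
            obtain ⟨b, rfl⟩ : v <:+ w := by
              have := hc.2 (σ₁ + l) hgt.le
              rwa [hcw.1.1, inSub_some] at this
            have hb0 : b ≠ [] := by
              rintro rfl
              have := hcw.1.unique hc.1
              omega
            refine han b l (by omega) (List.length_pos_iff.2 hb0) ((marked_append _ hb0).1 hmw) ?_
            exact (hf.cutUpTo_shift_iff (by omega)).2 ⟨hcw.cutUpTo _, hax n⟩
        · rintro rfl
          exact ⟨by omega, hreg₁⟩
      rw [this, Set.ncard_singleton]
    · exact (hc₂.type_eq hm₂).2 (by rw [tp_append]; exact ham'.2)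

/-- The weight of the first regeneration time being of type `(i,i)`, without the escape. -/
def firstWeight (M : Model m) (ν : PMF (Fin m)) (K : ℕ) (i : Fin m) : ℝ≥0∞ :=
  ∑ r, ν r * ∑' x, pastMass M K goodMark (goodMark.at i) (none, r) x

/-- The weight of the segments between regeneration times of types `(i,i)` and `(j,j)`. -/
def goodWeight (M : Model m) (i j : Fin m) : ℝ≥0∞ :=
  ∑' x, pastMass M 0 goodMark (goodMark.at j) (some i, i) x

theorem goodMark_at_imp (i : Fin m) (x y : Pair m) (h : goodMark.at i x y) : goodMark x y := h.1

theorem mark_at_eq (P : Mark m) (i : Fin m) (x y : Pair m) (h : P.at i x y) : y = (some i, i) := h.2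

theorem law_apply (M : Model m) (ν : PMF (Fin m)) {A : Set (Sample m)}
    {B : Fin m → Set (Reservoir m × WalkSeed)} (hB : ∀ r, MeasurableSet (B r))
    (hAB : ∀ r z, (r, z) ∈ A ↔ z ∈ B r) :
    MeasurableSet A ∧ law M ν A = ∑ r, ν r * jointLaw M (B r) := by
  have hA : MeasurableSet A := by
    have : A = ⋃ r, ({r} : Set (Fin m)) ×ˢ B r := by
      ext ⟨r, z⟩
      simp [hAB]
    rw [this]
    exact MeasurableSet.iUnion fun r => (measurableSet_singleton r).prod (hB r)
  refine ⟨hA, ?_⟩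
  rw [law_eq, Measure.prod_apply hA, lintegral_fintype]
  refine Finset.sum_congr rfl fun r _ => ?_
  rw [PMF.toMeasure_apply_singleton _ _ (measurableSet_singleton r), mul_comm]
  congr 2
  ext z
  exact hAB r z

theorem law_regenerationType_one (M : Model m) (ν : PMF (Fin m)) (K : ℕ) (i : Fin m) :
    MeasurableSet (regenerationType K 1 (i, i) : Set (Sample m)) ∧
    law M ν (regenerationType K 1 (i, i)) = firstWeight M ν K i * esc M (some i, i) := by
  have hmeas : ∀ r : Fin m, MeasurableSet {z : Reservoir m × WalkSeed | ∃ x : Node × ℕ,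
      Past K goodMark (goodMark.at i) (none, r) z.1 z.2 x.1 x.2 ∧
        Alive (tp (none, r) z.1 x.1) (shift x.1 z.1) (seedShift x.2 z.2)} := by
    intro r
    refine measurableSet_setOfPred.2 (Measurable.exists fun x => ?_)
    refine (measurable_past _ _ _ _ _ _).and ?_
    refine measurable_apply_countable (f := fun (q : Pair m) (z : Reservoir m × WalkSeed) =>
      Alive q (shift x.1 z.1) (seedShift x.2 z.2)) (fun q => ?_)
      ((measurable_tp _ _).comp measurable_fst)
    exact (measurable_alive q).comp (((measurable_shift _).comp measurable_fst).prodMk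
        ((measurable_seedShift _).comp measurable_snd))
  obtain ⟨h1, h2⟩ := law_apply M ν (A := regenerationType K 1 (i, i)) hmeas
    fun r z => mem_regenerationType_one
  refine ⟨h1, h2.trans ?_⟩
  rw [firstWeight, Finset.sum_mul]
  refine Finset.sum_congr rfl fun r _ => ?_
  rw [jointLaw_exists_past M K (none, r) (mark_at_eq _ i) (goodMark_at_imp i) (B := Alive)
    (measurable_alive _) (fun _ _ h => h), mul_assoc]
  rfl

theorem law_regenerationType_one_two (M : Model m) (ν : PMF (Fin m)) (K : ℕ) (i j : Fin m) :
    law M ν (regenerationType K 1 (i, i) ∩ regenerationType K 2 (j, j)) =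
      firstWeight M ν K i * (goodWeight M i j * esc M (some j, j)) := by
  set B : Pair m → Reservoir m → WalkSeed → Prop := fun q ω ξ => ∃ y : Node × ℕ,
    Past 0 goodMark (goodMark.at j) q ω ξ y.1 y.2 ∧
        Alive (tp q ω y.1) (shift y.1 ω) (seedShift y.2 ξ) with hBdef
  have hB : ∀ q, Measurable fun z : Reservoir m × WalkSeed => B q z.1 z.2 := by
    intro q
    refine Measurable.exists fun y => (measurable_past _ _ _ _ _ _).and ?_
    refine measurable_apply_countable (f := fun (q : Pair m) (z : Reservoir m × WalkSeed) =>
      Alive q (shift y.1 z.1) (seedShift y.2 z.2)) (fun q => ?_)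
      ((measurable_tp _ _).comp measurable_fst)
    exact (measurable_alive q).comp (((measurable_shift _).comp measurable_fst).prodMk
        ((measurable_seedShift _).comp measurable_snd))
  have hmeas : ∀ r : Fin m, MeasurableSet {z : Reservoir m × WalkSeed | ∃ x : Node × ℕ,
      Past K goodMark (goodMark.at i) (none, r) z.1 z.2 x.1 x.2 ∧
        B (tp (none, r) z.1 x.1) (shift x.1 z.1) (seedShift x.2 z.2)} := by
    intro r
    refine measurableSet_setOfPred.2 (Measurable.exists fun x => ?_)
    refine (measurable_past _ _ _ _ _ _).and ?_
    refine measurable_apply_countable (f := fun (q : Pair m) (z : Reservoir m × WalkSeed) =>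
      B q (shift x.1 z.1) (seedShift x.2 z.2)) (fun q => ?_)
      ((measurable_tp _ _).comp measurable_fst)
    exact (hB q).comp (((measurable_shift _).comp measurable_fst).prodMk
        ((measurable_seedShift _).comp measurable_snd))
  obtain ⟨-, h2⟩ := law_apply M ν
    (A := regenerationType K 1 (i, i) ∩ regenerationType K 2 (j, j)) hmeas
    fun r z => mem_regenerationType_one_two
  rw [h2, firstWeight, Finset.sum_mul]
  refine Finset.sum_congr rfl fun r _ => ?_
  rw [jointLaw_exists_past M K (none, r) (mark_at_eq _ i) (goodMark_at_imp i) (B := B) (hB _),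
    mul_assoc]
  · congr 2
    exact jointLaw_exists_past M 0 (some i, i) (mark_at_eq _ j) (goodMark_at_imp j) (B := Alive)
      (measurable_alive _) (fun _ _ h => h)
  · rintro ω ξ ⟨y, hy, hya⟩
    exact hy.1.alive hya

/-- The weight of the initial segment, which alone involves `ν` and `K`, cancels in the conditional
probability. -/
theorem typesChain_eq (M : Model m) (ν : PMF (Fin m)) (K : ℕ) (i j : Fin m)
    (hpos : firstWeight M ν K i ≠ 0) (hesc : esc M (some i, i) ≠ 0) :
    typesChain M ν K i j =
      (goodWeight M i j * esc M (some j, j)).toReal / (esc M (some i, i)).toReal := by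
  have hle : firstWeight M ν K i * esc M (some i, i) ≤ 1 := by
    rw [← (law_regenerationType_one M ν K i).2]
    have : IsProbabilityMeasure (law M ν) := by rw [law_eq]; infer_instance
    exact prob_le_one
  have hfin : firstWeight M ν K i ≠ ⊤ := by
    intro h
    rw [h, ENNReal.top_mul hesc] at hle
    exact absurd hle (by simp)
  simp only [typesChain, typesTransition, Matrix.submatrix_apply, Matrix.of_apply, Measure.real]
  rw [ProbabilityTheory.cond_apply (law_regenerationType_one M ν K i).1,
    (law_regenerationType_one M ν K i).2, law_regenerationType_one_two]
  have ha : (firstWeight M ν K i).toReal ≠ 0 := (ENNReal.toReal_pos hpos hfin).ne'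
  rw [ENNReal.toReal_mul, ENNReal.toReal_inv, ENNReal.toReal_mul, ENNReal.toReal_mul,
    mul_inv]
  field_simp

end Types

section Quenched

variable {m : ℕ}

/-! ### One step of the walk on a fixed tree -/

theorem lintegral_seedLaw_first {d : ℕ} (F : Bool → Fin (d + 1) → ℝ≥0∞) :
    ∫⁻ ξ, F (ξ.1 0) (ξ.2 (0, d)) ∂seedLaw =
      2⁻¹ * ((∑ i, F true i) / (d + 1 : ℕ)) + 2⁻¹ * ((∑ i, F false i) / (d + 1 : ℕ)) := by
  have h1 : MeasurePreserving (fun x : ℕ → Bool => x 0)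
      (Measure.infinitePi fun _ : ℕ => (PMF.uniformOfFintype Bool).toMeasure)
      (PMF.uniformOfFintype Bool).toMeasure := measurePreserving_eval_infinitePi _ 0
  have h2 : MeasurePreserving (fun x : (p : ℕ × ℕ) → Fin (p.2 + 1) => x (0, d))
      (Measure.infinitePi fun p : ℕ × ℕ => (PMF.uniformOfFintype (Fin (p.2 + 1))).toMeasure)
      (PMF.uniformOfFintype (Fin (d + 1))).toMeasure :=
    measurePreserving_eval_infinitePi
      (fun p : ℕ × ℕ => (PMF.uniformOfFintype (Fin (p.2 + 1))).toMeasure) (0, d)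
  have h3 := h1.prod h2
  have h4 := h3.lintegral_comp (f := fun z : Bool × Fin (d + 1) => F z.1 z.2)
    (measurable_of_countable _)
  rw [show seedLaw = _ from rfl]
  refine h4.trans ?_
  rw [lintegral_prod _ (measurable_of_countable _).aemeasurable, lintegral_fintype]
  simp only [lintegral_fintype, PMF.toMeasure_apply_singleton _ _ (measurableSet_singleton _),
    PMF.uniformOfFintype_apply, Fintype.univ_bool, Fintype.card_bool, Fintype.card_fin]
  rw [Finset.sum_pair (by simp)]
  simp only [← Finset.sum_mul, div_eq_mul_inv]
  push_cast
  ring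

theorem measurable_pos_seed (p : Pair m) (ω : Reservoir m) (o : Option Node) (t : ℕ) :
    Measurable fun ξ : WalkSeed => pos p ω ξ o t :=
  (measurable_pos p o t).comp (measurable_const.prodMk measurable_id)

/-- The mean of `g` after one step from `u`, on the tree whose root has a parent. -/
def stepMean (p : Pair m) (ω : Reservoir m) (g : Option Node → ℝ≥0∞) (u : Node) : ℝ≥0∞ :=
  2⁻¹ * g (some u) + 2⁻¹ *
    (((∑ k ∈ Finset.range (kids p ω u).length, g (some (k :: u))) + g (up u)) /
      ((kids p ω u).length + 1 : ℕ))

theorem nbrs_of_ne {p : Pair m} {u : Node} (h : ¬ (u = [] ∧ p.1 = none)) (ω : Reservoir m) :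
    nbrs p ω u = (List.range (kids p ω u).length).map (fun k => some (k :: u)) ++ [up u] := by
  rw [nbrs, if_neg h]

/-- The truncated `length - 1 + 1` covers an empty list of neighbours: the single draw then returns
the default and the walk stays. -/
theorem lintegral_pos_one (p : Pair m) (ω : Reservoir m) (u : Node) (g : Option Node → ℝ≥0∞) :
    ∫⁻ ξ, g (pos p ω ξ (some u) 1) ∂seedLaw = 2⁻¹ * g (some u) + 2⁻¹ *
      ((∑ i ∈ Finset.range ((nbrs p ω u).length - 1 + 1), g ((nbrs p ω u).getD i (some u))) /
        ((nbrs p ω u).length - 1 + 1 : ℕ)) := by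
  set L := nbrs p ω u
  have h := lintegral_seedLaw_first (d := L.length - 1)
    (fun b i => g (if b then some u else L.getD i (some u)))
  refine h.trans ?_
  congr 1
  · simp only [if_true, Finset.sum_const, Finset.card_univ, Fintype.card_fin, nsmul_eq_mul]
    rw [mul_comm ((L.length - 1 + 1 : ℕ) : ℝ≥0∞), ENNReal.mul_div_cancel_right
      (by simp) (ENNReal.natCast_ne_top _)]
  · rw [← Fin.sum_univ_eq_sum_range (fun i => g (L.getD i (some u)))]
    simp

theorem lintegral_pos_one_of_ne (p : Pair m) (ω : Reservoir m) (u : Node)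
    (g : Option Node → ℝ≥0∞) (h : ¬ (u = [] ∧ p.1 = none)) :
    ∫⁻ ξ, g (pos p ω ξ (some u) 1) ∂seedLaw = stepMean p ω g u := by
  rw [lintegral_pos_one, nbrs_of_ne h, stepMean]
  simp only [List.length_append, List.length_map, List.length_range, List.length_singleton,
    Nat.add_sub_cancel]
  rw [Finset.sum_range_succ]
  set L := (List.range (kids p ω u).length).map (fun k => some (k :: u))
  have hL : L.length = (kids p ω u).length := by simp [L]
  have e1 : ∀ i ∈ Finset.range (kids p ω u).length,
      g ((L ++ [up u]).getD i (some u)) = g (some (i :: u)) := by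
    intro i hi
    rw [Finset.mem_range, ← hL] at hi
    rw [List.getD_append _ _ _ _ hi, List.getD_eq_getElem _ _ hi]
    simp [L]
  have e2 : (L ++ [up u]).getD (kids p ω u).length (some u) = up u := by
    rw [List.getD_append_right _ _ _ _ hL.le, hL]
    simp
  rw [Finset.sum_congr rfl e1, e2]

/-- The Markov property at time `1`, on a fixed tree. -/
theorem seedLaw_first_step (p : Pair m) (ω : Reservoir m) (o : Option Node)
    {H : Option Node → WalkSeed → Prop} (hH : ∀ o', Measurable (H o')) :
    seedLaw {ξ | H (pos p ω ξ o 1) (seedShift 1 ξ)} =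
      ∫⁻ ξ, seedLaw {ξ' | H (pos p ω ξ o 1) ξ'} ∂seedLaw := by
  have hmp := measurable_pos_seed p ω o 1
  have h1 : {ξ | H (pos p ω ξ o 1) (seedShift 1 ξ)} =
      ⋃ o', {ξ | ξ ∈ {ξ | pos p ω ξ o 1 = o'} ∧ seedShift 1 ξ ∈ {ξ | H o' ξ}} := by
    ext ξ; simp
  have hms : ∀ o', MeasurableSet {ξ : WalkSeed | pos p ω ξ o 1 = o'} := fun o' =>
    hmp (measurableSet_singleton o')
  rw [h1, measure_iUnion]
  · have h2 : ∀ o', seedLaw {ξ | ξ ∈ {ξ | pos p ω ξ o 1 = o'} ∧ seedShift 1 ξ ∈ {ξ | H o' ξ}} =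
        seedLaw {ξ | H o' ξ} * seedLaw ((fun ξ => pos p ω ξ o 1) ⁻¹' {o'}) := by
      intro o'
      rw [seedLaw_restart 1 (hms o') (measurableSet_setOfPred.2 (hH o')), mul_comm]
      · rfl
      · intro ξ ξ₂ hc hch h
        simp only [Set.mem_ofPred_eq, pos] at h ⊢
        rw [← h, hc 0 (by omega)]
        congr 1
        funext d
        exact (hch 0 (by omega) d).symm
    simp only [h2]
    rw [← lintegral_map (μ := seedLaw) (g := fun ξ => pos p ω ξ o 1)
      (f := fun o' => seedLaw {ξ' | H o' ξ'}) (measurable_of_countable _) hmp, lintegral_countable']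
    exact tsum_congr fun o' => by rw [Measure.map_apply hmp (measurableSet_singleton o')]
  · intro a b hab
    refine Set.disjoint_left.2 fun ξ h h' => hab (h.1.symm.trans h'.1)
  · intro o'
    exact (hms o').inter (measurable_seedShift 1 (measurableSet_setOfPred.2 (hH o')))

/-- The probability, on a fixed tree, that the walk from `o` visits `T` until time `n`. -/
def hitBy (p : Pair m) (ω : Reservoir m) (T : Set (Option Node)) (n : ℕ) (o : Option Node) :
    ℝ≥0∞ :=
  seedLaw {ξ | ∃ s ≤ n, pos p ω ξ o s ∈ T}

theorem measurable_hitSet (p : Pair m) (ω : Reservoir m) (T : Set (Option Node)) (n : ℕ)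
    (o : Option Node) : Measurable fun ξ : WalkSeed => ∃ s ≤ n, pos p ω ξ o s ∈ T :=
  Measurable.exists fun s => measurable_const.and
    ((measurable_of_countable (· ∈ T)).comp (measurable_pos_seed p ω o s))

variable {p : Pair m} {ω : Reservoir m} {T : Set (Option Node)} {n : ℕ}

theorem hitBy_of_mem {o : Option Node} (h : o ∈ T) : hitBy p ω T n o = 1 := by
  have : {ξ : WalkSeed | ∃ s ≤ n, pos p ω ξ o s ∈ T} = Set.univ :=
    Set.eq_univ_of_forall fun ξ => ⟨0, Nat.zero_le _, h⟩
  rw [hitBy, this, measure_univ]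

theorem hitBy_none (h : none ∉ T) : hitBy p ω T n none = 0 := by
  have : {ξ : WalkSeed | ∃ s ≤ n, pos p ω ξ none s ∈ T} = ∅ :=
    Set.eq_empty_iff_forall_notMem.2 fun ξ ⟨s, _, hs⟩ => h (by rwa [pos_none] at hs)
  rw [hitBy, this, measure_empty]

theorem hitBy_zero {o : Option Node} (h : o ∉ T) : hitBy p ω T 0 o = 0 := by
  have : {ξ : WalkSeed | ∃ s ≤ 0, pos p ω ξ o s ∈ T} = ∅ :=
    Set.eq_empty_iff_forall_notMem.2 fun ξ ⟨s, hs0, hs⟩ => h (by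
      rw [Nat.le_zero.1 hs0] at hs
      exact hs)
  rw [hitBy, this, measure_empty]

theorem hitBy_succ (hp : p.1 ≠ none) {u : Node} (h : some u ∉ T) :
    hitBy p ω T (n + 1) (some u) = stepMean p ω (hitBy p ω T n) u := by
  rw [← lintegral_pos_one_of_ne p ω u _ fun h => hp h.2]
  simp only [hitBy]
  rw [← seedLaw_first_step p ω (some u) (H := fun o' ξ => ∃ s ≤ n, pos p ω ξ o' s ∈ T)
    fun o' => measurable_hitSet p ω T n o']
  congr 1
  ext ξ
  simp only [Set.mem_ofPred_eq]
  constructor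
  · rintro ⟨s, hs, hT⟩
    cases s with
    | zero => exact absurd hT h
    | succ s =>
      refine ⟨s, by omega, ?_⟩
      rw [← pos_add, add_comm]
      exact hT
  · rintro ⟨s, hs, hT⟩
    rw [← pos_add] at hT
    exact ⟨1 + s, by omega, hT⟩

/-! ### The probability to reach a given depth -/

theorem toReal_stepMean {g : Option Node → ℝ≥0∞} (hg : ∀ o, g o ≤ 1) (u : Node) :
    (stepMean p ω g u).toReal = 1 / 2 * (g (some u)).toReal + 1 / 2 *
      (((∑ k ∈ Finset.range (kids p ω u).length, (g (some (k :: u))).toReal) +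
        (g (up u)).toReal) / ((kids p ω u).length + 1)) := by
  have hne : ∀ o, g o ≠ ⊤ := fun o => ne_top_of_le_ne_top ENNReal.one_ne_top (hg o)
  have hs : (∑ k ∈ Finset.range (kids p ω u).length, g (some (k :: u))) ≠ ⊤ :=
    ENNReal.sum_ne_top.2 fun k _ => hne _
  rw [stepMean, ENNReal.toReal_add, ENNReal.toReal_mul, ENNReal.toReal_mul, ENNReal.toReal_div,
    ENNReal.toReal_add hs (hne _), ENNReal.toReal_sum fun k _ => hne _, ENNReal.toReal_natCast]
  · push_cast
    norm_num
  · exact ENNReal.mul_ne_top (by simp) (hne _)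
  · refine ENNReal.mul_ne_top (by simp) (ENNReal.div_ne_top (ENNReal.add_ne_top.2 ⟨hs, hne _⟩) ?_)
    simp

/-- If all nodes have at least two children, then the walk from the root reaches depth `k` before
leaving through the parent of the root with probability at least `1/2`. -/
theorem half_le_depth (hp : p.1 ≠ none) (hkids : ∀ u, 2 ≤ (kids p ω u).length) (k : ℕ) :
    2⁻¹ ≤ seedLaw {ξ | ∃ s v, v.length = k ∧ pos p ω ξ (some []) s = some v} := by
  set T : Set (Option Node) := {o | ∃ v : Node, o = some v ∧ v.length = k} with hT
  have hnT : none ∉ T := by rintro ⟨v, hv, -⟩; simp at hv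
  -- For two children the error factor `4 / 3` per level averages to `(2 · 3/4 + 4/3) / 3 = 17/18`,
  -- and the lazy step gives `1/2 + 17/36`.
  set ρ : ℝ := 35 / 36 with hρ
  have hle1 : ∀ n o, hitBy p ω T n o ≤ 1 := fun n o => prob_le_one
  -- The function `1 - (1/2) ^ (depth + 1)` is harmonic for exactly two children, subharmonic for
  -- more, and vanishes at the exit, which has depth `-1`. The last term pays for the finite horizon
  -- `n` and disappears in the limit.
  have key : ∀ n (u : Node), u.length ≤ k →
      1 - (1 / 2) ^ (u.length + 1) - ρ ^ n * (4 / 3) ^ (k - u.length) ≤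
        (hitBy p ω T n (some u)).toReal := by
    intro n
    induction n with
    | zero =>
      intro u hu
      have h1 : (1 : ℝ) ≤ (4 / 3) ^ (k - u.length) := one_le_pow₀ (by norm_num)
      have h2 : (0 : ℝ) ≤ (1 / 2) ^ (u.length + 1) := by positivity
      have h3 : 0 ≤ (hitBy p ω T 0 (some u)).toReal := ENNReal.toReal_nonneg
      rw [pow_zero, one_mul]
      linarith
    | succ n ih =>
      intro u hu
      by_cases huT : some u ∈ T
      · rw [hitBy_of_mem huT, ENNReal.toReal_one]
        have h1 : (0 : ℝ) ≤ ρ ^ (n + 1) * (4 / 3) ^ (k - u.length) := by positivity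
        have h2 : (0 : ℝ) ≤ (1 / 2) ^ (u.length + 1) := by positivity
        linarith
      have hlt : u.length < k := lt_of_le_of_ne hu fun h => huT ⟨u, rfl, h⟩
      rw [hitBy_succ hp huT, toReal_stepMean (hle1 n)]
      set c := (kids p ω u).length with hc
      have hc2 : (2 : ℝ) ≤ c := by exact_mod_cast hkids u
      set x : ℝ := (1 / 2) ^ (u.length + 1) with hx
      set y : ℝ := ρ ^ n * (4 / 3) ^ (k - u.length) with hy
      have hx0 : 0 ≤ x := by positivity
      have hy0 : 0 ≤ y := by positivity
      have hchild : ∀ l, 1 - x / 2 - 3 / 4 * y ≤ (hitBy p ω T n (some (l :: u))).toReal := by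
        intro l
        have := ih (l :: u) (by simpa using hlt)
        refine le_trans (le_of_eq ?_) this
        have e1 : k - u.length = (k - (l :: u).length) + 1 := by simp; omega
        rw [hy, e1, List.length_cons, pow_succ, hx, pow_succ _ (u.length + 1)]
        ring
      have hself := ih u hu
      have hup : 1 - 2 * x - 4 / 3 * y ≤ (hitBy p ω T n (up u)).toReal := by
        cases u with
        | nil =>
          rw [up, hitBy_none hnT, ENNReal.toReal_zero]
          have hx' : x = 1 / 2 := by simp [hx]
          rw [hx']
          linarith
        | cons l u =>
          have := ih u (by simp at hu; omega)
          rw [up]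
          refine le_trans (le_of_eq ?_) this
          have e1 : k - u.length = (k - (l :: u).length) + 1 := by
            simp only [List.length_cons] at hlt ⊢; omega
          rw [hy, e1, hx, List.length_cons, pow_succ _ (u.length + 1), pow_succ _ (k - _)]
          ring
      have hsum : (c : ℝ) * (1 - x / 2 - 3 / 4 * y) ≤
          ∑ l ∈ Finset.range c, (hitBy p ω T n (some (l :: u))).toReal := by
        calc (c : ℝ) * (1 - x / 2 - 3 / 4 * y) = ∑ _l ∈ Finset.range c, (1 - x / 2 - 3 / 4 * y) := by
              rw [Finset.sum_const, Finset.card_range, nsmul_eq_mul]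
          _ ≤ _ := Finset.sum_le_sum fun l _ => hchild l
      have hfrac : 1 - x - 17 / 18 * y ≤
          ((∑ l ∈ Finset.range c, (hitBy p ω T n (some (l :: u))).toReal) +
            (hitBy p ω T n (up u)).toReal) / (c + 1) := by
        rw [le_div_iff₀ (by positivity)]
        nlinarith [mul_nonneg hx0 (sub_nonneg.2 hc2), mul_nonneg hy0 (sub_nonneg.2 hc2)]
      have e : ρ ^ (n + 1) * (4 / 3) ^ (k - u.length) = 35 / 36 * y := by
        rw [hy, pow_succ, hρ]; ring
      rw [e]
      linarith
  have hlim : Filter.Tendsto (fun n : ℕ => (1 : ℝ) / 2 - ρ ^ n * (4 / 3) ^ k) Filter.atTop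
      (nhds (1 / 2)) := by
    have := ((tendsto_pow_atTop_nhds_zero_of_lt_one (r := ρ) (by norm_num [hρ])
      (by norm_num [hρ])).mul_const ((4 / 3 : ℝ) ^ k)).const_sub (1 / 2)
    simpa using this
  set q := seedLaw {ξ | ∃ s v, v.length = k ∧ pos p ω ξ (some []) s = some v}
  have hq : ∀ n, (1 : ℝ) / 2 - ρ ^ n * (4 / 3) ^ k ≤ q.toReal := by
    intro n
    have h1 := key n [] (Nat.zero_le _)
    have h2 : (hitBy p ω T n (some [])).toReal ≤ q.toReal := by
      refine ENNReal.toReal_mono (measure_ne_top _ _) (measure_mono ?_)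
      rintro ξ ⟨s, -, v, hv, hvl⟩
      exact ⟨s, v, hvl, hv⟩
    simp only [List.length_nil, Nat.sub_zero] at h1
    norm_num at h1 ⊢
    linarith
  have hfin : (1 : ℝ) / 2 ≤ q.toReal := le_of_tendsto' hlim hq
  have : ENNReal.ofReal (1 / 2) ≤ q := ENNReal.ofReal_le_of_le_toReal hfin
  refine le_trans (le_of_eq ?_) this
  rw [one_div, ENNReal.ofReal_inv_of_pos (by norm_num)]
  simp

end Quenched

section Value

variable {m : ℕ} {p : Pair m} {ω : Reservoir m}

/-! ### Payoffs of the walk stopped at a node and at the exit -/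

/-- The mean payoff until time `n` of the walk, on a fixed tree, that is stopped with payoff `α` at
`w` and with payoff `β` at the exit `none`. -/
def val (p : Pair m) (ω : Reservoir m) (w : Option Node) (α β : ℝ≥0∞) : ℕ → Option Node → ℝ≥0∞
  | 0 => fun o => o.elim β fun u => if w = some u then α else 0
  | n + 1 => fun o => o.elim β fun u =>
      if w = some u then α else stepMean p ω (val p ω w α β n) u

/-- The mean payoff of the stopped walk. -/
def value (p : Pair m) (ω : Reservoir m) (w : Option Node) (α β : ℝ≥0∞) (o : Option Node) :
    ℝ≥0∞ :=
  ⨆ n, val p ω w α β n o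

theorem stepMean_mono {g h : Option Node → ℝ≥0∞} (hgh : ∀ o, g o ≤ h o) (u : Node) :
    stepMean p ω g u ≤ stepMean p ω h u := by
  unfold stepMean
  gcongr <;> exact hgh _

theorem stepMean_tendsto {g : ℕ → Option Node → ℝ≥0∞} {G : Option Node → ℝ≥0∞}
    (h : ∀ o, Tendsto (fun n => g n o) atTop (nhds (G o))) (u : Node) :
    Tendsto (fun n => stepMean p ω (g n) u) atTop (nhds (stepMean p ω G u)) := by
  unfold stepMean
  refine (ENNReal.Tendsto.const_mul (h _) (Or.inr (by simp))).add
    (ENNReal.Tendsto.const_mul (ENNReal.Tendsto.div_const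
      ((tendsto_finsetSum _ fun k _ => h _).add (h _)) (Or.inr ?_)) (Or.inr (by simp)))
  simp

variable {w : Option Node} {α β : ℝ≥0∞}

theorem val_none (n : ℕ) : val p ω w α β n none = β := by cases n <;> rfl

theorem val_target {u : Node} (h : w = some u) (n : ℕ) : val p ω w α β n (some u) = α := by
  cases n <;> simp [val, h]

theorem val_zero {u : Node} (h : w ≠ some u) : val p ω w α β 0 (some u) = 0 := by
  simp [val, h]

theorem val_succ {u : Node} (h : w ≠ some u) (n : ℕ) :
    val p ω w α β (n + 1) (some u) = stepMean p ω (val p ω w α β n) u := by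
  simp [val, h]

theorem val_le_succ (n : ℕ) (o : Option Node) : val p ω w α β n o ≤ val p ω w α β (n + 1) o := by
  induction n generalizing o with
  | zero =>
    cases o with
    | none => simp [val_none]
    | some u =>
      by_cases h : w = some u
      · simp [val_target h]
      · simp [val_zero h]
  | succ n ih =>
    cases o with
    | none => simp [val_none]
    | some u =>
      by_cases h : w = some u
      · simp [val_target h]
      · rw [val_succ h, val_succ h]
        exact stepMean_mono ih u

theorem val_monotone (o : Option Node) : Monotone fun n => val p ω w α β n o :=
  monotone_nat_of_le_succ fun n => val_le_succ n o

theorem val_tendsto (o : Option Node) :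
    Tendsto (fun n => val p ω w α β n o) atTop (nhds (value p ω w α β o)) :=
  tendsto_atTop_iSup (val_monotone o)

theorem val_le_value (n : ℕ) (o : Option Node) : val p ω w α β n o ≤ value p ω w α β o :=
  le_iSup (fun n => val p ω w α β n o) n

theorem value_none : value p ω w α β none = β := by simp [value, val_none]

theorem value_target {u : Node} (h : w = some u) : value p ω w α β (some u) = α := by
  simp [value, val_target h]

theorem value_eq_stepMean {u : Node} (h : w ≠ some u) :
    value p ω w α β (some u) = stepMean p ω (value p ω w α β) u := by
  refine tendsto_nhds_unique ((val_tendsto (some u)).comp (tendsto_add_atTop_nat 1)) ?_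
  refine Tendsto.congr (fun n => (val_succ h n).symm) ?_
  exact stepMean_tendsto (fun o => val_tendsto o) u

theorem stepMean_lift (g : Option Node → ℝ≥0∞) (u v : Node) :
    stepMean p ω g (u ++ v) = stepMean (tp p ω v) (shift v ω) (fun o => g (lift v o)) u := by
  unfold stepMean
  rw [kids_append]
  cases u <;> rfl

/-- The walk in the subtree at `v`, stopped when it leaves the subtree. -/
theorem value_lift {k : ℕ} {w' : Option Node}
    (hw : ∀ u : Node, w = some (u ++ [k]) ↔ w' = some u) (o : Option Node) :
    value p ω w α β (lift [k] o) = value (tp p ω [k]) (shift [k] ω) w' α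
      (value p ω w α β (some [])) o := by
  -- `value` is the limit of iterates that increase from the boundary payoffs, so each inequality
  -- compares the iterates of one side with the fixed point on the other; the one-step equation
  -- alone would not determine it on an infinite tree.
  apply le_antisymm
  · refine iSup_le fun n => ?_
    induction n generalizing o with
    | zero =>
      cases o with
      | none =>
        rw [value_none]
        exact val_le_value 0 _
      | some u =>
        by_cases h : w' = some u
        · rw [value_target h, lift, val_target ((hw u).2 h)]
        · rw [lift, val_zero (fun h' => h ((hw u).1 h'))]
          exact zero_le
    | succ n ih =>
      cases o with
      | none =>
        rw [value_none]
        exact val_le_value (n + 1) _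
      | some u =>
        by_cases h : w' = some u
        · rw [value_target h, lift, val_target ((hw u).2 h)]
        · rw [lift, val_succ (fun h' => h ((hw u).1 h')), value_eq_stepMean h, stepMean_lift]
          exact stepMean_mono ih u
  · refine iSup_le fun n => ?_
    induction n generalizing o with
    | zero =>
      cases o with
      | none => rw [val_none]; exact le_rfl
      | some u =>
        by_cases h : w' = some u
        · rw [val_target h, lift, value_target ((hw u).2 h)]
        · rw [val_zero h]
          exact zero_le
    | succ n ih =>
      cases o with
      | none => rw [val_none]; exact le_rfl
      | some u =>
        by_cases h : w' = some u
        · rw [val_target h, lift, value_target ((hw u).2 h)]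
        · rw [lift, val_succ h, value_eq_stepMean (fun h' => h ((hw u).1 h')), stepMean_lift]
          exact stepMean_mono ih u

theorem stepMean_linear (g h : Option Node → ℝ≥0∞) (u : Node) :
    stepMean p ω (fun o => α * g o + β * h o) u =
      α * stepMean p ω g u + β * stepMean p ω h u := by
  simp only [stepMean, Finset.sum_add_distrib, ← Finset.mul_sum, div_eq_mul_inv]
  ring

theorem val_linear (n : ℕ) (o : Option Node) :
    val p ω w α β n o = α * val p ω w 1 0 n o + β * val p ω w 0 1 n o := by
  induction n generalizing o with
  | zero =>
    cases o with
    | none => simp [val_none]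
    | some u =>
      by_cases h : w = some u
      · simp [val_target h]
      · simp [val_zero h]
  | succ n ih =>
    cases o with
    | none => simp [val_none]
    | some u =>
      by_cases h : w = some u
      · simp [val_target h]
      · simp only [val_succ h]
        rw [← stepMean_linear]
        congr 1
        funext o
        exact ih o

theorem value_linear (o : Option Node) :
    value p ω w α β o = α * value p ω w 1 0 o + β * value p ω w 0 1 o := by
  simp only [value, ENNReal.mul_iSup]
  rw [ENNReal.iSup_add_iSup_of_monotone]
  · exact iSup_congr fun n => val_linear n o
  · intro a b hab
    have := val_monotone (p := p) (ω := ω) (w := w) (α := 1) (β := 0) o hab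
    simp only at this ⊢
    gcongr
  · intro a b hab
    have := val_monotone (p := p) (ω := ω) (w := w) (α := 0) (β := 1) o hab
    simp only at this ⊢
    gcongr

theorem stepMean_one (u : Node) : stepMean p ω (fun _ => 1) u = 1 := by
  simp only [stepMean, Finset.sum_const, Finset.card_range, nsmul_eq_mul, mul_one]
  push_cast
  rw [ENNReal.div_self (by simp) (by simp), mul_one]
  exact ENNReal.inv_two_add_inv_two

theorem val_le_one (hα : α ≤ 1) (hβ : β ≤ 1) (n : ℕ) (o : Option Node) :
    val p ω w α β n o ≤ 1 := by
  induction n generalizing o with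
  | zero =>
    cases o with
    | none => simpa [val_none]
    | some u =>
      by_cases h : w = some u
      · simpa [val_target h]
      · simp [val_zero h]
  | succ n ih =>
    cases o with
    | none => simpa [val_none]
    | some u =>
      by_cases h : w = some u
      · simpa [val_target h]
      · rw [val_succ h, ← stepMean_one (p := p) (ω := ω) u]
        exact stepMean_mono ih u

theorem value_le_one (hα : α ≤ 1) (hβ : β ≤ 1) (o : Option Node) : value p ω w α β o ≤ 1 :=
  iSup_le fun n => val_le_one hα hβ n o

theorem val_no_target (n : ℕ) (o : Option Node) : val p ω none α 0 n o = 0 := by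
  induction n generalizing o with
  | zero => cases o <;> simp [val]
  | succ n ih =>
    cases o with
    | none => simp [val_none]
    | some u =>
      rw [val_succ (by simp)]
      simp [stepMean, ih]

theorem value_no_target (o : Option Node) : value p ω none α 0 o = 0 := by
  simp [value, val_no_target]

/-! ### The exit probability and the probability to hit a node -/

/-- The probability to leave through the parent of the root. -/
def exitP (p : Pair m) (ω : Reservoir m) : ℝ≥0∞ := value p ω none 0 1 (some [])

/-- The probability to hit `w` before leaving through the parent of the root. -/
def hitV (p : Pair m) (ω : Reservoir m) (w : Node) : ℝ≥0∞ := value p ω (some w) 1 0 (some [])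

/-- The probability to leave through the parent of the root before hitting `w`. -/
def missV (p : Pair m) (ω : Reservoir m) (w : Node) : ℝ≥0∞ := value p ω (some w) 0 1 (some [])

/-- The degree of the root minus the sum of the return probabilities from its children other than
`κ`. -/
def dval (p : Pair m) (ω : Reservoir m) (κ : ℕ) : ℝ :=
  (kids p ω []).length + 1 - ∑ k ∈ (Finset.range (kids p ω []).length).erase κ,
    (exitP (tp p ω [k]) (shift [k] ω)).toReal

theorem exitP_le_one : exitP p ω ≤ 1 := value_le_one zero_le_one le_rfl _

theorem hitV_le_one {w : Node} : hitV p ω w ≤ 1 := value_le_one le_rfl zero_le_one _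

theorem missV_le_one {w : Node} : missV p ω w ≤ 1 := value_le_one zero_le_one le_rfl _

/-- A side branch without the target pays nothing before the walk returns to the root. -/
theorem value_side {k : ℕ} (hw : ∀ u : Node, w ≠ some (u ++ [k])) :
    value p ω w α β (some [k]) =
      value p ω w α β (some []) * exitP (tp p ω [k]) (shift [k] ω) := by
  have := value_lift (p := p) (ω := ω) (w := w) (α := α) (β := β) (k := k) (w' := none)
    (fun u => by simp [hw u]) (some [])
  rw [lift, List.nil_append] at this
  rw [this, value_linear, value_no_target, mul_zero, zero_add]
  rfl

/-- The one-step equation at the root; the holding probability drops out. -/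
theorem value_root_eq (hα : α ≤ 1) (hβ : β ≤ 1) (hw : w ≠ some []) :
    ((kids p ω []).length + 1) * (value p ω w α β (some [])).toReal =
      ∑ k ∈ Finset.range (kids p ω []).length, (value p ω w α β (some [k])).toReal + β.toReal := by
  have h := congrArg ENNReal.toReal (value_eq_stepMean (p := p) (ω := ω) (α := α) (β := β) hw)
  rw [toReal_stepMean (value_le_one hα hβ), up, value_none] at h
  have hpos : (0 : ℝ) < (kids p ω []).length + 1 := by positivity
  field_simp at h
  linarith

theorem toReal_value_side {k : ℕ} (hw : ∀ u : Node, w ≠ some (u ++ [k])) :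
    (value p ω w α β (some [k])).toReal =
      (value p ω w α β (some [])).toReal * (exitP (tp p ω [k]) (shift [k] ω)).toReal := by
  rw [value_side hw, ENNReal.toReal_mul]

/-- The equation at the root is solved for the root value: side branches contribute their return
probabilities, which `dval` subtracts from the degree, and the branch `κ` either reaches the target
or returns. -/
theorem value_path_eq {κ : ℕ} (hκ : κ < (kids p ω []).length) (w' : Node) (hα : α ≤ 1)
    (hβ : β ≤ 1) :
    (value p ω (some (w' ++ [κ])) α β (some [])).toReal *
      (dval p ω κ - (missV (tp p ω [κ]) (shift [κ] ω) w').toReal) =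
      α.toReal * (hitV (tp p ω [κ]) (shift [κ] ω) w').toReal + β.toReal := by
  set V := value p ω (some (w' ++ [κ])) α β (some []) with hV
  have hVle : V ≤ 1 := value_le_one hα hβ _
  have hroot := value_root_eq (p := p) (ω := ω) (w := some (w' ++ [κ])) hα hβ (by simp)
  rw [← Finset.add_sum_erase _ _ (Finset.mem_range.2 hκ)] at hroot
  have hside : ∀ k ∈ (Finset.range (kids p ω []).length).erase κ,
      (value p ω (some (w' ++ [κ])) α β (some [k])).toReal =
        V.toReal * (exitP (tp p ω [k]) (shift [k] ω)).toReal := by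
    intro k hk
    refine toReal_value_side fun u => ?_
    have := Finset.ne_of_mem_erase hk
    intro h
    have h2 := congrArg List.getLast? (Option.some.inj h)
    simp at h2
    exact this h2.symm
  rw [Finset.sum_congr rfl hside, ← Finset.mul_sum] at hroot
  have hpath : (value p ω (some (w' ++ [κ])) α β (some [κ])).toReal =
      α.toReal * (hitV (tp p ω [κ]) (shift [κ] ω) w').toReal +
        V.toReal * (missV (tp p ω [κ]) (shift [κ] ω) w').toReal := by
    have := value_lift (p := p) (ω := ω) (w := some (w' ++ [κ])) (α := α) (β := β) (k := κ)
      (w' := some w') (fun u => by simp) (some [])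
    rw [lift, List.nil_append] at this
    rw [this, value_linear, ENNReal.toReal_add, ENNReal.toReal_mul, ENNReal.toReal_mul]
    · rfl
    · exact ENNReal.mul_ne_top (ne_top_of_le_ne_top ENNReal.one_ne_top hα)
        (ne_top_of_le_ne_top ENNReal.one_ne_top (value_le_one le_rfl zero_le_one _))
    · exact ENNReal.mul_ne_top (ne_top_of_le_ne_top ENNReal.one_ne_top hVle)
        (ne_top_of_le_ne_top ENNReal.one_ne_top (value_le_one zero_le_one le_rfl _))
  rw [hpath] at hroot
  unfold dval
  linarith

/-- If the path leaves the tree at the root, all true children have value at most the root value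
`V`, and the exit pays zero, so that `(n + 1) V ≤ n V` for `n` children. -/
theorem hitV_eq_zero_of_le {κ : ℕ} (hκ : (kids p ω []).length ≤ κ) (w' : Node) :
    hitV p ω (w' ++ [κ]) = 0 := by
  have hroot := value_root_eq (p := p) (ω := ω) (w := some (w' ++ [κ])) (α := 1) (β := 0)
    le_rfl zero_le_one (by simp)
  set V := value p ω (some (w' ++ [κ])) 1 0 (some []) with hV
  have hside : ∀ k ∈ Finset.range (kids p ω []).length,
      (value p ω (some (w' ++ [κ])) 1 0 (some [k])).toReal ≤ V.toReal := by
    intro k hk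
    rw [Finset.mem_range] at hk
    rw [toReal_value_side fun u => ?_]
    · refine mul_le_of_le_one_right ENNReal.toReal_nonneg ?_
      rw [← ENNReal.toReal_one]
      exact ENNReal.toReal_mono ENNReal.one_ne_top exitP_le_one
    · intro h
      have h2 := congrArg List.getLast? (Option.some.inj h)
      simp at h2
      omega
  have h2 := Finset.sum_le_sum hside
  rw [Finset.sum_const, Finset.card_range, nsmul_eq_mul] at h2
  simp only [ENNReal.toReal_zero, add_zero] at hroot
  have h3 : V.toReal ≤ 0 := by linarith
  have hVle : V ≤ 1 := value_le_one le_rfl zero_le_one _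
  have h4 : V.toReal = 0 := le_antisymm h3 ENNReal.toReal_nonneg
  rcases (ENNReal.toReal_eq_zero_iff _).1 h4 with h | h
  · exact h
  · rw [h] at hVle
    exact absurd hVle (by simp)

theorem two_le_dval {κ : ℕ} (hκ : κ < (kids p ω []).length) : 2 ≤ dval p ω κ := by
  have h1 : ∑ k ∈ (Finset.range (kids p ω []).length).erase κ,
      (exitP (tp p ω [k]) (shift [k] ω)).toReal ≤
      ∑ _k ∈ (Finset.range (kids p ω []).length).erase κ, (1 : ℝ) := by
    refine Finset.sum_le_sum fun k _ => ?_
    rw [← ENNReal.toReal_one]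
    exact ENNReal.toReal_mono ENNReal.one_ne_top exitP_le_one
  rw [Finset.sum_const, Finset.card_erase_of_mem (Finset.mem_range.2 hκ), Finset.card_range,
    nsmul_eq_mul, mul_one, Nat.cast_sub (by omega)] at h1
  unfold dval
  push_cast at h1
  linarith

/-! ### Continuants -/

/-- The continuant of a list and of its tail, with signs: `K(d₁,…,dₙ) = d₁ K(d₂,…) - K(d₃,…)`. -/
def contPair : List ℝ → ℝ × ℝ
  | [] => (1, 0)
  | d :: ds => (d * (contPair ds).1 - (contPair ds).2, (contPair ds).1)

theorem contPair_bounds {ds : List ℝ} (h : ∀ d ∈ ds, 2 ≤ d) :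
    1 ≤ (contPair ds).1 ∧ 0 ≤ (contPair ds).2 ∧ (contPair ds).2 ≤ (contPair ds).1 := by
  induction ds with
  | nil => simp [contPair]
  | cons d ds ih =>
    obtain ⟨h1, h2, h3⟩ := ih fun d' hd' => h d' (by simp [hd'])
    have hd := h d (by simp)
    simp only [contPair]
    refine ⟨by nlinarith, by linarith, by nlinarith⟩

theorem contPair_eq_mul (ds : List ℝ) :
    ∃ A : Matrix (Fin 2) (Fin 2) ℝ, A = (ds.map fun d => !![d, -1; 1, 0]).prod ∧
      (contPair ds).1 = A 0 0 ∧ (contPair ds).2 = A 1 0 := by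
  refine ⟨_, rfl, ?_⟩
  induction ds with
  | nil => simp [contPair]
  | cons d ds ih =>
    rw [List.map_cons, List.prod_cons]
    simp only [contPair, Matrix.mul_apply, Fin.sum_univ_two, ih.1, ih.2]
    simp
    ring

/-- The continuant is the corner entry of a product of two-by-two matrices. Transposition reverses
the product, and conjugation by `diag(1,-1)` restores each factor without changing the corner. -/
theorem contPair_reverse (ds : List ℝ) : (contPair ds.reverse).1 = (contPair ds).1 := by
  obtain ⟨_, rfl, h1, -⟩ := contPair_eq_mul ds.reverse
  obtain ⟨_, rfl, h2, -⟩ := contPair_eq_mul ds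
  rw [h1, h2]
  set S : Matrix (Fin 2) (Fin 2) ℝ := !![1, 0; 0, -1]
  have key : ∀ l : List ℝ, (l.reverse.map fun d => !![d, -1; 1, 0]).prod =
      S * (l.map fun d => !![d, -1; 1, 0]).prod.transpose * S := by
    intro l
    induction l with
    | nil =>
      ext i j
      fin_cases i <;> fin_cases j <;> simp [S, Matrix.mul_apply, Fin.sum_univ_two]
    | cons d l ih =>
      have hS : S * !![d, -1; 1, 0] = (!![d, -1; 1, 0] : Matrix (Fin 2) (Fin 2) ℝ).transpose * S := by
        ext i j
        fin_cases i <;> fin_cases j <;> simp [S, Matrix.mul_apply, Fin.sum_univ_two]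
      rw [List.reverse_cons, List.map_append, List.prod_append, ih, List.map_singleton,
        List.prod_singleton, List.map_cons (l := l), List.prod_cons, Matrix.transpose_mul]
      simp only [Matrix.mul_assoc, hS]
  rw [key]
  generalize (ds.map fun d => !![d, -1; 1, 0]).prod = B
  rw [Matrix.mul_apply, Fin.sum_univ_two, Matrix.mul_apply, Fin.sum_univ_two, Matrix.mul_apply,
    Fin.sum_univ_two]
  simp [S]

/-! ### The probability to hit a node as a continuant -/

/-- The values `dval` along the path with the indices `b` from the root. -/
def dlist (p : Pair m) (ω : Reservoir m) : List ℕ → List ℝ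
  | [] => []
  | κ :: b => dval p ω κ :: dlist (tp p ω [κ]) (shift [κ] ω) b

/-- The path with the indices `b` from the root stays in the tree. -/
def InTree (p : Pair m) (ω : Reservoir m) : List ℕ → Prop
  | [] => True
  | κ :: b => κ < (kids p ω []).length ∧ InTree (tp p ω [κ]) (shift [κ] ω) b

theorem two_le_of_mem_dlist {b : List ℕ} (hb : InTree p ω b) : ∀ d ∈ dlist p ω b, 2 ≤ d := by
  induction b generalizing p ω with
  | nil => simp [dlist]
  | cons κ b ih =>
    intro d hd
    rw [dlist, List.mem_cons] at hd
    rcases hd with rfl | hd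
    · exact two_le_dval hb.1
    · exact ih hb.2 d hd

/-- Gambler's ruin on the path once the side branches are eliminated: the determinants of the linear
system are continuants. The weight of the target does not occur, so target and exit play symmetric
roles. Nodes list their indices from the bottom, whence `b.reverse`. -/
theorem hitV_missV_eq {b : List ℕ} (hb : InTree p ω b) :
    (hitV p ω b.reverse).toReal = 1 / (contPair (dlist p ω b)).1 ∧
      (missV p ω b.reverse).toReal = (contPair (dlist p ω b)).2 / (contPair (dlist p ω b)).1 := by
  induction b generalizing p ω with
  | nil =>
    simp only [List.reverse_nil, hitV, missV, dlist, contPair]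
    rw [value_target rfl, value_target rfl]
    simp
  | cons κ b ih =>
    have hpos := (contPair_bounds (two_le_of_mem_dlist hb)).1
    obtain ⟨h1, h2⟩ := ih hb.2
    have b1 := (contPair_bounds (two_le_of_mem_dlist hb.2)).1
    rw [List.reverse_cons]
    have e1 := value_path_eq (p := p) (ω := ω) (α := 1) (β := 0) hb.1 b.reverse le_rfl zero_le_one
    have e2 := value_path_eq (p := p) (ω := ω) (α := 0) (β := 1) hb.1 b.reverse zero_le_one le_rfl
    rw [h1, h2] at e1 e2
    simp only [dlist, contPair] at hpos ⊢
    set x := (contPair (dlist (tp p ω [κ]) (shift [κ] ω) b)).1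
    set y := (contPair (dlist (tp p ω [κ]) (shift [κ] ω) b)).2
    set d := dval p ω κ
    have hx : x ≠ 0 := by linarith
    have hd : d * x - y ≠ 0 := by linarith
    have e : d - y / x = (d * x - y) / x := by field_simp
    rw [e] at e1 e2
    simp only [ENNReal.toReal_one, ENNReal.toReal_zero] at e1 e2
    constructor
    · rw [eq_div_iff hd]
      have : hitV p ω (b.reverse ++ [κ]) = value p ω (some (b.reverse ++ [κ])) 1 0 (some []) := rfl
      rw [this]
      field_simp at e1
      linarith
    · rw [eq_div_iff hd]
      have : missV p ω (b.reverse ++ [κ]) = value p ω (some (b.reverse ++ [κ])) 0 1 (some []) := rfl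
      rw [this]
      field_simp at e2
      linarith

theorem hitV_eq_zero {b : List ℕ} (hb : ¬ InTree p ω b) : hitV p ω b.reverse = 0 := by
  induction b generalizing p ω with
  | nil => exact absurd trivial hb
  | cons κ b ih =>
    rw [List.reverse_cons]
    by_cases hκ : κ < (kids p ω []).length
    · have hb' : ¬ InTree (tp p ω [κ]) (shift [κ] ω) b := fun h => hb ⟨hκ, h⟩
      have e := value_path_eq (p := p) (ω := ω) (α := 1) (β := 0) hκ b.reverse le_rfl zero_le_one
      rw [ih hb'] at e
      simp only [ENNReal.toReal_zero, mul_zero, add_zero] at e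
      have hd := two_le_dval hκ
      have hm : (missV (tp p ω [κ]) (shift [κ] ω) b.reverse).toReal ≤ 1 := by
        rw [← ENNReal.toReal_one]
        exact ENNReal.toReal_mono ENNReal.one_ne_top missV_le_one
      rcases mul_eq_zero.1 e with h | h
      · rcases (ENNReal.toReal_eq_zero_iff _).1 h with h | h
        · exact h
        · have := hitV_le_one (p := p) (ω := ω) (w := b.reverse ++ [κ])
          rw [hitV, h] at this
          exact absurd this (by simp)
      · linarith
    · exact hitV_eq_zero_of_le (not_lt.1 hκ) _

theorem val_eq_hitBy (hp : p.1 ≠ none) (w : Node) (n : ℕ) (o : Option Node) :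
    val p ω (some w) 1 0 n o = hitBy p ω {some w} n o := by
  induction n generalizing o with
  | zero =>
    cases o with
    | none => rw [val_none, hitBy_none (by simp)]
    | some u =>
      by_cases h : w = u
      · rw [val_target (by rw [h]), hitBy_of_mem (by simp [h])]
      · rw [val_zero (by simpa using h), hitBy_zero (by simpa using fun h' => h h'.symm)]
  | succ n ih =>
    cases o with
    | none => rw [val_none, hitBy_none (by simp)]
    | some u =>
      by_cases h : w = u
      · rw [val_target (by rw [h]), hitBy_of_mem (by simp [h])]
      · rw [val_succ (by simpa using h), hitBy_succ hp (by simpa using fun h' => h h'.symm)]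
        congr 1
        funext o
        exact ih o

/-- The sum over the time of the probabilities of the first visit to `w`. -/
theorem tsum_seedLaw_firstHit (hp : p.1 ≠ none) (w : Node) :
    ∑' t, seedLaw {ξ | FirstHit p ω ξ w t} = hitV p ω w := by
  have hm : ∀ t, MeasurableSet {ξ : WalkSeed | FirstHit p ω ξ w t} := fun t =>
    measurableSet_setOfPred.2
      ((measurable_firstHit p w t).comp (measurable_const.prodMk measurable_id))
  rw [← measure_iUnion _ hm]
  · have h1 : hitV p ω w = ⨆ n, seedLaw {ξ | ∃ s ≤ n, pos p ω ξ (some []) s ∈ ({some w} : Set _)} := by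
      simp only [hitV, value, val_eq_hitBy hp]
      rfl
    rw [h1, ← Monotone.measure_iUnion]
    · congr 1
      ext ξ
      simp only [Set.mem_iUnion, Set.mem_ofPred_eq, Set.mem_singleton_iff]
      constructor
      · rintro ⟨t, ht⟩
        exact ⟨t, t, le_rfl, ht.1⟩
      · rintro ⟨n, s, hs, h⟩
        classical
        have hex : ∃ s, pos p ω ξ (some []) s = some w := ⟨s, h⟩
        exact ⟨Nat.find hex, Nat.find_spec hex, fun r hr => Nat.find_min hex hr⟩
    · intro a b hab ξ
      rintro ⟨s, hs, h⟩
      exact ⟨s, hs.trans hab, h⟩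
  · intro a b hab
    exact Set.disjoint_left.2 fun ξ h h' => hab (FirstHit.unique h h')

end Value

section PathSum

/-! ### Lists of reals as a measurable space -/

/-- The σ-algebra generated by the length and the entries. -/
instance : MeasurableSpace (List ℝ) :=
  MeasurableSpace.comap (fun l => ((l.length, fun n => l.getD n 0) : ℕ × (ℕ → ℝ))) inferInstance

theorem measurable_list_length : Measurable (List.length : List ℝ → ℕ) :=
  measurable_fst.comp (comap_measurable
    (fun l : List ℝ => ((l.length, fun n => l.getD n 0) : ℕ × (ℕ → ℝ))))

theorem measurable_list_getD (n : ℕ) : Measurable fun l : List ℝ => l.getD n 0 :=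
  (measurable_pi_apply n).comp (measurable_snd.comp (comap_measurable
    (fun l : List ℝ => ((l.length, fun n => l.getD n 0) : ℕ × (ℕ → ℝ)))))

theorem measurable_to_list {β : Type*} [MeasurableSpace β] {f : β → List ℝ}
    (h1 : Measurable fun y => (f y).length) (h2 : ∀ n, Measurable fun y => (f y).getD n 0) :
    Measurable f :=
  measurable_comap_iff.2 (h1.prodMk (measurable_pi_lambda _ h2))

theorem measurable_list_cons : Measurable fun z : ℝ × List ℝ => z.1 :: z.2 := by
  refine measurable_to_list ?_ fun n => ?_
  · simp only [List.length_cons]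
    exact (measurable_list_length.comp measurable_snd).add_const 1
  · cases n with
    | zero => simpa using measurable_fst
    | succ n =>
      simp only [List.getD_cons_succ]
      exact (measurable_list_getD n).comp measurable_snd

theorem measurable_list_concat : Measurable fun z : ℝ × List ℝ => z.2 ++ [z.1] := by
  refine measurable_to_list ?_ fun n => ?_
  · simp only [List.length_append, List.length_singleton]
    exact (measurable_list_length.comp measurable_snd).add_const 1
  · have hl : Measurable fun z : ℝ × List ℝ => z.2.length :=
      measurable_list_length.comp measurable_snd
    have : (fun z : ℝ × List ℝ => (z.2 ++ [z.1]).getD n 0) = fun z =>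
        if n < z.2.length then z.2.getD n 0 else if z.2.length = n then z.1 else 0 := by
      funext z
      split_ifs with h1 h2
      · exact List.getD_append _ _ _ _ h1
      · rw [List.getD_append_right _ _ _ _ (by omega), h2]
        simp
      · rw [List.getD_append_right _ _ _ _ (by omega), List.getD_eq_default _ _ (by simp; omega)]
    rw [this]
    refine Measurable.ite ?_ ((measurable_list_getD n).comp measurable_snd)
      (Measurable.ite ?_ measurable_fst measurable_const)
    · exact hl (measurableSet_Ioi (a := n))
    · exact hl (measurableSet_singleton n)

theorem measurable_contPair : Measurable contPair := by
  let cp : ℕ → (ℕ → ℝ) → ℝ × ℝ := fun n => Nat.rec (fun _ => (1, 0))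
    (fun _ f s => (s 0 * (f fun k => s (k + 1)).1 - (f fun k => s (k + 1)).2,
      (f fun k => s (k + 1)).1)) n
  have hcp : ∀ n, Measurable (cp n) := by
    intro n
    induction n with
    | zero => exact measurable_const
    | succ n ih =>
      have hs : Measurable fun s : ℕ → ℝ => cp n fun k => s (k + 1) :=
        ih.comp (measurable_pi_lambda _ fun k => measurable_pi_apply _)
      exact (((measurable_pi_apply 0).mul (measurable_fst.comp hs)).sub
        (measurable_snd.comp hs)).prodMk (measurable_fst.comp hs)
  have heq : ∀ l : List ℝ, contPair l = cp l.length fun n => l.getD n 0 := by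
    intro l
    induction l with
    | nil => rfl
    | cons d l ih =>
      rw [contPair, ih]
      rfl
  have : contPair = fun l : List ℝ => (fun n (l : List ℝ) => cp n fun k => l.getD k 0) l.length l :=
    funext heq
  rw [this]
  exact measurable_apply_countable (fun n => (hcp n).comp (measurable_pi_lambda _
    measurable_list_getD)) measurable_list_length

/-! ### Sums over paths of types -/

variable {α : Type*} [Fintype α] [DecidableEq α] (N : α → α → α → Measure ℝ)

/-- The iterated integral of a function of the weights along a path of types, summed over the paths
that start with the pair `(a, b)`, have `k` further types and end with the pair `q`. -/
def pathSum (q : α × α) : ℕ → α → α → (List ℝ → ℝ≥0∞) → ℝ≥0∞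
  | 0, a, b, Ψ => if (a, b) = q then Ψ [] else 0
  | k + 1, a, b, Ψ => ∑ c, ∫⁻ x, pathSum q k b c (fun l => Ψ (x :: l)) ∂N a b c

variable [∀ a b c, SFinite (N a b c)]

theorem measurable_pathSum (q : α × α) (k : ℕ) (a b : α) {β : Type*} [MeasurableSpace β]
    {Φ : β → List ℝ → ℝ≥0∞} (hΦ : Measurable (Function.uncurry Φ)) :
    Measurable fun y => pathSum N q k a b (Φ y) := by
  induction k generalizing a b β with
  | zero =>
    simp only [pathSum]
    split_ifs
    · exact hΦ.comp (measurable_id.prodMk measurable_const)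
    · exact measurable_const
  | succ k ih =>
    simp only [pathSum]
    refine Finset.measurable_sum _ fun c _ => ?_
    refine Measurable.lintegral_prod_right' (f := fun z : β × ℝ =>
      pathSum N q k b c fun l => Φ z.1 (z.2 :: l)) ?_
    refine ih b c (Φ := fun (z : β × ℝ) l => Φ z.1 (z.2 :: l)) ?_
    exact hΦ.comp ((measurable_fst.comp measurable_fst).prodMk (measurable_list_cons.comp
      ((measurable_snd.comp measurable_fst).prodMk measurable_snd)))

/-- Peels off the last weight instead of the first; the exchange of the integrals needs joint
measurability in the list, hence the σ-algebra on lists. -/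
theorem pathSum_succ_right (c d : α) (k : ℕ) (a b : α) {Ψ : List ℝ → ℝ≥0∞} (hΨ : Measurable Ψ) :
    pathSum N (c, d) (k + 1) a b Ψ =
      ∑ e, ∫⁻ x, pathSum N (e, c) k a b (fun l => Ψ (l ++ [x])) ∂N e c d := by
  induction k generalizing a b Ψ with
  | zero =>
    simp only [pathSum, Prod.mk.injEq]
    rw [Finset.sum_eq_single d, Finset.sum_eq_single a]
    · by_cases h : b = c
      · simp [h]
      · simp [h]
    · intro e _ he
      simp [he.symm]
    · simp
    · intro e _ he
      simp [he]
    · simp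
  | succ k ih =>
    have hm : ∀ e c', Measurable fun z : ℝ × ℝ =>
        pathSum N (e, c) k b c' fun l => Ψ (z.1 :: (l ++ [z.2])) := by
      intro e c'
      refine measurable_pathSum N _ k b c' (Φ := fun (z : ℝ × ℝ) l => Ψ (z.1 :: (l ++ [z.2]))) ?_
      refine hΨ.comp (measurable_list_cons.comp ((measurable_fst.comp measurable_fst).prodMk
        (measurable_list_concat.comp ((measurable_snd.comp measurable_fst).prodMk
          measurable_snd))))
    rw [pathSum]
    have h1 : ∀ c' x, pathSum N (c, d) (k + 1) b c' (fun l => Ψ (x :: l)) =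
        ∑ e, ∫⁻ y, pathSum N (e, c) k b c' (fun l => Ψ (x :: (l ++ [y]))) ∂N e c d := fun c' x =>
      ih b c' (hΨ.comp (measurable_list_cons.comp (measurable_const.prodMk measurable_id)))
    simp only [h1]
    have h2 : ∀ c', ∫⁻ x, ∑ e, ∫⁻ y, pathSum N (e, c) k b c' (fun l => Ψ (x :: (l ++ [y])))
          ∂N e c d ∂N a b c' =
        ∑ e, ∫⁻ y, ∫⁻ x, pathSum N (e, c) k b c' (fun l => Ψ (x :: (l ++ [y])))
          ∂N a b c' ∂N e c d := by
      intro c'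
      rw [lintegral_finsetSum]
      · refine Finset.sum_congr rfl fun e _ => ?_
        exact lintegral_lintegral_swap (hm e c').aemeasurable
      · intro e _
        exact (hm e c').lintegral_prod_right'
    simp only [h2]
    rw [Finset.sum_comm]
    refine Finset.sum_congr rfl fun e _ => ?_
    rw [← lintegral_finsetSum]
    · rfl
    · intro c' _
      exact (hm e c').lintegral_prod_left'

/-- Reversal of the paths for weights that are reversible with respect to `w`. -/
theorem pathSum_reverse {w : α → α → ℝ≥0∞} (hw : ∀ a b, w a b = w b a)
    (hN : ∀ a b c, w a b • N a b c = w c b • N c b a) (c d : α) (k : ℕ) (a b : α)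
    {Ψ : List ℝ → ℝ≥0∞} (hΨ : Measurable Ψ) (hΨr : Measurable fun l : List ℝ => Ψ l.reverse) :
    w a b * pathSum N (c, d) k a b Ψ = w c d * pathSum N (b, a) k d c fun l => Ψ l.reverse := by
  induction k generalizing a b Ψ with
  | zero =>
    simp only [pathSum, Prod.mk.injEq, List.reverse_nil]
    by_cases h : a = c ∧ b = d
    · obtain ⟨rfl, rfl⟩ := h
      simp
    · have h' : ¬ (d = b ∧ c = a) := fun h' => h ⟨h'.2.symm, h'.1.symm⟩
      simp [h, h']
  | succ k ih =>
    have hm : ∀ e, Measurable fun x : ℝ => pathSum N (c, d) k b e fun l => Ψ (x :: l) := fun e =>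
      measurable_pathSum N _ k b e (Φ := fun x l => Ψ (x :: l)) (hΨ.comp measurable_list_cons)
    have hm' : Measurable (Function.uncurry fun (x : ℝ) (l : List ℝ) => Ψ (x :: l.reverse)) := by
      have : (Function.uncurry fun (x : ℝ) (l : List ℝ) => Ψ (x :: l.reverse)) =
          (fun l : List ℝ => Ψ l.reverse) ∘ fun z : ℝ × List ℝ => z.2 ++ [z.1] := by
        funext z; simp [Function.uncurry]
      rw [this]
      exact hΨr.comp measurable_list_concat
    rw [pathSum_succ_right N b a k d c hΨr, pathSum, Finset.mul_sum, Finset.mul_sum]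
    refine Finset.sum_congr rfl fun e _ => ?_
    simp only [List.reverse_append, List.reverse_singleton, List.singleton_append]
    -- Reversibility moves the factor `w` one pair along the path: the first weight on the left is
    -- the last one on the right.
    rw [← smul_eq_mul, ← lintegral_smul_measure, hN, lintegral_smul_measure, smul_eq_mul, hw e b,
      ← lintegral_const_mul _ (hm e), ← lintegral_const_mul]
    · refine lintegral_congr fun x => ?_
      exact ih b e (hΨ.comp (measurable_list_cons.comp (measurable_const.prodMk measurable_id)))
        (hm'.comp (measurable_const.prodMk measurable_id))
    · exact measurable_pathSum N _ k d c hm'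

end PathSum

section LevelSum

variable {m : ℕ}

/-! ### Measurability of the quenched quantities -/

theorem measurable_val (p : Pair m) (w : Option Node) (α β : ℝ≥0∞) (n : ℕ) (o : Option Node) :
    Measurable fun ω : Reservoir m => val p ω w α β n o := by
  induction n generalizing o with
  | zero => cases o <;> simp [val]
  | succ n ih =>
    cases o with
    | none => simp [val]
    | some u =>
      by_cases h : w = some u
      · simp [val, h]
      · simp only [val_succ h, stepMean]
        exact measurable_apply_countable (f := fun (l : List (Fin m)) (ω : Reservoir m) =>
          2⁻¹ * val p ω w α β n (some u) + 2⁻¹ *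
            (((∑ k ∈ Finset.range l.length, val p ω w α β n (some (k :: u))) +
              val p ω w α β n (up u)) / (l.length + 1 : ℕ)))
          (fun l => ((ih _).const_mul _).add ((((Finset.measurable_sum _ fun k _ => ih _).add
            (ih _)).div_const _).const_mul _)) (measurable_kids p u)

theorem measurable_exitP (p : Pair m) : Measurable fun ω : Reservoir m => exitP p ω :=
  Measurable.iSup fun n => measurable_val p _ _ _ n _

theorem tp_singleton (p : Pair m) (ω : Reservoir m) (k : ℕ) :
    tp p ω [k] = (some p.2, (kids p ω []).getD k p.2) := rfl

theorem measurable_dval (p : Pair m) (κ : ℕ) : Measurable fun ω : Reservoir m => dval p ω κ := by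
  simp only [dval, tp_singleton]
  exact measurable_apply_countable (f := fun (l : List (Fin m)) (ω : Reservoir m) =>
    (l.length : ℝ) + 1 - ∑ k ∈ (Finset.range l.length).erase κ,
      (exitP (some p.2, l.getD k p.2) (shift [k] ω)).toReal)
    (fun l => measurable_const.sub (Finset.measurable_sum _ fun k _ =>
      ((measurable_exitP _).comp (measurable_shift [k])).ennreal_toReal)) (measurable_kids p [])

theorem kids_graft (p : Pair m) (κ : ℕ) (ω ω' : Reservoir m) :
    kids p (graft [κ] ω ω') [] = kids p ω [] := by
  simp [kids, graft, tp]

theorem shift_graft_of_ne {k κ : ℕ} (h : k ≠ κ) (ω ω' : Reservoir m) :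
    shift [k] (graft [κ] ω ω') = shift [k] ω := by
  funext x
  have : ¬ [κ] <:+ x.1 ++ [k] := by
    rintro ⟨l, hl⟩
    have := congrArg List.getLast? hl
    simp at this
    exact h this.symm
  simp [shift, graft, this]

/-- The weight at a node leaves out the branch that continues the path and is therefore independent
of it, given the types. -/
theorem dval_graft (p : Pair m) (κ : ℕ) (ω ω' : Reservoir m) :
    dval p (graft [κ] ω ω') κ = dval p ω κ := by
  simp only [dval, tp_singleton, kids_graft]
  congr 1
  refine Finset.sum_congr rfl fun k hk => ?_
  rw [shift_graft_of_ne (Finset.ne_of_mem_erase hk)]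

/-! ### Sums over the nodes of a level -/

/-- The sum of `Ψ (dlist p ω b)` over the paths of length `k` from the root to a node with the
pair of types `q`. -/
def levelSum (q : Pair m) : ℕ → Pair m → Reservoir m → (List ℝ → ℝ≥0∞) → ℝ≥0∞
  | 0, p, _, Ψ => if p = q then Ψ [] else 0
  | k + 1, p, ω, Ψ => ∑ κ ∈ Finset.range (kids p ω []).length,
      levelSum q k (tp p ω [κ]) (shift [κ] ω) fun l => Ψ (dval p ω κ :: l)

theorem measurable_levelSum (q : Pair m) (k : ℕ) (p : Pair m) {β : Type*} [MeasurableSpace β]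
    {Φ : β → List ℝ → ℝ≥0∞} (hΦ : Measurable (Function.uncurry Φ)) :
    Measurable fun z : β × Reservoir m => levelSum q k p z.2 (Φ z.1) := by
  induction k generalizing p β with
  | zero =>
    simp only [levelSum]
    split_ifs
    · exact hΦ.comp (measurable_fst.prodMk measurable_const)
    · exact measurable_const
  | succ k ih =>
    simp only [levelSum, tp_singleton]
    refine measurable_apply_countable (f := fun (l : List (Fin m)) (z : β × Reservoir m) =>
      ∑ κ ∈ Finset.range l.length, levelSum q k (some p.2, l.getD κ p.2) (shift [κ] z.2)
        fun l => Φ z.1 (dval p z.2 κ :: l)) (fun l => Finset.measurable_sum _ fun κ _ => ?_)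
      ((measurable_kids p []).comp measurable_snd)
    have h := ih (some p.2, l.getD κ p.2) (Φ := fun (y : β × ℝ) l => Φ y.1 (y.2 :: l))
      (hΦ.comp ((measurable_fst.comp measurable_fst).prodMk (measurable_list_cons.comp
        ((measurable_snd.comp measurable_fst).prodMk measurable_snd))))
    exact h.comp ((measurable_fst.prodMk ((measurable_dval p κ).comp measurable_snd)).prodMk
      ((measurable_shift [κ]).comp measurable_snd))

theorem tsum_list_succ (k : ℕ) (F : List ℕ → ℝ≥0∞) :
    ∑' a : List ℕ, (if a.length = k + 1 then F a else 0) =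
      ∑' κ, ∑' a : List ℕ, if a.length = k then F (a ++ [κ]) else 0 := by
  rw [← ENNReal.tsum_prod (f := fun κ (a : List ℕ) => if a.length = k then F (a ++ [κ]) else 0)]
  have hinj : Function.Injective fun z : ℕ × List ℕ => z.2 ++ [z.1] := by
    intro z z' h
    have := List.append_inj' h rfl
    exact Prod.ext (by simpa using this.2) this.1
  rw [← hinj.tsum_eq]
  · refine tsum_congr fun z => ?_
    simp
  · intro a ha
    rw [Function.mem_support] at ha
    have hl : a.length = k + 1 := by
      by_contra h
      simp [h] at ha
    have hne : a ≠ [] := by rintro rfl; simp at hl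
    exact ⟨(a.getLast hne, a.dropLast), List.dropLast_append_getLast hne⟩

open Classical in
theorem levelSum_eq_tsum (q : Pair m) (k : ℕ) (p : Pair m) (ω : Reservoir m)
    (Ψ : List ℝ → ℝ≥0∞) :
    ∑' a : Node, (if a.length = k then
      (if InTree p ω a.reverse ∧ tp p ω a = q then Ψ (dlist p ω a.reverse) else 0) else 0) =
      levelSum q k p ω Ψ := by
  induction k generalizing p ω Ψ with
  | zero =>
    rw [tsum_eq_single []]
    · simp [levelSum, InTree, tp, dlist]
    · intro a ha
      simp [ha]
  | succ k ih =>
    rw [tsum_list_succ, levelSum, tsum_eq_sum (s := Finset.range (kids p ω []).length)]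
    · refine Finset.sum_congr rfl fun κ hκ => ?_
      rw [← ih]
      refine tsum_congr fun a => ?_
      rw [List.reverse_append, List.reverse_singleton, List.singleton_append, tp_append]
      simp only [InTree, dlist, Finset.mem_range.1 hκ, true_and]
    · intro κ hκ
      rw [Finset.mem_range] at hκ
      simp [InTree, hκ]

open Classical in
theorem tsum_hitV_eq_levelSum (q : Pair m) (k : ℕ) (p : Pair m) (ω : Reservoir m) :
    ∑' a : Node, (if a.length = k then (if tp p ω a = q then hitV p ω a else 0) else 0) =
      levelSum q k p ω fun l => ENNReal.ofReal (1 / (contPair l).1) := by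
  rw [← levelSum_eq_tsum]
  refine tsum_congr fun a => ?_
  by_cases h : InTree p ω a.reverse
  · have h1 := (hitV_missV_eq h).1
    rw [List.reverse_reverse] at h1
    rw [← h1, ENNReal.ofReal_toReal (ne_top_of_le_ne_top ENNReal.one_ne_top hitV_le_one)]
    simp [h]
  · have h1 := hitV_eq_zero h
    rw [List.reverse_reverse] at h1
    simp [h, h1]

/-! ### The annealed level sums -/

/-- The joint law, as a sum over the children of type `c`, of the weight `dval` of a node of type
`b` whose parent has type `a`. -/
def weightLaw (M : Model m) (a b c : Fin m) : Measure ℝ :=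
  Measure.sum fun κ => ((resLaw M).restrict {ω | κ < (kids (some a, b) ω []).length ∧
    tp (some a, b) ω [κ] = (some b, c)}).map fun ω => dval (some a, b) ω κ

instance (M : Model m) (a b c : Fin m) : SFinite (weightLaw M a b c) := by
  unfold weightLaw
  infer_instance

theorem measurableSet_child (p : Pair m) (κ : ℕ) (q : Pair m) :
    MeasurableSet {ω : Reservoir m | κ < (kids p ω []).length ∧ tp p ω [κ] = q} :=
  measurableSet_setOfPred.2 (((measurable_of_countable fun l : List (Fin m) => κ < l.length).comp
    (measurable_kids p [])).and ((measurable_of_countable (· = q)).comp (measurable_tp p [κ])))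

theorem lintegral_weightLaw (M : Model m) (a b c : Fin m) {g : ℝ → ℝ≥0∞} (hg : Measurable g) :
    ∫⁻ x, g x ∂weightLaw M a b c = ∑' κ, ∫⁻ ω,
      {ω | κ < (kids (some a, b) ω []).length ∧ tp (some a, b) ω [κ] = (some b, c)}.indicator
        (fun ω => g (dval (some a, b) ω κ)) ω ∂resLaw M := by
  rw [weightLaw, lintegral_sum_measure]
  refine tsum_congr fun κ => ?_
  rw [lintegral_map hg (measurable_dval _ κ), lintegral_indicator (measurableSet_child _ _ _)]

/-- At each child `κ` a fresh subtree is grafted: the root weight reads the first sample and the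
rest of the path the second. Hence the annealed sum is an iterated integral driven by the types. -/
theorem lintegral_levelSum (M : Model m) (c d : Fin m) (k : ℕ) (a b : Fin m)
    {Ψ : List ℝ → ℝ≥0∞} (hΨ : Measurable Ψ) :
    ∫⁻ ω, levelSum (some c, d) k (some a, b) ω Ψ ∂resLaw M =
      pathSum (weightLaw M) (c, d) k a b Ψ := by
  induction k generalizing a b Ψ with
  | zero => simp [levelSum, pathSum]
  | succ k ih =>
    have hm : ∀ κ e, Measurable fun z : Reservoir m × Reservoir m =>
        levelSum (some c, d) k (some b, e) z.2 fun l => Ψ (dval (some a, b) z.1 κ :: l) := by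
      intro κ e
      exact measurable_levelSum _ k _ (Φ := fun (y : Reservoir m) l =>
        Ψ (dval (some a, b) y κ :: l)) (hΨ.comp (measurable_list_cons.comp
          (((measurable_dval _ κ).comp measurable_fst).prodMk measurable_snd)))
    set A : ℕ → Fin m → Set (Reservoir m) := fun κ e =>
      {ω | κ < (kids (some a, b) ω []).length ∧ tp (some a, b) ω [κ] = (some b, e)} with hA
    set F : ℕ → Fin m → Reservoir m → ℝ≥0∞ := fun κ e => (A κ e).indicator fun ω =>
      levelSum (some c, d) k (some b, e) (shift [κ] ω) fun l => Ψ (dval (some a, b) ω κ :: l)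
      with hF
    have hFm : ∀ κ e, Measurable (F κ e) := fun κ e =>
      ((hm κ e).comp (measurable_id.prodMk (measurable_shift [κ]))).indicator
        (measurableSet_child _ _ _)
    have h1 : ∀ ω, levelSum (some c, d) (k + 1) (some a, b) ω Ψ = ∑' κ, ∑ e, F κ e ω := by
      intro ω
      rw [levelSum, tsum_eq_sum (s := Finset.range (kids (some a, b) ω []).length)]
      · refine Finset.sum_congr rfl fun κ hκ => ?_
        rw [Finset.mem_range] at hκ
        rw [Finset.sum_eq_single ((kids (some a, b) ω []).getD κ b)]
        · rw [hF]
          simp only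
          rw [Set.indicator_of_mem]
          · rfl
          · exact ⟨hκ, rfl⟩
        · intro e _ he
          rw [hF]
          refine Set.indicator_of_notMem (fun h => he ?_) _
          exact (congrArg Prod.snd h.2).symm
        · simp
      · intro κ hκ
        rw [Finset.mem_range] at hκ
        exact Finset.sum_eq_zero fun e _ => Set.indicator_of_notMem (fun h => hκ h.1) _
    have h2 : ∀ κ e, ∫⁻ ω, F κ e ω ∂resLaw M = ∫⁻ ω, (A κ e).indicator (fun ω =>
        pathSum (weightLaw M) (c, d) k b e fun l => Ψ (dval (some a, b) ω κ :: l)) ω ∂resLaw M := by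
      intro κ e
      rw [← (measurePreserving_graft M [κ]).lintegral_comp (hFm κ e), lintegral_prod
        (fun z : Reservoir m × Reservoir m => F κ e (graft [κ] z.1 z.2)) ((hFm κ e).comp (measurePreserving_graft M [κ]).measurable).aemeasurable]
      refine lintegral_congr fun ω => ?_
      have hmem : ∀ ω', graft [κ] ω ω' ∈ A κ e ↔ ω ∈ A κ e := by
        intro ω'
        simp only [hA, Set.mem_ofPred_eq, tp_singleton, kids_graft]
      by_cases hω : ω ∈ A κ e
      · rw [Set.indicator_of_mem hω, ← ih b e (Ψ := fun l => Ψ (dval (some a, b) ω κ :: l))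
          (hΨ.comp (measurable_list_cons.comp (measurable_const.prodMk measurable_id)))]
        refine lintegral_congr fun ω' => ?_
        rw [hF]
        simp only
        rw [Set.indicator_of_mem ((hmem ω').2 hω), shift_graft, dval_graft]
      · rw [Set.indicator_of_notMem hω]
        refine (lintegral_congr fun ω' => ?_).trans lintegral_zero
        exact Set.indicator_of_notMem (fun h => hω ((hmem ω').1 h)) _
    simp only [h1]
    rw [lintegral_tsum fun κ => (Finset.measurable_sum _ fun e _ => hFm κ e).aemeasurable]
    simp only [lintegral_finsetSum _ fun e _ => hFm _ e, h2, pathSum]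
    rw [Summable.tsum_finsetSum fun i _ => ENNReal.summable]
    refine Finset.sum_congr rfl fun e _ => ?_
    rw [lintegral_weightLaw]
    exact measurable_pathSum _ _ k b e (Φ := fun x l => Ψ (x :: l)) (hΨ.comp measurable_list_cons)

end LevelSum

/-! ### The law of a path weight in terms of offspring lists. -/

section WeightLaw

variable {m : ℕ}

/-- The offspring of the root is independent of the subtrees of its children. -/
theorem measurePreserving_root (M : Model m) :
    MeasurePreserving (fun (z : Reservoir m × Reservoir m) (x : Node × Pair m) =>
      if x.1 = [] then z.2 x else z.1 x) ((resLaw M).prod (resLaw M)) (resLaw M) := by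
  classical
  exact measurePreserving_replace
    (fun x : Node × (Option (Fin m) × Fin m) => (M.offspringLaw x.2).toMeasure)
    {x | x.1 = []} id (Set.injOn_id _) (fun _ x => x) fun _ => MeasurePreserving.id _

/-- The subtrees of the children may be relabelled. -/
theorem measurePreserving_relabel (M : Model m) {e : ℕ → ℕ} (he : Function.Injective e) :
    ∃ f : Reservoir m → Reservoir m, MeasurePreserving f (resLaw M) (resLaw M) ∧
      ∀ k ω, shift [k] (f ω) = shift [e k] ω := by
  classical
  -- The last entry of a node selects its ancestor at depth one, so only this entry is relabelled.
  set r : Node → Node := fun u => if h : u = [] then [] else u.dropLast ++ [e (u.getLast h)] with hr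
  have hr1 : ∀ (u : Node) k, r (u ++ [k]) = u ++ [e k] := by
    intro u k
    simp [hr]
  have hinj : Function.Injective r := by
    intro u v h
    rcases List.eq_nil_or_concat u with rfl | ⟨u, k, rfl⟩ <;>
      rcases List.eq_nil_or_concat v with rfl | ⟨v, k', rfl⟩
    · rfl
    · simp [hr] at h
    · simp [hr] at h
    · rw [List.concat_eq_append, List.concat_eq_append] at h ⊢
      rw [hr1, hr1] at h
      have := List.append_inj' h rfl
      have hk : k = k' := he (by simpa using this.2)
      rw [this.1, hk]
  have h := measurePreserving_replace
    (fun x : Node × (Option (Fin m) × Fin m) => (M.offspringLaw x.2).toMeasure)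
    Set.univ (fun x => (r x.1, x.2)) (fun x _ y _ hxy => Prod.ext
      (hinj (congrArg Prod.fst hxy)) (by simpa using congrArg Prod.snd hxy)) (fun _ x => x)
    fun _ => MeasurePreserving.id _
  simp only [Set.mem_univ, if_true] at h
  refine ⟨fun ω x => ω (r x.1, x.2), ?_, ?_⟩
  · refine ⟨?_, ?_⟩
    · exact measurable_pi_lambda _ fun x => measurable_pi_apply _
    · have h2 := h.map_eq
      have h3 : (fun (z : Reservoir m × Reservoir m) (i : Node × Pair m) => z.2 (r i.1, i.2)) =
          (fun (ω : Reservoir m) (x : Node × Pair m) => ω (r x.1, x.2)) ∘ Prod.snd := rfl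
      rw [h3, ← Measure.map_map (measurable_pi_lambda _ fun x => measurable_pi_apply _)
        measurable_snd] at h2
      change Measure.map _ (Measure.map Prod.snd ((resLaw M).prod (resLaw M))) = resLaw M at h2
      rwa [Measure.map_snd_prod, measure_univ, one_smul] at h2
  · intro k ω
    funext x
    simp [shift, hr1]

theorem lintegral_root (M : Model m) (p : Pair m) (f : List (Fin m) → ℝ≥0∞) :
    ∫⁻ ω, f (kids p ω []) ∂resLaw M = ∑' l, M.offspringLaw p l * f l := by
  have h := measurePreserving_eval_infinitePi
    (fun x : Node × (Option (Fin m) × Fin m) => (M.offspringLaw x.2).toMeasure) ([], p)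
  have h2 := h.lintegral_comp (measurable_of_countable f)
  change ∫⁻ ω, f (ω ([], p)) ∂resLaw M = _
  refine Eq.trans h2 ?_
  rw [lintegral_countable']
  refine tsum_congr fun l => ?_
  rw [PMF.toMeasure_apply_singleton _ _ (measurableSet_singleton l), mul_comm]

theorem shift_root (k : ℕ) (ω ω' : Reservoir m) :
    shift [k] (fun x : Node × Pair m => if x.1 = [] then ω' x else ω x) = shift [k] ω := by
  funext x
  simp [shift]

/-- The mean of a function of the weight of a node of type `b`, whose neighbours other than the
parent and a distinguished child have the types `l`. -/
def restMean (M : Model m) (g : ℝ → ℝ≥0∞) (b : Fin m) (l : List (Fin m)) : ℝ≥0∞ :=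
  ∫⁻ ω, g (l.length + 2 - ∑ k ∈ Finset.range l.length,
    (exitP (some b, l.getD k b) (shift [k] ω)).toReal) ∂resLaw M

/-- The sum of `G` over the lists obtained from `l` by removing an entry `c`. -/
def removeSum {α : Type*} [DecidableEq α] (c : α) (l : List α) (G : List α → ℝ≥0∞) : ℝ≥0∞ :=
  ∑ κ ∈ Finset.range l.length, if l[κ]? = some c then G (l.eraseIdx κ) else 0

theorem measurable_exitSum (b : Fin m) (l : List (Fin m)) (s : Finset ℕ) (x : ℝ) :
    Measurable fun ω : Reservoir m => x - ∑ k ∈ s,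
      (exitP (some b, l.getD k b) (shift [k] ω)).toReal :=
  measurable_const.sub (Finset.measurable_sum _ fun k _ =>
    ((measurable_exitP _).comp (measurable_shift [k])).ennreal_toReal)

/-- The subtrees of the children are exchangeable given the types, so the labels may be closed up
over the omitted `κ`. The `2` in `restMean` stands for the parent and the omitted child. -/
theorem restMean_eraseIdx (M : Model m) {g : ℝ → ℝ≥0∞} (hg : Measurable g) (b : Fin m)
    (l : List (Fin m)) {κ : ℕ} (hκ : κ < l.length) :
    ∫⁻ ω, g (l.length + 1 - ∑ k ∈ (Finset.range l.length).erase κ,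
      (exitP (some b, l.getD k b) (shift [k] ω)).toReal) ∂resLaw M =
      restMean M g b (l.eraseIdx κ) := by
  set e : ℕ → ℕ := fun k => if k < κ then k else k + 1 with he
  have hinj : Function.Injective e := by
    intro a b h
    simp only [he] at h
    split_ifs at h <;> omega
  obtain ⟨f, hf, hfs⟩ := measurePreserving_relabel M hinj
  rw [restMean, ← hf.lintegral_comp (f := fun ω => g ((l.eraseIdx κ).length + 2 -
    ∑ k ∈ Finset.range (l.eraseIdx κ).length,
      (exitP (some b, (l.eraseIdx κ).getD k b) (shift [k] ω)).toReal))
    (hg.comp (measurable_exitSum _ _ _ _))]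
  refine lintegral_congr fun ω => ?_
  have hlen : (l.eraseIdx κ).length = l.length - 1 := by rw [List.length_eraseIdx]; simp [hκ]
  have himg : (Finset.range l.length).erase κ = (Finset.range (l.length - 1)).image e := by
    ext k
    simp only [Finset.mem_erase, Finset.mem_range, Finset.mem_image, he]
    constructor
    · rintro ⟨h1, h2⟩
      by_cases h : k < κ
      · exact ⟨k, by omega, by simp [h]⟩
      · exact ⟨k - 1, by omega, by rw [if_neg (by omega)]; omega⟩
    · rintro ⟨a, h1, h2⟩
      split_ifs at h2 <;> omega
  have hsum : ∑ k ∈ (Finset.range l.length).erase κ,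
      (exitP (some b, l.getD k b) (shift [k] ω)).toReal =
      ∑ k ∈ Finset.range (l.length - 1),
      (exitP (some b, (l.eraseIdx κ).getD k b) (shift [k] (f ω))).toReal := by
    rw [himg, Finset.sum_image fun x _ y _ h => hinj h]
    refine Finset.sum_congr rfl fun k _ => ?_
    rw [hfs]
    simp only [List.getD_eq_getElem?_getD, List.getElem?_eraseIdx, he]
    split_ifs <;> rfl
  rw [hsum, hlen, Nat.cast_sub (by omega)]
  congr 2
  push_cast
  ring

/-- After conditioning on the offspring of the root, the parent and the distinguished child enter
only through the law of the remaining list. This reduces reversibility to a statement about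
offspring laws. -/
theorem lintegral_weightLaw_eq (M : Model m) (a b c : Fin m) {g : ℝ → ℝ≥0∞} (hg : Measurable g) :
    ∫⁻ x, g x ∂weightLaw M a b c =
      ∑' l, M.offspringLaw (some a, b) l * removeSum c l (restMean M g b) := by
  rw [lintegral_weightLaw M a b c hg]
  have h1 : ∀ κ, ∫⁻ ω, {ω | κ < (kids (some a, b) ω []).length ∧
        tp (some a, b) ω [κ] = (some b, c)}.indicator (fun ω => g (dval (some a, b) ω κ)) ω ∂resLaw M =
      ∑' l, M.offspringLaw (some a, b) l *
        (if l[κ]? = some c then restMean M g b (l.eraseIdx κ) else 0) := by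
    intro κ
    have hm : Measurable ({ω : Reservoir m | κ < (kids (some a, b) ω []).length ∧
        tp (some a, b) ω [κ] = (some b, c)}.indicator fun ω => g (dval (some a, b) ω κ)) :=
      (hg.comp (measurable_dval _ _)).indicator (measurableSet_child _ _ _)
    have hmp := measurePreserving_root M
    rw [← lintegral_root, ← hmp.lintegral_comp hm, lintegral_prod_symm
      (fun z : Reservoir m × Reservoir m => {ω | κ < (kids (some a, b) ω []).length ∧
        tp (some a, b) ω [κ] = (some b, c)}.indicator (fun ω => g (dval (some a, b) ω κ))
          fun x => if x.1 = [] then z.2 x else z.1 x) (hm.comp hmp.measurable).aemeasurable]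
    refine lintegral_congr fun ω' => ?_
    have hk : ∀ ω : Reservoir m, kids (some a, b) (fun x : Node × Pair m => if x.1 = [] then ω' x else ω x) [] =
        kids (some a, b) ω' [] := fun ω => by simp [kids, tp]
    set l := kids (some a, b) ω' [] with hl
    by_cases hκ : l[κ]? = some c
    · obtain ⟨hlt, hget⟩ := List.getElem?_eq_some_iff.1 hκ
      rw [if_pos hκ, ← restMean_eraseIdx M hg b l hlt]
      refine lintegral_congr fun ω => ?_
      rw [Set.indicator_of_mem]
      · simp only [dval, tp_singleton, hk, shift_root]
      · refine ⟨by rw [hk]; exact hlt, ?_⟩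
        rw [tp_singleton, hk]
        simp [hκ]
    · rw [if_neg hκ]
      refine (lintegral_congr fun ω => ?_).trans lintegral_zero
      refine Set.indicator_of_notMem (fun h => hκ ?_) _
      have h1 := h.1
      have h2 := congrArg Prod.snd h.2
      rw [tp_singleton, hk] at h2
      rw [hk] at h1
      rw [List.getElem?_eq_getElem h1]
      simpa [h1] using h2
  simp only [h1]
  rw [ENNReal.tsum_comm]
  refine tsum_congr fun l => ?_
  rw [ENNReal.tsum_mul_left, removeSum, tsum_eq_sum]
  intro κ hκ
  rw [Finset.mem_range, not_lt] at hκ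
  simp [List.getElem?_eq_none hκ]

end WeightLaw

section Offspring

/-! ### Means of discrete laws -/

/-- The mean of `f` with respect to `μ`. -/
def pmfMean {α : Type*} (μ : PMF α) (f : α → ℝ≥0∞) : ℝ≥0∞ := ∑' a, μ a * f a

theorem pmfMean_pure {α : Type*} (a : α) (f : α → ℝ≥0∞) : pmfMean (PMF.pure a) f = f a := by
  rw [pmfMean, tsum_eq_single a]
  · simp
  · intro b hb
    simp [hb]

theorem pmfMean_bind {α β : Type*} (μ : PMF α) (k : α → PMF β) (f : β → ℝ≥0∞) :
    pmfMean (μ.bind k) f = pmfMean μ fun a => pmfMean (k a) f := by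
  simp only [pmfMean, PMF.bind_apply, ← ENNReal.tsum_mul_right, ← ENNReal.tsum_mul_left]
  rw [ENNReal.tsum_comm]
  simp only [mul_assoc]

theorem pmfMean_map {α β : Type*} (μ : PMF α) (k : α → β) (f : β → ℝ≥0∞) :
    pmfMean (μ.map k) f = pmfMean μ fun a => f (k a) := by
  rw [← PMF.bind_pure_comp, pmfMean_bind]
  simp only [Function.comp, pmfMean_pure]

theorem pmfMean_add {α : Type*} (μ : PMF α) (f g : α → ℝ≥0∞) :
    pmfMean μ (fun a => f a + g a) = pmfMean μ f + pmfMean μ g := by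
  simp only [pmfMean, mul_add, ENNReal.tsum_add]

theorem pmfMean_const_mul {α : Type*} (μ : PMF α) (r : ℝ≥0∞) (f : α → ℝ≥0∞) :
    pmfMean μ (fun a => r * f a) = r * pmfMean μ f := by
  simp only [pmfMean, ← ENNReal.tsum_mul_left]
  exact tsum_congr fun a => by ring

theorem pmfMean_const {α : Type*} (μ : PMF α) (r : ℝ≥0∞) : pmfMean μ (fun _ => r) = r := by
  rw [pmfMean, ENNReal.tsum_mul_right, PMF.tsum_coe, one_mul]

theorem weighted_apply {α : Type*} [Fintype α] {w : α → ℕ} (h : ∑ a, w a ≠ 0) (a₀ a : α) :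
    weighted w a₀ a = (w a : ℝ≥0∞) / ((∑ b, w b : ℕ) : ℝ≥0∞) := by
  rw [weighted, dif_neg h]
  rfl

theorem pmfMean_weighted {α : Type*} [Fintype α] {w : α → ℕ} (h : ∑ a, w a ≠ 0) (a₀ : α)
    (f : α → ℝ≥0∞) :
    ((∑ b, w b : ℕ) : ℝ≥0∞) * pmfMean (weighted w a₀) f = ∑ a, w a * f a := by
  rw [pmfMean, tsum_fintype, Finset.mul_sum]
  refine Finset.sum_congr rfl fun a _ => ?_
  rw [weighted_apply h, ← mul_assoc, ENNReal.mul_div_cancel (by exact_mod_cast h)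
    (ENNReal.natCast_ne_top _)]

/-! ### Removing a child -/

variable {α : Type*} [DecidableEq α]

theorem removeSum_cons (c x : α) (l : List α) (G : List α → ℝ≥0∞) :
    removeSum c (x :: l) G = (if x = c then G l else 0) + removeSum c l fun l => G (x :: l) := by
  rw [removeSum, List.length_cons, Finset.sum_range_succ', add_comm]
  simp [removeSum]

theorem removeSum_replicate (c b : α) (n : ℕ) (l : List α) (G : List α → ℝ≥0∞) :
    removeSum c (List.replicate n b ++ l) G =
      (if b = c then n * G (List.replicate (n - 1) b ++ l) else 0) +
        removeSum c l fun l => G (List.replicate n b ++ l) := by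
  induction n generalizing G with
  | zero => simp
  | succ n ih =>
    rw [List.replicate_succ, List.cons_append, removeSum_cons, ih, ← add_assoc]
    congr 1
    by_cases h : b = c
    · simp only [h, if_true, Nat.add_sub_cancel]
      cases n with
      | zero => simp
      | succ n =>
        rw [Nat.add_sub_cancel, ← List.cons_append, ← List.replicate_succ]
        push_cast
        ring
    · simp [h]

/-- Each of `n` independent entries equals `c` with probability `μ c`, and deleting it leaves `n -
1` independent entries. -/
theorem pmfMean_iidList_removeSum (μ : PMF α) (c : α) (n : ℕ) (G : List α → ℝ≥0∞) :
    pmfMean (iidList μ n) (fun l => removeSum c l G) =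
      n * μ c * pmfMean (iidList μ (n - 1)) G := by
  induction n generalizing G with
  | zero => simp [iidList, pmfMean_pure, removeSum]
  | succ n ih =>
    have hs : ∀ f : List α → ℝ≥0∞, pmfMean (iidList μ (n + 1)) f =
        pmfMean μ fun x => pmfMean (iidList μ n) fun l => f (x :: l) := fun f => by
      simp only [iidList, pmfMean_bind, pmfMean_map]
    rw [hs]
    simp only [removeSum_cons, pmfMean_add, ih, pmfMean_const_mul, Nat.add_sub_cancel]
    have h1 : (pmfMean μ fun x => pmfMean (iidList μ n) fun l => if x = c then G l else 0) =
        μ c * pmfMean (iidList μ n) G := by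
      rw [pmfMean, tsum_eq_single c]
      · simp
      · intro x hx
        simp [hx, pmfMean]
    rw [h1]
    cases n with
    | zero => simp
    | succ n =>
      rw [Nat.add_sub_cancel]
      have : (pmfMean μ fun x => pmfMean (iidList μ n) fun l => G (x :: l)) =
          pmfMean (iidList μ (n + 1)) G := by
        simp only [iidList, pmfMean_bind, pmfMean_map]
      rw [this]
      push_cast
      ring

variable {m : ℕ} (M : Model m)

theorem pmfMean_childrenLaw_removeSum (b c : Fin m) (x y : ℕ) (G : List (Fin m) → ℝ≥0∞) :
    pmfMean (M.childrenLaw b x y) (fun l => removeSum c l G) =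
      (if b = c then x * pmfMean (M.childrenLaw b (x - 1) y) G else 0) +
        y * M.outType b c * pmfMean (M.childrenLaw b x (y - 1)) G := by
  simp only [Model.childrenLaw, pmfMean_map, removeSum_replicate, pmfMean_add,
    pmfMean_iidList_removeSum]
  congr 1
  split_ifs
  · rw [pmfMean_const_mul]
  · exact pmfMean_const _ _

theorem sum_out (b : Fin m) : ∑ s, (if s = b then 0 else M.E b s) = ∑ v, M.degOut b v := by
  rw [M.sum_degOut, ← Finset.sum_erase_add _ _ (Finset.mem_univ b)]
  simp only [if_true, add_zero]
  exact Finset.sum_congr rfl fun s hs => if_neg (Finset.ne_of_mem_erase hs)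

theorem E_le_out {b c : Fin m} (h : c ≠ b) : M.E b c ≤ ∑ v, M.degOut b v := by
  rw [← sum_out]
  have := Finset.single_le_sum (f := fun s => if s = b then 0 else M.E b s)
    (fun _ _ => Nat.zero_le _) (Finset.mem_univ c)
  simpa [h] using this

theorem out_mul_outType {b c : Fin m} (h : c ≠ b) (h0 : ∑ v, M.degOut b v ≠ 0) :
    ((∑ v, M.degOut b v : ℕ) : ℝ≥0∞) * M.outType b c = M.E b c := by
  rw [Model.outType, weighted_apply (by rwa [sum_out]), sum_out, if_neg h,
    ENNReal.mul_div_cancel (by exact_mod_cast h0) (ENNReal.natCast_ne_top _)]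

theorem outType_self {b : Fin m} (h0 : ∑ v, M.degOut b v ≠ 0) : M.outType b b = 0 := by
  rw [Model.outType, weighted_apply (by rwa [sum_out])]
  simp

/-- The mean of `G` over the children of a node of type `i` whose parent has type `i`. -/
theorem pmfMean_offspring_self {i : Fin m} (h : M.E i i ≠ 0) (G : List (Fin m) → ℝ≥0∞) :
    (M.E i i : ℝ≥0∞) * pmfMean (M.offspringLaw (some i, i)) G =
      ∑ v, M.degInt i v * pmfMean (M.childrenLaw i (M.degInt i v - 1) (M.degOut i v)) G := by
  simp only [Model.offspringLaw, if_true, pmfMean_bind]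
  rw [← M.sum_degInt] at h ⊢
  exact pmfMean_weighted h _ _

/-- The mean of `G` over the children of a node of type `i` whose parent has type `j ≠ i`. -/
theorem pmfMean_offspring_of_ne {i j : Fin m} (hij : j ≠ i) (h : ∑ v, M.degOut i v ≠ 0)
    (G : List (Fin m) → ℝ≥0∞) :
    ((∑ v, M.degOut i v : ℕ) : ℝ≥0∞) * pmfMean (M.offspringLaw (some j, i)) G =
      ∑ v, M.degOut i v * pmfMean (M.childrenLaw i (M.degInt i v) (M.degOut i v - 1)) G := by
  simp only [Model.offspringLaw, if_neg hij, pmfMean_bind]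
  exact pmfMean_weighted h _ _

/-- Both sides sum over vertices of community `b` with one chosen internal half-edge and one chosen
outgoing half-edge to type `c`. One leads to the parent and the other to the removed child, and the
rest of the offspring has the same law for both assignments. -/
theorem removal_reversible_self {b c : Fin m} (hc : c ≠ b) (hE : M.E b b ≠ 0)
    (G : List (Fin m) → ℝ≥0∞) :
    (M.E b b : ℝ≥0∞) * pmfMean (M.offspringLaw (some b, b)) (fun l => removeSum c l G) =
      M.E c b * pmfMean (M.offspringLaw (some c, b)) (fun l => removeSum b l G) := by
  rw [pmfMean_offspring_self M hE, M.E_symm c b]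
  -- Without outgoing half-edges `weighted` falls back to a point mass; then `E b c = 0` and both
  -- sides vanish.
  by_cases h0 : ∑ v, M.degOut b v = 0
  · have h1 : ∀ v, M.degOut b v = 0 := fun v => (Finset.sum_eq_zero_iff.1 h0) v (Finset.mem_univ v)
    have h2 : M.E b c = 0 := Nat.le_zero.1 (h0 ▸ E_le_out M hc)
    simp only [pmfMean_childrenLaw_removeSum, h1, h2, if_neg hc.symm]
    simp
  · rw [← out_mul_outType M hc h0, mul_assoc, mul_left_comm, pmfMean_offspring_of_ne M hc h0,
      Finset.mul_sum]
    refine Finset.sum_congr rfl fun v _ => ?_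
    simp only [pmfMean_childrenLaw_removeSum, if_neg hc.symm, if_true, outType_self M h0]
    ring

/-- Exchange of the half-edge to the parent with the half-edge to the removed child, according to
which of them are internal. -/
theorem removal_reversible (hE : ∀ i, M.E i i ≠ 0) (a b c : Fin m) (G : List (Fin m) → ℝ≥0∞) :
    (M.E a b : ℝ≥0∞) * pmfMean (M.offspringLaw (some a, b)) (fun l => removeSum c l G) =
      M.E c b * pmfMean (M.offspringLaw (some c, b)) (fun l => removeSum a l G) := by
  by_cases hac : a = c
  · rw [hac]
  by_cases hab : a = b
  · subst hab
    exact removal_reversible_self M (Ne.symm hac) (hE _) G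
  by_cases hcb : c = b
  · subst hcb
    exact (removal_reversible_self M hac (hE _) G).symm
  by_cases h0 : ∑ v, M.degOut b v = 0
  · have h1 : M.E b a = 0 := Nat.le_zero.1 (h0 ▸ E_le_out M hab)
    have h2 : M.E b c = 0 := Nat.le_zero.1 (h0 ▸ E_le_out M hcb)
    rw [M.E_symm a b, M.E_symm c b, h1, h2]
    simp
  · rw [M.E_symm a b, M.E_symm c b, ← out_mul_outType M hab h0, ← out_mul_outType M hcb h0,
      mul_assoc, mul_left_comm, pmfMean_offspring_of_ne M hab h0, mul_assoc, mul_left_comm,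
      pmfMean_offspring_of_ne M hcb h0, Finset.mul_sum, Finset.mul_sum]
    refine Finset.sum_congr rfl fun v _ => ?_
    simp only [pmfMean_childrenLaw_removeSum, if_neg (Ne.symm hab), if_neg (Ne.symm hcb)]
    ring

theorem weightLaw_reversible (hE : ∀ i, M.E i i ≠ 0) (a b c : Fin m) :
    (M.E a b : ℝ≥0∞) • weightLaw M a b c = (M.E c b : ℝ≥0∞) • weightLaw M c b a := by
  ext s hs
  have hg : Measurable (s.indicator (1 : ℝ → ℝ≥0∞)) := measurable_one.indicator hs
  have h : ∀ a b c, weightLaw M a b c s =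
      pmfMean (M.offspringLaw (some a, b))
        (fun l => removeSum c l (restMean M (s.indicator 1) b)) := by
    intro a b c
    rw [pmfMean, ← lintegral_weightLaw_eq M a b c hg, lintegral_indicator_one hs]
  rw [Measure.smul_apply, Measure.smul_apply, h, h]
  exact removal_reversible M hE a b c _

/-- The Green function of the nodes, restricted to level `k`, is symmetric. -/
theorem lintegral_levelSum_symm (hE : ∀ i, M.E i i ≠ 0) (k : ℕ) (i j : Fin m) :
    (M.E i i : ℝ≥0∞) * ∫⁻ ω, levelSum (some j, j) k (some i, i) ω
        (fun l => ENNReal.ofReal (1 / (contPair l).1)) ∂resLaw M =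
      M.E j j * ∫⁻ ω, levelSum (some i, i) k (some j, j) ω
        (fun l => ENNReal.ofReal (1 / (contPair l).1)) ∂resLaw M := by
  have hm : Measurable fun l => ENNReal.ofReal (1 / (contPair l).1) :=
    ((measurable_const.div (measurable_fst.comp measurable_contPair))).ennreal_ofReal
  rw [lintegral_levelSum M _ _ _ _ _ hm, lintegral_levelSum M _ _ _ _ _ hm]
  -- Reversing the path exchanges the exit above the root with the target, and the continuant is
  -- unchanged.
  have h := pathSum_reverse (weightLaw M) (w := fun a b => (M.E a b : ℝ≥0∞))
    (fun a b => by rw [M.E_symm]) (weightLaw_reversible M hE) j j k i i hm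
    (by simpa only [contPair_reverse] using hm)
  simpa only [contPair_reverse] using h

end Offspring

/-! ### Almost sure regularity of the tree and lower bounds for escape and visits. -/

section Regular

variable {m : ℕ} {M : Model m} {Δ : ℕ}

/-- All the lists of children have at least two entries and at most `Δ`, and the first child has
the type of its parent. -/
def Regular (Δ : ℕ) (ω : Reservoir m) : Prop :=
  ∀ x : Node × Pair m, 2 ≤ (ω x).length ∧ (ω x).length ≤ Δ ∧ (ω x).head? = some x.2.2

theorem length_of_mem_support_iidList {α : Type*} {μ : PMF α} {n : ℕ} {l : List α}
    (h : l ∈ (iidList μ n).support) : l.length = n := by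
  induction n generalizing l with
  | zero => simp_all [iidList]
  | succ n ih =>
    simp only [iidList, PMF.mem_support_bind_iff, PMF.mem_support_map_iff] at h
    obtain ⟨a, -, l', hl', rfl⟩ := h
    simp [ih hl']

theorem childrenLaw_support {i : Fin m} {a b : ℕ} {l : List (Fin m)}
    (h : l ∈ (M.childrenLaw i a b).support) (ha : 2 ≤ a) (hab : a + b ≤ Δ) :
    2 ≤ l.length ∧ l.length ≤ Δ ∧ l.head? = some i := by
  simp only [Model.childrenLaw, PMF.mem_support_map_iff] at h
  obtain ⟨l', hl', rfl⟩ := h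
  have := length_of_mem_support_iidList hl'
  refine ⟨by simp; omega, by simp; omega, ?_⟩
  obtain ⟨n, rfl⟩ := Nat.exists_eq_add_of_le' ha
  rfl

/-- Of at least three internal half-edges at most one leads to the parent, so two internal children
remain; they come first in the list. -/
theorem offspringLaw_support (h3 : ∀ i v, 3 ≤ M.degInt i v) (hΔ : ∀ i v, M.deg i v ≤ Δ)
    {p : Pair m} {l : List (Fin m)} (h : l ∈ (M.offspringLaw p).support) :
    2 ≤ l.length ∧ l.length ≤ Δ ∧ l.head? = some p.2 := by
  obtain ⟨j, i⟩ := p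
  unfold Model.deg at hΔ
  cases j with
  | none =>
    simp only [Model.offspringLaw, PMF.mem_support_bind_iff] at h
    obtain ⟨v, -, hv⟩ := h
    exact childrenLaw_support hv (by have := h3 i v; omega) (hΔ i v)
  | some j =>
    simp only [Model.offspringLaw] at h
    split_ifs at h
    · rw [PMF.mem_support_bind_iff] at h
      obtain ⟨v, -, hv⟩ := h
      exact childrenLaw_support hv (by have := h3 i v; omega) (by have := hΔ i v; omega)
    · rw [PMF.mem_support_bind_iff] at h
      obtain ⟨v, -, hv⟩ := h
      exact childrenLaw_support hv (by have := h3 i v; omega) (by have := hΔ i v; omega)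

theorem ae_regular (h3 : ∀ i v, 3 ≤ M.degInt i v) (hΔ : ∀ i v, M.deg i v ≤ Δ) :
    ∀ᵐ ω ∂resLaw M, Regular Δ ω := by
  refine ae_all_iff.2 fun x => ?_
  have h := measurePreserving_eval_infinitePi
    (fun x : Node × (Option (Fin m) × Fin m) => (M.offspringLaw x.2).toMeasure) x
  have h2 : ∀ᵐ l ∂(M.offspringLaw x.2).toMeasure,
      2 ≤ l.length ∧ l.length ≤ Δ ∧ l.head? = some x.2.2 := by
    rw [ae_iff, PMF.toMeasure_apply_eq_zero_iff _ (MeasurableSet.of_discrete)]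
    exact Set.disjoint_left.2 fun l hl hn => hn (offspringLaw_support h3 hΔ hl)
  exact h.quasiMeasurePreserving.ae h2

variable {ω : Reservoir m}

theorem Regular.two_le (h : Regular Δ ω) (p : Pair m) (u : Node) : 2 ≤ (kids p ω u).length :=
  (h _).1

theorem Regular.le (h : Regular Δ ω) (p : Pair m) (u : Node) : (kids p ω u).length ≤ Δ := (h _).2.1

theorem Regular.tp_zero (h : Regular Δ ω) (p : Pair m) (u : Node) :
    tp p ω (0 :: u) = (some (tp p ω u).2, (tp p ω u).2) := by
  have := (h (u, tp p ω u)).2.2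
  rw [tp, List.getD_eq_getElem?_getD, ← List.head?_eq_getElem?, this]
  rfl

/-! ### The mass of the first visits -/

open Classical in
theorem measurable_marked_hitV (P : Mark m) (p : Pair m) (a : Node) :
    Measurable fun ω => if Marked P p ω a then hitV p ω a else 0 :=
  Measurable.ite (measurableSet_setOfPred.2 (measurable_marked P p a))
    (Measurable.iSup fun n => measurable_val p _ _ _ n _) measurable_const

open Classical in
theorem measurable_markedSum (P : Mark m) (p : Pair m) (k : ℕ) :
    Measurable fun ω => ∑' a : Node, (if a.length = k then
      (if Marked P p ω a then hitV p ω a else 0) else 0) := by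
  refine Measurable.tsum fun a => ?_
  split_ifs
  · exact measurable_marked_hitV P p a
  · exact measurable_const

-- With the empty property for `S`, `Past` is a bare first visit, and the sum over times is a
-- hitting probability. So this mass is the Green function on level `k` of the walk killed at the
-- exit, each node counted once.
open Classical in
theorem mass_bot_eq (M : Model m) {p : Pair m} (hp : p.1 ≠ none) (P : Mark m) {k : ℕ}
    (hk : 0 < k) :
    mass M (fun _ _ => False) P p k = ∫⁻ ω, ∑' a : Node, (if a.length = k then
      (if Marked P p ω a then hitV p ω a else 0) else 0) ∂resLaw M := by
  have hms : ∀ a : Node, MeasurableSet {ω : Reservoir m | Marked P p ω a} := fun a =>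
    measurableSet_setOfPred.2 (measurable_marked P p a)
  rw [lintegral_tsum]
  · rw [mass, ENNReal.tsum_prod (f := fun (a : Node) (t : ℕ) => if a.length = k then
      pastMass M 0 (fun _ _ => False) P p (a, t) else 0)]
    refine tsum_congr fun a => ?_
    by_cases ha : a.length = k
    · simp only [ha, if_true, pastMass]
      have h1 : ∀ t, jointLaw M {z | Past 0 (fun _ _ => False) P p z.1 z.2 a t} =
          ∫⁻ ω, (if Marked P p ω a then seedLaw {ξ | FirstHit p ω ξ a t} else 0) ∂resLaw M := by
        intro t
        rw [jointLaw, Measure.prod_apply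
          (measurableSet_setOfPred.2 (measurable_past 0 (fun _ _ => False) P p a t))]
        refine lintegral_congr fun ω => ?_
        split_ifs with hm
        · congr 1
          ext ξ
          simp only [Set.mem_preimage, Set.mem_ofPred_eq, Past]
          refine ⟨fun h => h.1, fun h => ⟨h, by omega, hm, ?_⟩⟩
          intro w t₁ _ _ hw
          cases w <;> exact hw.elim
        · convert measure_empty (μ := seedLaw)
          ext ξ
          simp only [Set.mem_preimage, Set.mem_ofPred_eq, Past, Set.mem_empty_iff_false, iff_false]
          exact fun h => hm h.2.2.1
      simp only [h1]
      rw [← lintegral_tsum]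
      · refine lintegral_congr fun ω => ?_
        split_ifs
        · exact tsum_seedLaw_firstHit hp a
        · simp
      · intro t
        refine (Measurable.ite (hms a) ?_ measurable_const).aemeasurable
        exact measurable_measure_prodMk_left (measurableSet_setOfPred.2 (measurable_firstHit p a t))
    · simp [ha]
  · intro a
    split_ifs
    · exact (measurable_marked_hitV P p a).aemeasurable
    · exact measurable_const.aemeasurable

theorem marked_at_iff {a : Node} (ha : a ≠ []) (j : Fin m) (p : Pair m) :
    Marked (sgMark.at j) p ω a ↔ tp p ω a = (some j, j) := by
  cases a with
  | nil => exact absurd rfl ha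
  | cons k u =>
    constructor
    · exact fun h => h.2
    · intro h
      refine ⟨?_, h⟩
      rw [sgMark, h]

theorem mass_zero (S P : Mark m) (p : Pair m) : mass M S P p 0 = 0 := by
  rw [mass]
  refine ENNReal.tsum_eq_zero.2 fun x => ?_
  split_ifs with h
  · rw [pastMass]
    convert measure_empty (μ := jointLaw M)
    ext z
    simp only [Set.mem_ofPred_eq, Set.mem_empty_iff_false, iff_false]
    intro h'
    have := h'.2.1
    omega
  · rfl

/-- The symmetry of the Green function of the nodes that have the type of their parent. -/
theorem mass_bot_symm (hE : ∀ i, M.E i i ≠ 0) (k : ℕ) (i j : Fin m) :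
    (M.E i i : ℝ≥0∞) * mass M (fun _ _ => False) (sgMark.at j) (some i, i) k =
      M.E j j * mass M (fun _ _ => False) (sgMark.at i) (some j, j) k := by
  rcases Nat.eq_zero_or_pos k with rfl | hk
  · simp [mass_zero]
  · have h : ∀ i j, mass M (fun _ _ => False) (sgMark.at j) (some i, i) k =
        ∫⁻ ω, levelSum (some j, j) k (some i, i) ω
          (fun l => ENNReal.ofReal (1 / (contPair l).1)) ∂resLaw M := by
      classical
      intro i j
      rw [mass_bot_eq M (by simp) _ hk]
      refine lintegral_congr fun ω => ?_
      rw [← tsum_hitV_eq_levelSum]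
      refine tsum_congr fun a => ?_
      by_cases ha : a.length = k
      · have hne : a ≠ [] := by rintro rfl; simp at ha; omega
        simp only [ha, if_true, marked_at_iff hne]
      · simp [ha]
    rw [h, h]
    exact lintegral_levelSum_symm M hE k i j

/-! ### Lower bounds on regular trees -/

theorem half_le_tsum_hitV (hω : Regular Δ ω) {p : Pair m} (hp : p.1 ≠ none) (k : ℕ) :
    2⁻¹ ≤ ∑' a : Node, if a.length = k then hitV p ω a else 0 := by
  refine (half_le_depth hp (hω.two_le p) k).trans ?_
  refine (measure_mono (t := ⋃ a : Node, {ξ | a.length = k ∧ ∃ t, FirstHit p ω ξ a t}) ?_).trans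
    ((measure_iUnion_le _).trans ?_)
  · rintro ξ ⟨s, v, hv, h⟩
    classical
    have hex : ∃ s, pos p ω ξ (some []) s = some v := ⟨s, h⟩
    exact Set.mem_iUnion.2 ⟨v, hv, Nat.find hex, Nat.find_spec hex, fun r hr => Nat.find_min hex hr⟩
  · refine ENNReal.tsum_le_tsum fun a => ?_
    by_cases ha : a.length = k
    · simp only [ha, true_and, if_true]
      rw [← tsum_seedLaw_firstHit hp, Set.ofPred_exists]
      exact measure_iUnion_le _
    · simp [ha]

theorem length_le_of_pos_eq {p : Pair m} {ξ : WalkSeed} {t : ℕ} {v : Node}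
    (h : pos p ω ξ (some []) t = some v) : v.length ≤ t := by
  induction t generalizing v with
  | zero =>
    simp only [pos, Option.some.injEq] at h
    simp [← h]
  | succ t ih =>
    have hne : pos p ω ξ (some []) t ≠ none :=
      pos_ne_none_of_le (t := t + 1) (by rw [h]; simp) (Nat.le_succ t)
    obtain ⟨u, hu⟩ := Option.ne_none_iff_exists'.1 hne
    have := ih hu
    rw [pos, hu] at h
    rcases move_cases p ω (ξ.1 t) (fun d => ξ.2 (t, d)) u with h' | ⟨k, h'⟩ | h'
    · rw [h'] at h
      simp only [Option.some.injEq] at h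
      subst h
      omega
    · rw [h'] at h
      simp only [Option.some.injEq] at h
      subst h
      simp; omega
    · rw [h'] at h
      cases u with
      | nil => simp [up] at h
      | cons k u =>
        simp only [up, Option.some.injEq] at h
        subst h
        simp at this
        omega

/-- Reaching depth `t` takes at least `t` steps, so `half_le_depth` bounds survival until every time
`t`. -/
theorem half_le_alive (hω : Regular Δ ω) {p : Pair m} (hp : p.1 ≠ none) :
    2⁻¹ ≤ seedLaw {ξ | Alive p ω ξ} := by
  have hset : {ξ | Alive p ω ξ} = ⋂ t, {ξ | pos p ω ξ (some []) t ≠ none} := by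
    ext ξ; simp [Alive]
  rw [hset, Antitone.measure_iInter]
  · refine le_iInf fun t => (half_le_depth hp (hω.two_le p) t).trans (measure_mono ?_)
    rintro ξ ⟨s, v, hv, h⟩
    have := length_le_of_pos_eq h
    exact pos_ne_none_of_le (t := s) (by rw [h]; simp) (by omega)
  · intro s t hst ξ h
    exact pos_ne_none_of_le h hst
  · intro t
    exact (measurableSet_setOfPred.2 ((measurable_of_countable (· ≠ none)).comp
      (measurable_pos_seed p ω _ t))).nullMeasurableSet
  · exact ⟨0, measure_ne_top _ _⟩

theorem half_le_esc (h3 : ∀ i v, 3 ≤ M.degInt i v) (hΔ : ∀ i v, M.deg i v ≤ Δ) {p : Pair m}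
    (hp : p.1 ≠ none) : 2⁻¹ ≤ esc M p := by
  rw [esc, jointLaw, Measure.prod_apply (measurableSet_setOfPred.2 (measurable_alive p))]
  calc (2⁻¹ : ℝ≥0∞) = ∫⁻ _, 2⁻¹ ∂resLaw M := by simp
    _ ≤ _ := lintegral_mono_ae ((ae_regular h3 hΔ).mono fun ω hω => half_le_alive hω hp)

/-- The lower bound `1 / (2 (Δ + 1))` for the probability to move to a given child. -/
def stepBound (Δ : ℕ) : ℝ≥0∞ := 2⁻¹ * ((Δ + 1 : ℕ) : ℝ≥0∞)⁻¹

theorem stepBound_le_seedLaw (hω : Regular Δ ω) (p : Pair m) {κ : ℕ}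
    (hκ : κ < (kids p ω []).length) :
    stepBound Δ ≤ seedLaw {ξ | pos p ω ξ (some []) 1 = some [κ]} := by
  classical
  have h := lintegral_pos_one p ω [] (fun o => if o = some [κ] then 1 else 0)
  have hm : MeasurableSet {ξ | pos p ω ξ (some []) 1 = some [κ]} :=
    measurableSet_setOfPred.2 ((measurable_of_countable (· = some [κ])).comp
      (measurable_pos_seed p ω _ 1))
  rw [← lintegral_indicator_one hm]
  have h1 : ∫⁻ ξ, {ξ | pos p ω ξ (some []) 1 = some [κ]}.indicator 1 ξ ∂seedLaw =
      ∫⁻ ξ, (if pos p ω ξ (some []) 1 = some [κ] then 1 else 0) ∂seedLaw :=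
    lintegral_congr fun ξ => by simp [Set.indicator_apply]
  rw [h1, h]
  set L := nbrs p ω [] with hL
  have hlen : L.length ≤ Δ + 1 := by
    have := hω.le p []
    rw [hL, nbrs, List.length_append, List.length_map, List.length_range]
    split_ifs <;> simp <;> omega
  have hκL : κ < L.length := by
    rw [hL, nbrs, List.length_append, List.length_map, List.length_range]
    omega
  have hget : L.getD κ (some []) = some [κ] := by
    rw [hL, nbrs, List.getD_append _ _ _ _ (by simpa using hκ)]
    simp [hκ]
  have h2 : (1 : ℝ≥0∞) ≤ ∑ i ∈ Finset.range (L.length - 1 + 1),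
      if L.getD i (some []) = some [κ] then 1 else 0 := by
    refine le_trans ?_ (Finset.single_le_sum (f := fun i =>
      if L.getD i (some []) = some [κ] then (1 : ℝ≥0∞) else 0) (fun _ _ => zero_le)
      (Finset.mem_range.2 (by omega : κ < L.length - 1 + 1)))
    rw [if_pos hget]
  refine le_trans ?_ le_add_self
  have h4 : L.length - 1 + 1 ≤ Δ + 1 := by omega
  refine mul_le_mul' le_rfl ?_
  rw [← one_div]
  exact ENNReal.div_le_div h2 (by exact_mod_cast h4)

theorem Regular.shift (h : Regular Δ ω) (v : Node) : Regular Δ (shift v ω) := fun x =>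
  h (x.1 ++ v, x.2)

theorem firstHit_singleton {p : Pair m} {ξ : WalkSeed} {κ : ℕ}
    (h : pos p ω ξ (some []) 1 = some [κ]) : FirstHit p ω ξ [κ] 1 := by
  refine ⟨h, fun s hs => ?_⟩
  obtain rfl : s = 0 := by omega
  simp [pos]

/-- Right after its first visit to `a` the walk may step to the first child; restarting the seed at
that time gives the product. -/
theorem stepBound_mul_hitV_le (hω : Regular Δ ω) {p : Pair m} (hp : p.1 ≠ none) (a : Node) :
    stepBound Δ * hitV p ω a ≤ hitV p ω (0 :: a) := by
  rw [← tsum_seedLaw_firstHit hp, ← tsum_seedLaw_firstHit hp, ← ENNReal.tsum_mul_left]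
  refine le_trans (ENNReal.tsum_le_tsum fun t => ?_)
    (ENNReal.tsum_comp_le_tsum_of_injective (add_left_injective 1) _)
  have hmA : MeasurableSet {ξ : WalkSeed | FirstHit p ω ξ a t} :=
    measurableSet_setOfPred.2
      ((measurable_firstHit p a t).comp (measurable_const.prodMk measurable_id))
  have hmB : MeasurableSet {ξ | pos (tp p ω a) (MultiCommunity.shift a ω) ξ (some []) 1 = some [0]} :=
    measurableSet_setOfPred.2 ((measurable_of_countable (· = some [0])).comp
      (measurable_pos_seed _ _ _ 1))
  have hr := seedLaw_restart t hmA hmB (by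
    intro ξ ξ₂ h1 h2 h
    have hag : Agree a t ω ω ξ ξ₂ := ⟨fun _ _ _ => rfl, h1, h2⟩
    exact (hag.firstHit h).1)
  rw [mul_comm]
  refine le_trans (mul_le_mul' le_rfl (stepBound_le_seedLaw (hω.shift a) (tp p ω a)
    (lt_of_lt_of_le Nat.zero_lt_two ((hω.shift a).two_le _ _)))) ?_
  rw [← hr]
  refine measure_mono fun ξ hξ => ?_
  exact (hξ.1.shift_iff.1 (firstHit_singleton hξ.2)).1

/-- Level `k` is reached with probability at least `1/2`, and the first child of a node shares its
type. The bound is uniform in `k`, so the Green function diverges. -/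
theorem le_sum_mass_bot (h3 : ∀ i v, 3 ≤ M.degInt i v) (hΔ : ∀ i v, M.deg i v ≤ Δ) (i : Fin m)
    (k : ℕ) :
    stepBound Δ * 2⁻¹ ≤ ∑ j, mass M (fun _ _ => False) (sgMark.at j) (some i, i) (k + 1) := by
  classical
  have hp : ((some i, i) : Pair m).1 ≠ none := by simp
  simp only [mass_bot_eq M hp _ (Nat.succ_pos k)]
  rw [← lintegral_finsetSum _ fun j _ => measurable_markedSum _ _ _]
  calc stepBound Δ * 2⁻¹ = ∫⁻ _, stepBound Δ * 2⁻¹ ∂resLaw M := by simp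
    _ ≤ _ := lintegral_mono_ae ((ae_regular h3 hΔ).mono fun ω hω => ?_)
  refine (mul_le_mul' le_rfl (half_le_tsum_hitV hω hp k)).trans ?_
  rw [← Summable.tsum_finsetSum fun i _ => ENNReal.summable, ← ENNReal.tsum_mul_left]
  refine le_trans (ENNReal.tsum_le_tsum fun a => ?_)
    (ENNReal.tsum_comp_le_tsum_of_injective (f := fun a : Node => 0 :: a)
      (fun a b h => List.cons_injective h) _)
  by_cases ha : a.length = k
  · simp only [ha, if_true, List.length_cons]
    refine (stepBound_mul_hitV_le hω hp a).trans ?_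
    refine le_trans ?_ (Finset.single_le_sum (f := fun j =>
      if Marked (sgMark.at j) (some i, i) ω (0 :: a) then hitV (some i, i) ω (0 :: a) else 0)
      (fun _ _ => zero_le) (Finset.mem_univ (tp (some i, i) ω a).2))
    rw [if_pos]
    rw [marked_at_iff (by simp), hω.tp_zero]
  · simp [ha]

end Regular

section Direct

variable {m : ℕ} {M : Model m} {Δ : ℕ} {ω : Reservoir m} {ξ : WalkSeed} {p : Pair m}

/-! ### Walks that go straight to a node -/

/-- The pairs of types on the path from `v` to the root, without the root. -/
def trace (p : Pair m) (ω : Reservoir m) : Node → List (Pair m)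
  | [] => []
  | k :: u => tp p ω (k :: u) :: trace p ω u

theorem length_trace (v : Node) : (trace p ω v).length = v.length := by
  induction v with
  | nil => rfl
  | cons k u ih => simp [trace, ih]

theorem headD_trace (v : Node) : (trace p ω v).headD p = tp p ω v := by
  cases v <;> rfl

theorem measurable_trace_eq (p : Pair m) (v : Node) (L : List (Pair m)) :
    Measurable fun ω : Reservoir m => trace p ω v = L := by
  induction v generalizing L with
  | nil => simp only [trace]; exact measurable_const
  | cons k u ih =>
    cases L with
    | nil => simp [trace]
    | cons q L =>
      simp only [trace, List.cons.injEq]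
      exact ((measurable_of_countable (· = q)).comp (measurable_tp p (k :: u))).and (ih L)

/-- The probability that the walk moves in the first step to a child with the pair of types `q`. -/
def stepMass (M : Model m) (p q : Pair m) : ℝ≥0∞ :=
  ∑' κ : ℕ, jointLaw M {z | pos p z.1 z.2 (some []) 1 = some [κ] ∧ tp p z.1 [κ] = q}

/-- The probability of walking straight along the pairs of types `L`, the last one first. -/
def directMass (M : Model m) (p : Pair m) : List (Pair m) → ℝ≥0∞
  | [] => 1
  | q :: L => directMass M p L * stepMass M (L.headD p) q

theorem Agree.trace_eq {v : Node} {t : ℕ} {ω₂ : Reservoir m} {ξ₂ : WalkSeed}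
    (h : Agree v t ω ω₂ ξ ξ₂) (p : Pair m) : trace p ω v = trace p ω₂ v := by
  have key : ∀ u : Node, u <:+ v → trace p ω u = trace p ω₂ u := by
    intro u
    induction u with
    | nil => intro _; rfl
    | cons k u ih =>
      intro hu
      have hu' : u <:+ v := (List.suffix_cons k u).trans hu
      rw [trace, trace, ih hu', h.tp_eq p]
      by_cases hv : v <:+ k :: u
      · exact Or.inl (hu.eq_of_length (le_antisymm hu.length_le hv.length_le))
      · exact Or.inr hv
  exact key v List.suffix_rfl

/-- Each straight step is a restart in the fresh subtree at the current node, so the probabilities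
multiply; different nodes are summed. -/
theorem directMass_le (M : Model m) (p : Pair m) (L : List (Pair m)) :
    directMass M p L ≤ ∑' v : Node, jointLaw M {z | FirstHit p z.1 z.2 v v.length ∧
      trace p z.1 v = L} := by
  induction L with
  | nil =>
    refine le_trans ?_ (ENNReal.le_tsum [])
    have : {z : Reservoir m × WalkSeed | FirstHit p z.1 z.2 [] ([] : Node).length ∧
        trace p z.1 [] = []} = Set.univ := by
      refine Set.eq_univ_of_forall fun z => ⟨⟨rfl, fun s hs => ?_⟩, rfl⟩
      simp at hs
    rw [this, measure_univ, directMass]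
  | cons q L ih =>
    rw [directMass]
    refine (mul_le_mul' ih le_rfl).trans ?_
    rw [← ENNReal.tsum_mul_right]
    refine le_trans (ENNReal.tsum_le_tsum fun u => ?_) (b := ∑' (u : Node) (κ : ℕ),
      jointLaw M {z | FirstHit p z.1 z.2 (κ :: u) (κ :: u).length ∧
        trace p z.1 (κ :: u) = q :: L}) ?_
    · rw [stepMass, ← ENNReal.tsum_mul_left]
      refine ENNReal.tsum_le_tsum fun κ => ?_
      rw [← jointLaw_restart M u u.length]
      · refine measure_mono fun z hz => ?_
        obtain ⟨⟨h1, h2⟩, h3, h4⟩ := hz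
        have h5 : tp p z.1 u = L.headD p := by rw [← h2, headD_trace]
        simp only at h3 h4
        rw [← h5] at h3 h4
        refine ⟨(h1.shift_iff.1 (firstHit_singleton h3)).1, ?_⟩
        rw [trace, h2]
        congr 1
      · exact measurableSet_setOfPred.2 ((measurable_firstHit p u _).and
          ((measurable_trace_eq p u L).comp measurable_fst))
      · exact measurableSet_setOfPred.2 ((measurable_pos_mem _ _ 1 (· = some [κ])).and
          (((measurable_of_countable (· = q)).comp (measurable_tp _ [κ])).comp measurable_fst))
      · intro ω ω₂ ξ ξ₂ hag h
        exact ⟨(hag.firstHit h.1).1, by rw [← hag.trace_eq]; exact h.2⟩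
    · rw [← ENNReal.tsum_prod (f := fun (u : Node) (κ : ℕ) =>
        jointLaw M {z | FirstHit p z.1 z.2 (κ :: u) (κ :: u).length ∧
        trace p z.1 (κ :: u) = q :: L})]
      exact ENNReal.tsum_comp_le_tsum_of_injective (f := fun x : Node × ℕ => x.2 :: x.1)
        (fun x y h => Prod.ext (List.cons.inj h).2 (List.cons.inj h).1) _

/-- No node below level `K` on the path has the property `S`. -/
def Avoids (K : ℕ) (S : Mark m) (p : Pair m) : List (Pair m) → Prop
  | [] => True
  | q :: L => (K < L.length + 1 → ¬ S (L.headD p) q) ∧ Avoids K S p L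

theorem Avoids.not_marked {K : ℕ} {S : Mark m} {v w : Node} (h : Avoids K S p (trace p ω v))
    (hw : w <:+ v) (hK : K < w.length) : ¬ Marked S p ω w := by
  induction v with
  | nil =>
    rw [List.suffix_nil] at hw
    subst hw
    simp at hK
  | cons k u ih =>
    rw [List.suffix_cons_iff] at hw
    rcases hw with rfl | hw
    · intro hm
      refine h.1 ?_ ?_
      · rwa [length_trace]
      · rw [headD_trace]
        exact hm
    · exact ih h.2 hw

/-- The walks that go straight to the first node with the property `S`. -/
theorem directMass_le_pastMass (M : Model m) {K : ℕ} {S P : Mark m} {q : Pair m}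
    {L : List (Pair m)} (hK : K < L.length + 1) (hP : P (L.headD p) q) (hS : Avoids K S p L) :
    directMass M p (q :: L) ≤ ∑' x, pastMass M K S P p x := by
  refine (directMass_le M p (q :: L)).trans ?_
  refine le_trans (ENNReal.tsum_le_tsum fun v => ?_)
    (ENNReal.tsum_comp_le_tsum_of_injective (f := fun v : Node => ((v, v.length) : Node × ℕ))
      (fun x y h => congrArg Prod.fst h) _)
  refine measure_mono fun z hz => ?_
  obtain ⟨h1, h2⟩ := hz
  cases v with
  | nil => simp [trace] at h2
  | cons k u =>
    rw [trace, List.cons.injEq] at h2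
    have hlen : u.length = L.length := by rw [← h2.2, length_trace]
    refine ⟨h1, by simp [hlen, hK], ?_, ?_⟩
    · change P (tp p z.1 u) (tp p z.1 (k :: u))
      rw [h2.1, ← headD_trace, h2.2]
      exact hP
    · intro w t₁ ht hw hm hcut
      have hsuf := hcut.suffix ht.le h1.1
      rw [List.suffix_cons_iff] at hsuf
      rcases hsuf with rfl | hsuf
      · exact ht.ne (hcut.1.unique h1)
      · exact (h2.2 ▸ hS : Avoids K S p (trace p z.1 u)).not_marked hsuf hw hm

/-! ### Lower bounds for one step -/

/-- Each child of type `j` is chosen with probability at least `stepBound Δ`, and `removeSum` of the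
constant one counts these children. -/
theorem le_stepMass (h3 : ∀ i v, 3 ≤ M.degInt i v) (hΔ : ∀ i v, M.deg i v ≤ Δ) (p : Pair m)
    (j : Fin m) :
    stepBound Δ * pmfMean (M.offspringLaw p) (fun l => removeSum j l fun _ => 1) ≤
      stepMass M p (some p.2, j) := by
  have hmk : Measurable fun ω : Reservoir m => removeSum j (kids p ω []) fun _ => 1 :=
    (measurable_of_countable fun l => removeSum j l fun _ => 1).comp (measurable_kids p [])
  rw [pmfMean, ← lintegral_root, ← lintegral_const_mul _ hmk]
  have hms : ∀ κ : ℕ, MeasurableSet {z : Reservoir m × WalkSeed |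
      pos p z.1 z.2 (some []) 1 = some [κ] ∧ tp p z.1 [κ] = (some p.2, j)} := fun κ =>
    measurableSet_setOfPred.2 ((measurable_pos_mem _ _ 1 (· = some [κ])).and
      (((measurable_of_countable (· = (some p.2, j))).comp (measurable_tp _ [κ])).comp
        measurable_fst))
  simp only [stepMass, jointLaw, Measure.prod_apply (hms _)]
  rw [← lintegral_tsum fun κ => (measurable_measure_prodMk_left (hms κ)).aemeasurable]
  refine lintegral_mono_ae ((ae_regular h3 hΔ).mono fun ω hω => ?_)
  rw [removeSum, Finset.mul_sum]
  refine le_trans (Finset.sum_le_sum fun κ hκ => ?_) (ENNReal.sum_le_tsum (Finset.range _))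
  split_ifs with h
  · rw [mul_one]
    refine (stepBound_le_seedLaw hω p (Finset.mem_range.1 hκ)).trans (measure_mono fun ξ hξ => ?_)
    refine ⟨hξ, ?_⟩
    simp [tp_singleton, h]
  · simp

theorem le_stepMass_self (h3 : ∀ i v, 3 ≤ M.degInt i v) (hΔ : ∀ i v, M.deg i v ≤ Δ)
    (p : Pair m) : stepBound Δ ≤ stepMass M p (some p.2, p.2) := by
  refine le_trans ?_ (le_stepMass h3 hΔ p p.2)
  refine le_mul_of_one_le_right zero_le ?_
  rw [pmfMean]
  calc (1 : ℝ≥0∞) = ∑' l, M.offspringLaw p l := (PMF.tsum_coe _).symm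
    _ ≤ _ := ENNReal.tsum_le_tsum fun l => ?_
  by_cases hl : l ∈ (M.offspringLaw p).support
  · obtain ⟨h1, -, h2⟩ := offspringLaw_support h3 hΔ hl
    refine le_mul_of_one_le_right zero_le ?_
    refine le_trans ?_ (Finset.single_le_sum (f := fun κ =>
      if l[κ]? = some p.2 then (1 : ℝ≥0∞) else 0) (fun _ _ => zero_le)
      (Finset.mem_range.2 (by omega : 0 < l.length)))
    rw [← List.head?_eq_getElem?, if_pos h2]
  · rw [PMF.mem_support_iff, not_not] at hl
    simp [hl]

theorem E_self_ne_zero (h3 : ∀ i v, 3 ≤ M.degInt i v) (i : Fin m) : M.E i i ≠ 0 := by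
  rw [← M.sum_degInt]
  have := Finset.single_le_sum (f := M.degInt i) (fun _ _ => Nat.zero_le _)
    (Finset.mem_univ ⟨0, M.n_pos i⟩)
  have := h3 i ⟨0, M.n_pos i⟩
  omega

/-- The mean number of children of type `j` of a node of type `i` whose parent has type `i`. -/
theorem le_stepMass_out (h3 : ∀ i v, 3 ≤ M.degInt i v) (hΔ : ∀ i v, M.deg i v ≤ Δ)
    {i j : Fin m} (hij : j ≠ i) :
    stepBound Δ * (M.E i j / M.E i i) ≤ stepMass M (some i, i) (some i, j) := by
  refine le_trans ?_ (le_stepMass h3 hΔ (some i, i) j)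
  refine mul_le_mul' le_rfl (ENNReal.div_le_of_le_mul' ?_)
  by_cases h0 : ∑ v, M.degOut i v = 0
  · have h2 : M.E i j = 0 := Nat.le_zero.1 (h0 ▸ E_le_out M hij)
    simp [h2]
  · rw [pmfMean_offspring_self M (E_self_ne_zero h3 i), ← out_mul_outType M hij h0, Nat.cast_sum, Finset.sum_mul]
    refine Finset.sum_le_sum fun v _ => ?_
    rw [pmfMean_childrenLaw_removeSum, if_neg hij.symm, zero_add, pmfMean_const, mul_one]
    -- The size bias by `degInt` is at least one and can be dropped.
    refine le_mul_of_one_le_left zero_le ?_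
    have := h3 i v
    exact_mod_cast (by omega : 1 ≤ M.degInt i v)

end Direct

/-! ### Lower bounds for the weights between regenerations. -/

section Bounds

variable {m : ℕ} {M : Model m} {Δ : ℕ}

theorem stepBound_ne_zero (Δ : ℕ) : stepBound Δ ≠ 0 := by
  simp [stepBound]

theorem stepBound_le_goodWeight (h3 : ∀ i v, 3 ≤ M.degInt i v) (hΔ : ∀ i v, M.deg i v ≤ Δ)
    (i : Fin m) : stepBound Δ ≤ goodWeight M i i := by
  refine (le_stepMass_self h3 hΔ (some i, i)).trans ?_
  refine le_trans ?_ (directMass_le_pastMass M (L := []) (q := (some i, i)) (by simp)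
    ⟨⟨rfl, rfl⟩, rfl⟩ trivial)
  simp [directMass]

/-- Three straight steps suffice: into type `j`, then twice within it. The first node differs in
type from its parent and the second from its grandparent, so only the third is good. -/
theorem le_goodWeight (h3 : ∀ i v, 3 ≤ M.degInt i v) (hΔ : ∀ i v, M.deg i v ≤ Δ)
    {i j : Fin m} (hij : j ≠ i) :
    stepBound Δ ^ 3 * (M.E i j / M.E i i) ≤ goodWeight M i j := by
  have h1 := le_stepMass_out h3 hΔ hij
  have h2 := le_stepMass_self h3 hΔ (some i, j)
  have h4 := le_stepMass_self h3 hΔ (some j, j)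
  refine le_trans ?_ (directMass_le_pastMass M (L := [(some j, j), (some i, j)]) (q := (some j, j))
    (by simp) ⟨⟨rfl, rfl⟩, rfl⟩ ?_)
  · simp only [directMass, one_mul, List.headD_cons, List.headD_nil]
    calc _ = (stepBound Δ * (M.E i j / M.E i i)) * stepBound Δ * stepBound Δ := by ring
      _ ≤ _ := mul_le_mul' (mul_le_mul' h1 h2) h4
  · refine ⟨fun _ h => ?_, fun _ h => ?_, trivial⟩
    · have := h.1
      simp only [List.headD_cons, Option.some.injEq] at this
      exact hij this.symm
    · have := h.2
      simp only [List.headD_nil, Prod.mk.injEq] at this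
      exact hij this.2

/-- Ensures that the conditioning in the types chain is on an event of positive probability; this is
where irreducibility carries the walk from the type of the root to `i`. -/
theorem firstWeight_ne_zero (h3 : ∀ i v, 3 ≤ M.degInt i v) (hΔ : ∀ i v, M.deg i v ≤ Δ)
    (hQ : M.Q.IsIrreducible) (ν : PMF (Fin m)) (K : ℕ) (i : Fin m) : firstWeight M ν K i ≠ 0 := by
  obtain ⟨r, hr⟩ := ν.support_nonempty
  have hself : ∀ p : Pair m, stepMass M p (some p.2, p.2) ≠ 0 := fun p h =>
    stepBound_ne_zero Δ (le_antisymm (h ▸ le_stepMass_self h3 hΔ p) zero_le)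
  -- The types at which a straight walk can stand with a parent of the same type, at depth at least
  -- `K`, before any good node deeper than `K`. One more step within the type completes a first
  -- regeneration segment.
  set A : Set (Fin m) := {b | ∃ L : List (Pair m), directMass M (none, r) L ≠ 0 ∧
    Avoids K goodMark (none, r) L ∧ K ≤ L.length ∧ L.headD (none, r) = (some b, b)} with hA
  have hmem : i ∈ A := by
    refine mem_of_closed_of_isIrreducible hQ ?_ ?_ i
    · have h0 : ∀ n, directMass M (none, r) (List.replicate n (some r, r)) ≠ 0 := by
        intro n
        induction n with
        | zero => simp [directMass]
        | succ n ih =>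
          rw [List.replicate_succ, directMass]
          refine mul_ne_zero ih ?_
          cases n with
          | zero => exact hself (none, r)
          | succ n => exact hself (some r, r)
      have h1 : ∀ n, n ≤ K → Avoids K goodMark (none, r) (List.replicate n (some r, r)) := by
        intro n hn
        induction n with
        | zero => trivial
        | succ n ih =>
          refine ⟨fun h => ?_, ih (by omega)⟩
          simp only [List.length_replicate] at h
          omega
      -- For `K = 0` one step creates the pair `(r,r)`; its node is not good, because the root has
      -- no parent.
      rcases Nat.eq_zero_or_pos K with hK | hK
      · refine ⟨r, [(some r, r)], h0 1, ⟨fun _ h => ?_, trivial⟩, by simp [hK], rfl⟩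
        simpa using h.1
      · refine ⟨r, List.replicate K (some r, r), h0 K, h1 K le_rfl, by simp, ?_⟩
        obtain ⟨n, rfl⟩ := Nat.exists_eq_add_of_le' hK
        rfl
    · rintro b ⟨L, hL, hav, hK, hh⟩ c hbc
      by_cases hcb : c = b
      · subst hcb
        exact ⟨L, hL, hav, hK, hh⟩
      refine ⟨(some c, c) :: (some b, c) :: L, ?_, ⟨fun _ h => ?_, fun _ h => ?_, hav⟩,
        by simp only [List.length_cons]; omega, rfl⟩
      · simp only [directMass, List.headD_cons, hh]
        refine mul_ne_zero (mul_ne_zero hL fun h => ?_) (hself (some b, c))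
        have := h ▸ le_stepMass_out h3 hΔ hcb
        rcases mul_eq_zero.1 (le_antisymm this zero_le) with h' | h'
        · exact stepBound_ne_zero Δ h'
        · rw [ENNReal.div_eq_zero_iff] at h'
          rcases h' with h' | h'
          · have hE : M.E b c = 0 := by exact_mod_cast h'
            simp [Model.Q, hE] at hbc
          · exact ENNReal.natCast_ne_top _ h'
      · have := h.1
        simp only [List.headD_cons, Option.some.injEq] at this
        exact hcb this.symm
      · have := h.2
        rw [hh] at this
        simp only [Prod.mk.injEq] at this
        exact hcb this.2
  obtain ⟨L, hL, hav, hK, hh⟩ := hmem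
  intro h0
  rw [firstWeight, Finset.sum_eq_zero_iff] at h0
  have h1 := h0 r (Finset.mem_univ r)
  rcases mul_eq_zero.1 h1 with h | h
  · exact hr h
  · have h2 := directMass_le_pastMass M (K := K) (S := goodMark) (P := goodMark.at i)
      (q := (some i, i)) (L := L) (p := (none, r)) (by omega) (by
        rw [hh]; exact ⟨⟨rfl, rfl⟩, rfl⟩) hav
    rw [h] at h2
    have h4 := le_antisymm h2 zero_le
    rw [directMass, hh] at h4
    rcases mul_eq_zero.1 h4 with h5 | h5
    · exact hL h5
    · exact hself (some i, i) h5

/-- The node, after which the walk never returns to the parent, has at most one type. -/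
theorem sum_weight_le (M : Model m) (S : Mark m) (p : Pair m) :
    ∑ j, (∑' x, pastMass M 0 S (S.at j) p x) * esc M (some j, j) ≤ esc M p := by
  set D : Fin m → Set (Reservoir m × WalkSeed) := fun j => {z | ∃ x : Node × ℕ,
    Past 0 S (S.at j) p z.1 z.2 x.1 x.2 ∧
      Alive (tp p z.1 x.1) (shift x.1 z.1) (seedShift x.2 z.2)} with hD
  have h1 : ∀ j, (∑' x, pastMass M 0 S (S.at j) p x) * esc M (some j, j) = jointLaw M (D j) :=
    fun j => (jointLaw_exists_past M 0 p (mark_at_eq S j) (fun _ _ h => h.1) (B := Alive)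
      (measurable_alive _) (fun _ _ h => h)).symm
  have hmeas : ∀ j, MeasurableSet (D j) := by
    intro j
    refine measurableSet_setOfPred.2 (Measurable.exists fun x => ?_)
    refine (measurable_past _ _ _ _ _ _).and ?_
    exact measurable_apply_countable
      (f := fun (q : Pair m) (z : Reservoir m × WalkSeed) =>
        Alive q (shift x.1 z.1) (seedShift x.2 z.2))
      (fun q => (measurable_alive q).comp (((measurable_shift x.1).comp measurable_fst).prodMk
        ((measurable_seedShift x.2).comp measurable_snd)))
      ((measurable_tp p x.1).comp measurable_fst)
  simp only [h1]
  rw [← measure_biUnion_finset]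
  · refine measure_mono fun z hz => ?_
    simp only [Set.mem_iUnion] at hz
    obtain ⟨j, -, x, hx, ha⟩ := hz
    exact hx.1.alive ha
  · intro i _ j _ hij
    refine Set.disjoint_left.2 ?_
    rintro z ⟨x, hx, hxa⟩ ⟨y, hy, hya⟩
    have := past_node_unique (s₁ := y.2) (s₂ := x.2) (fun _ _ h => h.1) (fun _ _ h => h.1) hx hy
      (hxa _) (hya _) (by omega) (by omega)
    have hxy : x = y := Prod.ext this.1 this.2
    subst hxy
    have e1 := hx.2.2.1.tp_eq (mark_at_eq S i)
    have e2 := hy.2.2.1.tp_eq (mark_at_eq S j)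
    exact hij (congrArg Prod.snd (e1.symm.trans e2))
  · exact fun j _ => hmeas j

end Bounds

/-! ### Matrix renewal equations with a symmetric Green function. -/

section RenewalAlgebra

variable {S : Type*} [Fintype S] {E q : S → ℝ}

/-- If the Green function of a matrix renewal equation is symmetric, then so is its kernel. -/
theorem renewal_symm [DecidableEq S] {U W : ℕ → Matrix S S ℝ} (hE : ∀ i, 0 < E i)
    (h : ∀ k, U k = W k + ∑ l ∈ Finset.HasAntidiagonal.antidiagonal k, W l.1 * U l.2)
    (hU : ∀ k i j, E i * U k i j = E j * U k j i) (k : ℕ) (i j : S) :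
    E i * W k i j = E j * W k j i := by
  -- The adjoint of `W` with respect to `E`. Symmetry of `U` turns the renewal equation for `W` into
  -- one for `V` with the factors in the opposite order.
  set V : ℕ → Matrix S S ℝ := fun k => Matrix.of fun i j => E j * W k j i / E i with hV
  have h' : ∀ k, U k = V k + ∑ l ∈ Finset.HasAntidiagonal.antidiagonal k, U l.1 * V l.2 := by
    intro k
    ext i j
    have h1 : U k i j = E j / E i * U k j i := by
      have := hU k i j
      have hi := (hE i).ne'
      field_simp
      linarith
    rw [h1, h k]
    simp only [Matrix.add_apply, Matrix.sum_apply, Matrix.mul_apply, mul_add, Finset.mul_sum]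
    congr 1
    · simp only [hV, Matrix.of_apply]
      ring
    · rw [← Finset.Nat.sum_antidiagonal_swap]
      refine Finset.sum_congr rfl fun l _ => Finset.sum_congr rfl fun e _ => ?_
      have h2 := hU l.1 i e
      have hi := (hE i).ne'
      have he := (hE e).ne'
      simp only [hV, Matrix.of_apply, Prod.fst_swap, Prod.snd_swap]
      field_simp
      linear_combination -(E j * W l.2 j e) * h2
  have e1 : (PowerSeries.mk U : PowerSeries (Matrix S S ℝ)) =
      PowerSeries.mk W + PowerSeries.mk W * PowerSeries.mk U := by
    ext1 k
    rw [map_add, PowerSeries.coeff_mul]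
    simp only [PowerSeries.coeff_mk]
    exact h k
  have e2 : (PowerSeries.mk U : PowerSeries (Matrix S S ℝ)) =
      PowerSeries.mk V + PowerSeries.mk U * PowerSeries.mk V := by
    ext1 k
    rw [map_add, PowerSeries.coeff_mul]
    simp only [PowerSeries.coeff_mk]
    exact h' k
  -- `1 - W` is a left inverse and `1 - V` a right inverse of `1 + U`, so they agree.
  have e3 : (1 - PowerSeries.mk W : PowerSeries (Matrix S S ℝ)) = 1 - PowerSeries.mk V := by
    refine left_inv_eq_right_inv (a := 1 + PowerSeries.mk U) ?_ ?_
    · rw [sub_mul, one_mul, mul_add, mul_one, ← e1]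
      abel
    · rw [mul_sub, mul_one, add_mul, one_mul, ← e2]
      abel
  have e4 := congrArg (PowerSeries.coeff k) (sub_right_injective e3)
  simp only [PowerSeries.coeff_mk] at e4
  have e5 := congrFun (congrFun e4 i) j
  simp only [hV, Matrix.of_apply] at e5
  rw [e5]
  have hi := (hE i).ne'
  field_simp

/-- A symmetric renewal kernel whose Green function has an infinite sum is stochastic. -/
theorem renewal_stochastic {U W : ℕ → Matrix S S ℝ} {w : Matrix S S ℝ} {c : ℝ}
    (hE : ∀ i, 0 < E i) (hq : ∀ i, 1 / 2 ≤ q i) (hU0 : ∀ k i j, 0 ≤ U k i j)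
    (hW0 : ∀ k i j, 0 ≤ W k i j)
    (h : ∀ k, U k = W k + ∑ l ∈ Finset.HasAntidiagonal.antidiagonal k, W l.1 * U l.2)
    (hw : ∀ n i j, ∑ k ∈ Finset.range n, W k i j ≤ w i j)
    (hsym : ∀ i j, E i * w i j = E j * w j i) (hle : ∀ i, ∑ j, w i j * q j ≤ q i)
    (hc : 0 < c) (hUc : ∀ k i, c ≤ ∑ j, U (k + 1) i j) (i : S) :
    ∑ j, w i j * q j = q i := by
  have hq0 : ∀ i, 0 ≤ q i := fun i => by linarith [hq i]
  set u : ℕ → S → ℝ := fun n i => ∑ k ∈ Finset.range n, ∑ j, U k i j * q j with hu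
  set s : S → ℝ := fun i => ∑ j, w i j * q j with hs
  have hu0 : ∀ n i, 0 ≤ u n i := fun n i => Finset.sum_nonneg fun k _ =>
    Finset.sum_nonneg fun j _ => mul_nonneg (hU0 k i j) (hq0 j)
  -- A truncated convolution is at most the product of the truncated sums.
  have hstep : ∀ n i, u n i ≤ s i + ∑ e, w i e * u n e := by
    intro n i
    have h1 : u n i = ∑ j, (∑ k ∈ Finset.range n, W k i j) * q j +
        ∑ e, ∑ k ∈ Finset.range n, ∑ l ∈ Finset.HasAntidiagonal.antidiagonal k,
          W l.1 i e * ∑ j, U l.2 e j * q j := by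
      have hk : ∀ k, ∑ j, U k i j * q j = ∑ j, W k i j * q j + ∑ e,
          ∑ l ∈ Finset.HasAntidiagonal.antidiagonal k, W l.1 i e * ∑ j, U l.2 e j * q j := by
        intro k
        have hkj : ∀ j, U k i j * q j = W k i j * q j + ∑ e,
            ∑ l ∈ Finset.HasAntidiagonal.antidiagonal k, W l.1 i e * (U l.2 e j * q j) := by
          intro j
          rw [h k, Matrix.add_apply, add_mul, Matrix.sum_apply, Finset.sum_comm, Finset.sum_mul]
          congr 1
          refine Finset.sum_congr rfl fun l _ => ?_
          rw [Matrix.mul_apply, Finset.sum_mul]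
          exact Finset.sum_congr rfl fun e _ => by ring
        simp only [hkj, Finset.sum_add_distrib, Finset.mul_sum]
        congr 1
        rw [Finset.sum_comm]
        exact Finset.sum_congr rfl fun e _ => Finset.sum_comm
      simp only [hu, hk, Finset.sum_add_distrib]
      congr 1
      · rw [Finset.sum_comm]
        exact Finset.sum_congr rfl fun j _ => (Finset.sum_mul _ _ _).symm
      · exact Finset.sum_comm
    rw [h1]
    refine add_le_add (Finset.sum_le_sum fun j _ => mul_le_mul_of_nonneg_right (hw n i j) (hq0 j))
      (Finset.sum_le_sum fun e _ => ?_)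
    set X : ℕ → ℝ := fun k => ∑ j, U k e j * q j with hX
    have hX0 : ∀ k, 0 ≤ X k := fun k => Finset.sum_nonneg fun j _ => mul_nonneg (hU0 k e j) (hq0 j)
    calc ∑ k ∈ Finset.range n, ∑ l ∈ Finset.HasAntidiagonal.antidiagonal k, W l.1 i e * X l.2
        = ∑ k ∈ Finset.range n, ∑ a ∈ Finset.range (k + 1), W a i e * X (k - a) :=
          Finset.sum_congr rfl fun k _ =>
            Finset.Nat.sum_antidiagonal_eq_sum_range_succ (fun a b => W a i e * X b) k
      _ = ∑ a ∈ Finset.range n, ∑ b ∈ Finset.range (n - a), W a i e * X b :=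
          Finset.sum_range_diag_flip n fun a b => W a i e * X b
      _ ≤ ∑ a ∈ Finset.range n, ∑ b ∈ Finset.range n, W a i e * X b :=
          Finset.sum_le_sum fun a _ => Finset.sum_le_sum_of_subset_of_nonneg
            (fun b hb => Finset.mem_range.2 (by have := Finset.mem_range.1 hb; omega))
            fun b _ _ => mul_nonneg (hW0 a i e) (hX0 b)
      _ = (∑ a ∈ Finset.range n, W a i e) * u n e := by rw [Finset.sum_mul_sum]
      _ ≤ w i e * u n e := mul_le_mul_of_nonneg_right (hw n i e) (hu0 n e)
  -- Against the weights `E q`, symmetry moves `w` from `u` to `q`, and what remains is the defect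
  -- `q - s` times `u`, bounded uniformly in `n`. As `u` grows linearly, the defect vanishes.
  have hbound : ∀ n, ∑ i, E i * (q i - s i) * u n i ≤ ∑ i, E i * q i * s i := by
    intro n
    have h1 : ∑ i, E i * q i * u n i ≤ ∑ i, E i * q i * (s i + ∑ e, w i e * u n e) :=
      Finset.sum_le_sum fun i _ =>
        mul_le_mul_of_nonneg_left (hstep n i) (mul_nonneg (hE i).le (hq0 i))
    have h2 : ∑ i, E i * q i * ∑ e, w i e * u n e = ∑ e, E e * s e * u n e := by
      simp only [Finset.mul_sum]
      rw [Finset.sum_comm]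
      refine Finset.sum_congr rfl fun e _ => ?_
      generalize u n e = y
      rw [show s e = ∑ j, w e j * q j from rfl, Finset.mul_sum, Finset.sum_mul]
      refine Finset.sum_congr rfl fun i _ => ?_
      linear_combination q i * y * hsym i e
    simp only [mul_add, Finset.sum_add_distrib, h2] at h1
    simp only [mul_sub, sub_mul, Finset.sum_sub_distrib]
    linarith
  have hlow : ∀ n, n * (c / 2) ≤ u (n + 1) i := by
    intro n
    rw [hu]
    simp only
    rw [Finset.sum_range_succ']
    have h0 : 0 ≤ ∑ j, U 0 i j * q j :=
      Finset.sum_nonneg fun j _ => mul_nonneg (hU0 0 i j) (hq0 j)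
    have h1 : ∑ _k ∈ Finset.range n, c / 2 ≤ ∑ k ∈ Finset.range n, ∑ j, U (k + 1) i j * q j := by
      refine Finset.sum_le_sum fun k _ => ?_
      calc c / 2 ≤ (∑ j, U (k + 1) i j) * (1 / 2) := by linarith [hUc k i]
        _ = ∑ j, U (k + 1) i j * (1 / 2) := Finset.sum_mul _ _ _
        _ ≤ _ := Finset.sum_le_sum fun j _ => mul_le_mul_of_nonneg_left (hq j) (hU0 _ _ _)
    rw [Finset.sum_const, Finset.card_range, nsmul_eq_mul] at h1
    linarith
  refine le_antisymm (hle i) ?_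
  by_contra hlt
  have hpos : 0 < E i * (q i - s i) * (c / 2) :=
    mul_pos (mul_pos (hE i) (by simp only [hs]; linarith [not_le.1 hlt])) (by linarith)
  obtain ⟨n, hn⟩ := exists_nat_gt ((∑ i, E i * q i * s i) / (E i * (q i - s i) * (c / 2)))
  rw [div_lt_iff₀ hpos] at hn
  have h1 := hbound (n + 1)
  have h2 := Finset.single_le_sum (f := fun i => E i * (q i - s i) * u (n + 1) i)
    (fun j _ => mul_nonneg (mul_nonneg (hE j).le (by simp only [hs]; linarith [hle j])) (hu0 _ j))
    (Finset.mem_univ i)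
  have h4 := mul_le_mul_of_nonneg_left (hlow n) (mul_pos (hE i)
    (by simp only [hs]; linarith [not_le.1 hlt] : 0 < q i - s i)).le
  nlinarith

/-- The chain watched at the points of the first kind: it is stochastic and has an invariant
distribution that is bounded from below. -/
theorem exists_invariant_of_watched [Nonempty S] {g b G : Matrix S S ℝ} {c : ℝ}
    (hE : ∀ i, 0 < E i) (hq : ∀ i, 1 / 2 ≤ q i) (hq1 : ∀ i, q i ≤ 1) (hg0 : ∀ i j, 0 ≤ g i j)
    (hb0 : ∀ i j, 0 ≤ b i j)
    (hG : ∀ i j, G i j = g i j + ∑ e, b i e * G e j)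
    (hsym : ∀ i j, E i * (g i j + b i j) = E j * (g j i + b j i))
    (hw : ∀ i, ∑ j, (g i j + b i j) * q j = q i) (hGle : ∀ i, ∑ j, G i j * q j ≤ q i)
    (hc : 0 < c) (hgc : ∀ i, c ≤ g i i) :
    (∀ i, ∑ j, G i j * q j / q i = 1) ∧
      ∃ π : S → ℝ, (∀ i, 0 ≤ π i) ∧ ∑ i, π i = 1 ∧
        (∀ j, ∑ i, π i * (G i j * q j / q i) = π j) ∧ ∀ j, c / 4 * (E j / ∑ i, E i) ≤ π j := by
  have hq0 : ∀ i, 0 < q i := fun i => by linarith [hq i]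
  constructor
  · intro i₀
    -- The relative defect satisfies `q d = b (q d)`. Since `g` takes at least the fraction `c` of
    -- the mass, `b` is strictly substochastic relative to `q`, and the maximum principle gives `d ≤
    -- 0`.
    set d : S → ℝ := fun i => 1 - (∑ j, G i j * q j) / q i with hd
    have hqd : ∀ i, q i * d i = q i - ∑ j, G i j * q j := by
      intro i
      have := (hq0 i).ne'
      simp only [hd]
      field_simp
    have hdrec : ∀ i, q i * d i = ∑ e, b i e * (q e * d e) := by
      intro i
      have h1 : ∑ j, G i j * q j = ∑ j, g i j * q j + ∑ e, b i e * ∑ j, G e j * q j := by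
        have : ∀ j, G i j * q j = g i j * q j + ∑ e, b i e * (G e j * q j) := fun j => by
          rw [hG i j, add_mul, Finset.sum_mul]
          congr 1
          exact Finset.sum_congr rfl fun e _ => by ring
        simp only [this, Finset.sum_add_distrib, Finset.mul_sum]
        congr 1
        exact Finset.sum_comm
      have h2 := hw i
      simp only [add_mul, Finset.sum_add_distrib] at h2
      simp only [hqd, mul_sub, Finset.sum_sub_distrib]
      linarith
    obtain ⟨x, hx⟩ := Finite.exists_max d
    have hdx : d x ≤ 0 := by
      have h1 : q x * d x ≤ d x * ∑ e, b x e * q e := by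
        rw [hdrec x, Finset.mul_sum]
        refine Finset.sum_le_sum fun e _ => ?_
        have := mul_le_mul_of_nonneg_left (hx e) (mul_nonneg (hb0 x e) (hq0 e).le)
        linarith
      have h2 := hw x
      simp only [add_mul, Finset.sum_add_distrib] at h2
      have h4 : c * q x ≤ ∑ j, g x j * q j :=
        (mul_le_mul_of_nonneg_right (hgc x) (hq0 x).le).trans
          (Finset.single_le_sum (f := fun j => g x j * q j)
            (fun j _ => mul_nonneg (hg0 x j) (hq0 j).le) (Finset.mem_univ x))
      by_contra hpos
      have hpos := not_le.1 hpos
      have h5 : ∑ e, b x e * q e ≤ q x - c * q x := by linarith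
      have h6 := mul_le_mul_of_nonneg_left h5 hpos.le
      have h7 : 0 < d x * (c * q x) := mul_pos hpos (mul_pos hc (hq0 x))
      nlinarith
    have h0 : d i₀ = 0 := by
      refine le_antisymm ((hx i₀).trans hdx) ?_
      simp only [hd]
      rw [sub_nonneg, div_le_one (hq0 i₀)]
      exact hGle i₀
    simp only [hd] at h0
    rw [← Finset.sum_div]
    linarith
  -- By symmetry `E q` is invariant under `g + b`; `a` is its flow through the `g`-transitions,
  -- which the watched kernel `G` preserves.
  · set a : S → ℝ := fun j => ∑ i, E i * q i * g i j with ha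
    set β : S → ℝ := fun j => ∑ i, E i * q i * b i j with hβ
    have ha0 : ∀ j, 0 ≤ a j := fun j => Finset.sum_nonneg fun i _ =>
      mul_nonneg (mul_pos (hE i) (hq0 i)).le (hg0 i j)
    have hβ0 : ∀ j, 0 ≤ β j := fun j => Finset.sum_nonneg fun i _ =>
      mul_nonneg (mul_pos (hE i) (hq0 i)).le (hb0 i j)
    have hab : ∀ j, a j + β j = E j * q j := by
      intro j
      rw [ha, hβ, ← hw j, Finset.mul_sum, ← Finset.sum_add_distrib]
      refine Finset.sum_congr rfl fun i _ => ?_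
      linear_combination q i * hsym i j
    have hinv : ∀ k, ∑ j, a j * G j k = a k := by
      intro k
      have h1 : ∀ j, a j * G j k = E j * q j * G j k - β j * G j k := fun j => by
        rw [← hab j]; ring
      have h2 : ∑ j, β j * G j k = ∑ i, E i * q i * ∑ e, b i e * G e k := by
        simp only [hβ, Finset.sum_mul, Finset.mul_sum]
        rw [Finset.sum_comm]
        exact Finset.sum_congr rfl fun i _ => Finset.sum_congr rfl fun e _ => by ring
      simp only [h1, Finset.sum_sub_distrib]
      rw [h2, ← Finset.sum_sub_distrib, ha]
      refine Finset.sum_congr rfl fun i _ => ?_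
      rw [hG i k]
      ring
    -- Only the diagonal term of `g` is kept; `1/4` comes from two factors `q j ≥ 1/2`.
    have hlow : ∀ j, c / 4 * E j ≤ a j * q j := by
      intro j
      have h1 : E j * q j * c ≤ a j :=
        (mul_le_mul_of_nonneg_left (hgc j) (mul_pos (hE j) (hq0 j)).le).trans
          (Finset.single_le_sum (f := fun i => E i * q i * g i j)
            (fun i _ => mul_nonneg (mul_pos (hE i) (hq0 i)).le (hg0 i j)) (Finset.mem_univ j))
      have h2 : (1 : ℝ) / 4 ≤ q j * q j := by nlinarith [hq j]
      have h4 := mul_le_mul_of_nonneg_right h1 (hq0 j).le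
      have h5 := mul_le_mul_of_nonneg_left h2 (mul_pos (hE j) hc).le
      nlinarith
    have hup : ∀ j, a j * q j ≤ E j := by
      intro j
      have h1 : a j ≤ E j * q j := by linarith [hab j, hβ0 j]
      have h2 := mul_le_mul h1 (hq1 j) (hq0 j).le (mul_pos (hE j) (hq0 j)).le
      have h4 := mul_le_mul_of_nonneg_left (hq1 j) (hE j).le
      linarith
    set Z := ∑ j, a j * q j with hZ
    have hZle : Z ≤ ∑ i, E i := Finset.sum_le_sum fun j _ => hup j
    have hZ0 : 0 < Z := by
      refine lt_of_lt_of_le ?_ (Finset.sum_le_sum fun j _ => hlow j)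
      exact Finset.sum_pos (fun j _ => mul_pos (by linarith) (hE j)) Finset.univ_nonempty
    refine ⟨fun j => a j * q j / Z, fun j => div_nonneg (mul_nonneg (ha0 j) (hq0 j).le) hZ0.le,
      ?_, ?_, ?_⟩
    · rw [← Finset.sum_div, div_self hZ0.ne']
    · intro k
      simp only
      rw [← hinv k, Finset.sum_mul, Finset.sum_div]
      refine Finset.sum_congr rfl fun j _ => ?_
      have := (hq0 j).ne'
      field_simp
    · intro j
      rw [mul_div_assoc']
      have hs : 0 < ∑ i, E i := lt_of_lt_of_le hZ0 hZle
      calc c / 4 * E j / ∑ i, E i ≤ c / 4 * E j / Z :=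
            div_le_div_of_nonneg_left (mul_pos (by linarith) (hE j)).le hZ0 hZle
        _ ≤ a j * q j / Z := div_le_div_of_nonneg_right (hlow j) hZ0.le

end RenewalAlgebra

/-! ### The reversible chain of the nodes that share the type of their parent. -/

section TypesChain

variable {m : ℕ} {M : Model m} {Δ : ℕ}

/-- Summed over nodes and times, the convolution in `pastMass_decomp` becomes a matrix product. -/
theorem tsum_pastMass_decomp (M : Model m) {S R P : Mark m} (hSR : ∀ x y, S x y → R x y)
    (hR : ∀ x y, R x y → y.1 = some y.2) (p : Pair m) :
    ∑' z, pastMass M 0 S P p z = ∑' z, pastMass M 0 R P p z +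
      ∑ e, (∑' x, pastMass M 0 R (Mark.at (fun x y => R x y ∧ ¬ S x y) e) p x) *
        ∑' y, pastMass M 0 S P (some e, e) y := by
  classical
  simp only [pastMass_decomp M hSR hR p (P := P)]
  rw [ENNReal.tsum_add]
  congr 1
  rw [ENNReal.tsum_comm]
  simp only [← ENNReal.tsum_mul_right]
  simp only [← ENNReal.tsum_mul_left]
  rw [← Summable.tsum_finsetSum fun i _ => ENNReal.summable]
  refine tsum_congr fun x => ?_
  rw [ENNReal.tsum_comm, ← Summable.tsum_finsetSum fun i _ => ENNReal.summable]
  refine tsum_congr fun y => ?_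
  rw [tsum_eq_single (comb x y)]
  · simp
  · intro z hz
    simp [hz.symm]

theorem pastMass_split (M : Model m) (K : ℕ) (S P R : Mark m) (p : Pair m) (x : Node × ℕ) :
    pastMass M K S P p x = pastMass M K S (fun a b => P a b ∧ R a b) p x +
      pastMass M K S (fun a b => P a b ∧ ¬ R a b) p x := by
  rw [pastMass, pastMass, pastMass, ← measure_union]
  · congr 1
    ext z
    obtain ⟨v, t⟩ := x
    cases v with
    | nil => simp [Past]
    | cons k u =>
      simp only [Past, Marked, Set.mem_union, Set.mem_ofPred_eq]
      tauto
  · refine Set.disjoint_left.2 fun z h h' => ?_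
    obtain ⟨v, t⟩ := x
    cases v with
    | nil => exact h.2.2.1
    | cons k u => exact h'.2.2.1.2 h.2.2.1.2
  · exact measurableSet_setOfPred.2 (measurable_past _ _ _ _ _ _)

theorem esc_le_one (M : Model m) (p : Pair m) : esc M p ≤ 1 := prob_le_one

theorem half_le_toReal_esc (h3 : ∀ i v, 3 ≤ M.degInt i v) (hΔ : ∀ i v, M.deg i v ≤ Δ)
    (i : Fin m) : 1 / 2 ≤ (esc M (some i, i)).toReal := by
  have := ENNReal.toReal_mono (ne_top_of_le_ne_top ENNReal.one_ne_top (esc_le_one M (some i, i)))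
    (half_le_esc h3 hΔ (p := (some i, i)) (by simp))
  simpa using this

theorem toReal_esc_le_one (M : Model m) (p : Pair m) : (esc M p).toReal ≤ 1 := by
  rw [← ENNReal.toReal_one]
  exact ENNReal.toReal_mono ENNReal.one_ne_top (esc_le_one M p)

/-- The masses times the escape probabilities sum to at most one, and each escape probability is at
least `1/2`. -/
theorem tsum_pastMass_ne_top (h3 : ∀ i v, 3 ≤ M.degInt i v) (hΔ : ∀ i v, M.deg i v ≤ Δ)
    (S : Mark m) (p : Pair m) (j : Fin m) : ∑' x, pastMass M 0 S (S.at j) p x ≠ ⊤ := by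
  intro h
  have h1 := (Finset.single_le_sum (f := fun j => (∑' x, pastMass M 0 S (S.at j) p x) *
    esc M (some j, j)) (fun _ _ => zero_le) (Finset.mem_univ j)).trans
    ((sum_weight_le M S p).trans (esc_le_one M p))
  simp only [h] at h1
  rw [ENNReal.top_mul] at h1
  · simp at h1
  · intro h0
    have := h0 ▸ half_le_esc h3 hΔ (p := (some j, j)) (by simp)
    simp at this

theorem sum_toReal_weight_le (h3 : ∀ i v, 3 ≤ M.degInt i v) (hΔ : ∀ i v, M.deg i v ≤ Δ)
    (S : Mark m) (i : Fin m) :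
    ∑ j, (∑' x, pastMass M 0 S (S.at j) (some i, i) x).toReal * (esc M (some j, j)).toReal ≤
      (esc M (some i, i)).toReal := by
  have hq : ∀ j, esc M (some j, j) ≠ ⊤ := fun j =>
    ne_top_of_le_ne_top ENNReal.one_ne_top (esc_le_one M _)
  have := ENNReal.toReal_mono (hq i) (sum_weight_le M S (some i, i))
  rw [ENNReal.toReal_sum fun j _ => ENNReal.mul_ne_top (tsum_pastMass_ne_top h3 hΔ S _ j) (hq j)]
    at this
  simpa only [ENNReal.toReal_mul] using this

/-- The masses of the nodes that have the type of their parent, as real matrices. -/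
theorem mass_renewal (h3 : ∀ i v, 3 ≤ M.degInt i v) (hΔ : ∀ i v, M.deg i v ≤ Δ) :
    (∀ k i j, mass M (fun _ _ => False) (sgMark.at j) (some i, i) k ≠ ⊤) ∧
    (∀ k i j, mass M sgMark (sgMark.at j) (some i, i) k ≠ ⊤) ∧
    ∀ k i j, mass M (fun _ _ => False) (sgMark.at j) (some i, i) k =
      mass M sgMark (sgMark.at j) (some i, i) k +
        ∑ l ∈ Finset.HasAntidiagonal.antidiagonal k, ∑ e,
          mass M sgMark (sgMark.at e) (some i, i) l.1 *
            mass M (fun _ _ => False) (sgMark.at j) (some e, e) l.2 := by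
  have hW : ∀ k i j, mass M sgMark (sgMark.at j) (some i, i) k ≠ ⊤ := by
    intro k i j
    refine ne_top_of_le_ne_top (tsum_pastMass_ne_top h3 hΔ sgMark (some i, i) j) ?_
    rw [tsum_pastMass]
    exact ENNReal.le_tsum k
  have hdec : ∀ k i j, mass M (fun _ _ => False) (sgMark.at j) (some i, i) k =
      mass M sgMark (sgMark.at j) (some i, i) k +
        ∑ l ∈ Finset.HasAntidiagonal.antidiagonal k, ∑ e,
          mass M sgMark (sgMark.at e) (some i, i) l.1 *
            mass M (fun _ _ => False) (sgMark.at j) (some e, e) l.2 := by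
    intro k i j
    have h := mass_decomp M (S := fun _ _ => False) (R := sgMark) (P := sgMark.at j)
      (fun _ _ h => h.elim) (fun _ _ h => h) (some i, i) k
    simpa only [not_false_eq_true, and_true] using h
  -- Level zero of the kernel vanishes, so the renewal equation expresses the Green function through
  -- strictly lower levels and finiteness follows by induction.
  refine ⟨fun k => ?_, hW, hdec⟩
  induction k using Nat.strong_induction_on with
  | _ k ih =>
    intro i j
    rw [hdec]
    refine ENNReal.add_ne_top.2 ⟨hW k i j, ENNReal.sum_ne_top.2 fun l hl =>
      ENNReal.sum_ne_top.2 fun e _ => ?_⟩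
    rw [Finset.HasAntidiagonal.mem_antidiagonal] at hl
    rcases Nat.eq_zero_or_pos l.1 with h0 | h0
    · rw [h0, mass_zero, zero_mul]
      exact ENNReal.zero_ne_top
    · exact ENNReal.mul_ne_top (hW _ _ _) (ih l.2 (by omega) e j)

/-- The chain of the types of the nodes, with the type of their parent, after which the walk never
returns to the parent: its weights are symmetric, and it is stochastic. -/
theorem sgWeight_spec (h3 : ∀ i v, 3 ≤ M.degInt i v) (hΔ : ∀ i v, M.deg i v ≤ Δ) :
    (∀ i j, (M.E i i : ℝ) * (∑' x, pastMass M 0 sgMark (sgMark.at j) (some i, i) x).toReal =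
      M.E j j * (∑' x, pastMass M 0 sgMark (sgMark.at i) (some j, j) x).toReal) ∧
    ∀ i, ∑ j, (∑' x, pastMass M 0 sgMark (sgMark.at j) (some i, i) x).toReal *
      (esc M (some j, j)).toReal = (esc M (some i, i)).toReal := by
  obtain ⟨hUf, hWf, hdec⟩ := mass_renewal h3 hΔ
  set U : ℕ → Matrix (Fin m) (Fin m) ℝ := fun k => Matrix.of fun i j =>
    (mass M (fun _ _ => False) (sgMark.at j) (some i, i) k).toReal with hU
  set W : ℕ → Matrix (Fin m) (Fin m) ℝ := fun k => Matrix.of fun i j =>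
    (mass M sgMark (sgMark.at j) (some i, i) k).toReal with hW
  have hE : ∀ i, (0 : ℝ) < M.E i i := fun i => by
    exact_mod_cast Nat.pos_of_ne_zero (E_self_ne_zero h3 i)
  have hren : ∀ k, U k = W k + ∑ l ∈ Finset.HasAntidiagonal.antidiagonal k, W l.1 * U l.2 := by
    intro k
    ext i j
    simp only [Matrix.add_apply, Matrix.sum_apply, Matrix.mul_apply, hU, hW, Matrix.of_apply]
    have hf : ∀ l ∈ Finset.HasAntidiagonal.antidiagonal k, ∀ e ∈ (Finset.univ : Finset (Fin m)),
        mass M sgMark (sgMark.at e) (some i, i) l.1 *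
          mass M (fun _ _ => False) (sgMark.at j) (some e, e) l.2 ≠ ⊤ := fun l _ e _ =>
      ENNReal.mul_ne_top (hWf _ _ _) (hUf _ _ _)
    rw [hdec, ENNReal.toReal_add (hWf _ _ _) (ENNReal.sum_ne_top.2 fun l hl =>
      ENNReal.sum_ne_top.2 (hf l hl)), ENNReal.toReal_sum fun l hl => ENNReal.sum_ne_top.2 (hf l hl)]
    congr 1
    refine Finset.sum_congr rfl fun l hl => ?_
    rw [ENNReal.toReal_sum (hf l hl)]
    simp only [ENNReal.toReal_mul]
  have hUsym : ∀ k i j, (M.E i i : ℝ) * U k i j = M.E j j * U k j i := by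
    intro k i j
    have h := congrArg ENNReal.toReal (mass_bot_symm (E_self_ne_zero h3) k i j)
    rw [ENNReal.toReal_mul, ENNReal.toReal_mul, ENNReal.toReal_natCast, ENNReal.toReal_natCast] at h
    exact h
  have hWsym := renewal_symm (E := fun i => (M.E i i : ℝ)) hE hren hUsym
  have hWsum : ∀ i j, HasSum (fun k => W k i j)
      (∑' x, pastMass M 0 sgMark (sgMark.at j) (some i, i) x).toReal := by
    intro i j
    rw [tsum_pastMass]
    have hne : ∑' k, mass M sgMark (sgMark.at j) (some i, i) k ≠ ⊤ := by
      rw [← tsum_pastMass]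
      exact tsum_pastMass_ne_top h3 hΔ sgMark _ j
    rw [ENNReal.tsum_toReal_eq fun k => hWf k i j]
    exact (ENNReal.summable_toReal hne).hasSum
  have hsym : ∀ i j, (M.E i i : ℝ) *
      (∑' x, pastMass M 0 sgMark (sgMark.at j) (some i, i) x).toReal =
      M.E j j * (∑' x, pastMass M 0 sgMark (sgMark.at i) (some j, j) x).toReal := fun i j =>
    ((hWsum i j).mul_left (M.E i i : ℝ)).unique
      (((hWsum j i).mul_left (M.E j j : ℝ)).congr_fun fun k => hWsym k i j)
  refine ⟨hsym, ?_⟩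
  have hW0 : ∀ k i j, 0 ≤ W k i j := fun k i j => ENNReal.toReal_nonneg
  refine renewal_stochastic (E := fun i => (M.E i i : ℝ)) (U := U) (W := W)
    (w := Matrix.of fun i j => (∑' x, pastMass M 0 sgMark (sgMark.at j) (some i, i) x).toReal)
    (q := fun i => (esc M (some i, i)).toReal) (c := (stepBound Δ * 2⁻¹).toReal) hE
    (half_le_toReal_esc h3 hΔ) (fun k i j => ENNReal.toReal_nonneg) hW0 hren
    (fun n i j => sum_le_hasSum _ (fun k _ => hW0 k i j) (hWsum i j)) hsym
    (sum_toReal_weight_le h3 hΔ sgMark) ?_ ?_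
  · refine ENNReal.toReal_pos ?_ ?_
    · exact mul_ne_zero (stepBound_ne_zero Δ) (by simp)
    · simp [stepBound, ENNReal.mul_eq_top]
  · intro k i
    have h := ENNReal.toReal_mono (ENNReal.sum_ne_top.2 fun j _ => hUf (k + 1) i j)
      (le_sum_mass_bot h3 hΔ i k)
    rwa [ENNReal.toReal_sum fun j _ => hUf (k + 1) i j] at h

end TypesChain

/-! ### The types chain as a watched chain, and the constants. -/

section Main

variable {m : ℕ} {M : Model m} {Δ : ℕ}

theorem tsum_pastMass_sg_split (M : Model m) (p : Pair m) (j : Fin m) :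
    ∑' x, pastMass M 0 sgMark (sgMark.at j) p x =
      ∑' x, pastMass M 0 sgMark (goodMark.at j) p x +
        ∑' x, pastMass M 0 sgMark (Mark.at (fun x y => sgMark x y ∧ ¬ goodMark x y) j) p x := by
  have h1 : (fun a b => sgMark.at j a b ∧ goodMark a b) = (goodMark.at j : Mark m) := by
    funext a b
    refine propext ⟨fun h => ⟨h.2, h.1.2⟩, fun h => ⟨⟨sgMark_of_goodMark _ _ h.1, h.2⟩, h.1⟩⟩
  have h2 : (fun a b => sgMark.at j a b ∧ ¬ goodMark a b) =
      (Mark.at (fun x y => sgMark x y ∧ ¬ goodMark x y) j : Mark m) := by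
    funext a b
    exact propext ⟨fun h => ⟨⟨h.1.1, h.2⟩, h.1.2⟩, fun h => ⟨⟨h.1.1, h.2⟩, h.1.2⟩⟩
  rw [← ENNReal.tsum_add]
  refine tsum_congr fun x => ?_
  rw [pastMass_split M 0 sgMark (sgMark.at j) goodMark, h1, h2]

theorem stepBound_ne_top (Δ : ℕ) : stepBound Δ ≠ ⊤ := by
  simp [stepBound, ENNReal.mul_eq_top]

theorem toReal_stepBound_pos (Δ : ℕ) : 0 < (stepBound Δ).toReal :=
  ENNReal.toReal_pos (stepBound_ne_zero Δ) (stepBound_ne_top Δ)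

theorem toReal_stepBound_le_one (Δ : ℕ) : (stepBound Δ).toReal ≤ 1 := by
  rw [← ENNReal.toReal_one]
  refine ENNReal.toReal_mono ENNReal.one_ne_top ?_
  rw [stepBound]
  refine mul_le_one' ?_ ?_
  · simp
  · rw [ENNReal.inv_le_one]
    simp

/-- The finer chain is split by whether the grandparent also shares the type. The decomposition at
the first node that shares its parent's type gives `G = g + b * G`, so the abstract lemma on watched
chains applies with weights `E i i`. -/
theorem typesChain_spec [Nonempty (Fin m)] (h3 : ∀ i v, 3 ≤ M.degInt i v)
    (hΔ : ∀ i v, M.deg i v ≤ Δ) (hQ : M.Q.IsIrreducible) (ν : PMF (Fin m)) (K : ℕ) :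
    typesChain M ν K ∈ Matrix.rowStochastic ℝ (Fin m) ∧
    ∃ π : Fin m → ℝ, IsInvariantDistribution (typesChain M ν K) π ∧
      ∀ j, (stepBound Δ).toReal / 4 * (M.E j j / ∑ i, (M.E i i : ℝ)) ≤ π j := by
  set q : Fin m → ℝ := fun i => (esc M (some i, i)).toReal with hq
  have hqh : ∀ i, 1 / 2 ≤ q i := half_le_toReal_esc h3 hΔ
  set g : Matrix (Fin m) (Fin m) ℝ := Matrix.of fun i j =>
    (∑' x, pastMass M 0 sgMark (goodMark.at j) (some i, i) x).toReal with hg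
  set b : Matrix (Fin m) (Fin m) ℝ := Matrix.of fun i j => (∑' x, pastMass M 0 sgMark
    (Mark.at (fun x y => sgMark x y ∧ ¬ goodMark x y) j) (some i, i) x).toReal with hb
  set G : Matrix (Fin m) (Fin m) ℝ := Matrix.of fun i j => (goodWeight M i j).toReal with hG
  have hGf : ∀ i j, goodWeight M i j ≠ ⊤ := fun i j =>
    tsum_pastMass_ne_top h3 hΔ goodMark (some i, i) j
  have hgf : ∀ i j, ∑' x, pastMass M 0 sgMark (goodMark.at j) (some i, i) x ≠ ⊤ := fun i j =>
    ne_top_of_le_ne_top (tsum_pastMass_ne_top h3 hΔ sgMark (some i, i) j)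
      (by rw [tsum_pastMass_sg_split]; exact le_self_add)
  have hbf : ∀ i j, ∑' x, pastMass M 0 sgMark
      (Mark.at (fun x y => sgMark x y ∧ ¬ goodMark x y) j) (some i, i) x ≠ ⊤ := fun i j =>
    ne_top_of_le_ne_top (tsum_pastMass_ne_top h3 hΔ sgMark (some i, i) j)
      (by rw [tsum_pastMass_sg_split]; exact le_add_self)
  have hgb : ∀ i j, (∑' x, pastMass M 0 sgMark (sgMark.at j) (some i, i) x).toReal =
      g i j + b i j := by
    intro i j
    rw [tsum_pastMass_sg_split, ENNReal.toReal_add (hgf i j) (hbf i j)]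
    rfl
  have hGdec : ∀ i j, G i j = g i j + ∑ e, b i e * G e j := by
    intro i j
    have h : goodWeight M i j = ∑' x, pastMass M 0 sgMark (goodMark.at j) (some i, i) x +
        ∑ e, (∑' x, pastMass M 0 sgMark
          (Mark.at (fun x y => sgMark x y ∧ ¬ goodMark x y) e) (some i, i) x) * goodWeight M e j :=
      tsum_pastMass_decomp M sgMark_of_goodMark (fun _ _ h => h) (some i, i)
    have hf : ∀ e ∈ (Finset.univ : Finset (Fin m)), (∑' x, pastMass M 0 sgMark
        (Mark.at (fun x y => sgMark x y ∧ ¬ goodMark x y) e) (some i, i) x) *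
          goodWeight M e j ≠ ⊤ := fun e _ => ENNReal.mul_ne_top (hbf i e) (hGf e j)
    have h' := congrArg ENNReal.toReal h
    rw [ENNReal.toReal_add (hgf i j) (ENNReal.sum_ne_top.2 hf), ENNReal.toReal_sum hf] at h'
    simp only [ENNReal.toReal_mul] at h'
    exact h'
  obtain ⟨hsym, hrow⟩ := sgWeight_spec h3 hΔ
  simp only [hgb] at hsym hrow
  have hE : ∀ i, (0 : ℝ) < M.E i i := fun i => by
    exact_mod_cast Nat.pos_of_ne_zero (E_self_ne_zero h3 i)
  -- The root already carries the pair `(i,i)`, so its first child is a good node reached in one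
  -- step.
  have hgc : ∀ i, (stepBound Δ).toReal ≤ g i i := by
    intro i
    refine ENNReal.toReal_mono (hgf i i) ((le_stepMass_self h3 hΔ (some i, i)).trans ?_)
    refine le_trans ?_ (directMass_le_pastMass M (L := []) (q := (some i, i)) (by simp)
      ⟨⟨rfl, rfl⟩, rfl⟩ trivial)
    simp [directMass]
  have hchain : ∀ i j, typesChain M ν K i j = G i j * q j / q i := by
    intro i j
    rw [typesChain_eq M ν K i j (firstWeight_ne_zero h3 hΔ hQ ν K i), ENNReal.toReal_mul]
    · rfl
    · intro h0
      have := hqh i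
      rw [hq] at this
      simp only [h0, ENNReal.toReal_zero] at this
      norm_num at this
  obtain ⟨hst, π, hπ0, hπ1, hπ2, hπ3⟩ := exists_invariant_of_watched
    (E := fun i => (M.E i i : ℝ)) (q := q) (g := g) (b := b) (G := G) hE hqh
    (fun i => toReal_esc_le_one M _) (fun i j => ENNReal.toReal_nonneg)
    (fun i j => ENNReal.toReal_nonneg) hGdec hsym hrow (sum_toReal_weight_le h3 hΔ goodMark)
    (toReal_stepBound_pos Δ) hgc
  refine ⟨?_, π, ⟨hπ0, hπ1, fun j => ?_⟩, hπ3⟩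
  · rw [Matrix.mem_rowStochastic_iff_sum]
    refine ⟨fun i j => ?_, fun i => ?_⟩
    · rw [hchain]
      exact div_nonneg (mul_nonneg ENNReal.toReal_nonneg ENNReal.toReal_nonneg)
        ENNReal.toReal_nonneg
    · simp only [hchain]
      exact hst i
  · simp only [hchain]
    exact hπ2 j

/-- The ratio of two escape probabilities is at least `1/2`. -/
theorem goodWeight_le_typesChain (h3 : ∀ i v, 3 ≤ M.degInt i v)
    (hΔ : ∀ i v, M.deg i v ≤ Δ) (hQ : M.Q.IsIrreducible) (ν : PMF (Fin m)) (K : ℕ)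
    (i j : Fin m) : (goodWeight M i j).toReal / 2 ≤ typesChain M ν K i j := by
  have hi := half_le_toReal_esc h3 hΔ i
  have hj := half_le_toReal_esc h3 hΔ j
  have hi1 := toReal_esc_le_one M (some i, i)
  rw [typesChain_eq M ν K i j (firstWeight_ne_zero h3 hΔ hQ ν K i), ENNReal.toReal_mul]
  · have hG : 0 ≤ (goodWeight M i j).toReal := ENNReal.toReal_nonneg
    rw [le_div_iff₀ (by linarith)]
    nlinarith [mul_le_mul_of_nonneg_left hj hG, mul_le_mul_of_nonneg_left hi1 hG]
  · intro h0
    rw [h0] at hi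
    norm_num at hi

/-- The types chain dominates a multiple of the chain `Q` on the communities. -/
theorem typesChain_dominates (h3 : ∀ i v, 3 ≤ M.degInt i v)
    (hΔ : ∀ i v, M.deg i v ≤ Δ) (hQ : M.Q.IsIrreducible) (ν : PMF (Fin m)) (K : ℕ) :
    (∀ i, (stepBound Δ).toReal / 2 ≤ typesChain M ν K i i) ∧
      ∀ i j, (stepBound Δ).toReal ^ 3 / 2 * M.Q i j ≤ typesChain M ν K i j := by
  have hc0 := toReal_stepBound_pos Δ
  have hc1 := toReal_stepBound_le_one Δ
  have hGf : ∀ i j, goodWeight M i j ≠ ⊤ := fun i j =>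
    tsum_pastMass_ne_top h3 hΔ goodMark (some i, i) j
  have hdiag : ∀ i, (stepBound Δ).toReal / 2 ≤ typesChain M ν K i i := by
    intro i
    refine le_trans ?_ (goodWeight_le_typesChain h3 hΔ hQ ν K i i)
    have := ENNReal.toReal_mono (hGf i i) (stepBound_le_goodWeight h3 hΔ i)
    linarith
  refine ⟨hdiag, fun i j => ?_⟩
  have hE : (0 : ℝ) < M.E i i := by exact_mod_cast Nat.pos_of_ne_zero (E_self_ne_zero h3 i)
  have hD : (M.E i i : ℝ) ≤ ∑ l, (M.E i l : ℝ) :=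
    Finset.single_le_sum (f := fun l => (M.E i l : ℝ)) (fun _ _ => Nat.cast_nonneg _)
      (Finset.mem_univ i)
  by_cases hij : j = i
  · subst hij
    have hQ1 : M.Q j j ≤ 1 := by
      simp only [Model.Q, Matrix.of_apply]
      exact (div_le_one (hE.trans_le hD)).2 hD
    have hQ0 : 0 ≤ M.Q j j := by
      simp only [Model.Q, Matrix.of_apply]
      exact div_nonneg hE.le (hE.le.trans hD)
    have h1 : (stepBound Δ).toReal ^ 3 ≤ (stepBound Δ).toReal :=
      pow_le_of_le_one hc0.le hc1 (by norm_num)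
    have h2 : 0 ≤ (stepBound Δ).toReal ^ 3 := by positivity
    refine le_trans ?_ (hdiag j)
    nlinarith
  · refine le_trans ?_ (goodWeight_le_typesChain h3 hΔ hQ ν K i j)
    have h1 := ENNReal.toReal_mono (hGf i j) (le_goodWeight h3 hΔ hij)
    rw [ENNReal.toReal_mul, ENNReal.toReal_pow, ENNReal.toReal_div, ENNReal.toReal_natCast,
      ENNReal.toReal_natCast] at h1
    have h2 : M.Q i j ≤ (M.E i j : ℝ) / M.E i i := by
      simp only [Model.Q, Matrix.of_apply]
      exact div_le_div_of_nonneg_left (Nat.cast_nonneg _) hE hD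
    have h4 := mul_le_mul_of_nonneg_left h2 (by positivity : 0 ≤ (stepBound Δ).toReal ^ 3)
    linarith

/-! ### The sizes of the communities -/

theorem three_mul_n_le (h3 : ∀ i v, 3 ≤ M.degInt i v) (i : Fin m) : 3 * M.n i ≤ M.E i i := by
  rw [← M.sum_degInt]
  calc 3 * M.n i = ∑ _v : Fin (M.n i), 3 := by simp [mul_comm]
    _ ≤ _ := Finset.sum_le_sum fun v _ => h3 i v

theorem sum_E_le (hΔ : ∀ i v, M.deg i v ≤ Δ) (i : Fin m) : ∑ l, M.E i l ≤ Δ * M.n i := by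
  rw [← Finset.add_sum_erase _ _ (Finset.mem_univ i), ← M.sum_degInt, ← M.sum_degOut,
    ← Finset.sum_add_distrib]
  calc ∑ v, (M.degInt i v + M.degOut i v) ≤ ∑ _v : Fin (M.n i), Δ :=
        Finset.sum_le_sum fun v _ => hΔ i v
    _ = Δ * M.n i := by simp [mul_comm]

/-- Serves both invariant distributions: `D` is the diagonal of `E` for the types chain and the row
sums of `E` for `Q`. Both lie between `n i` and `Δ * n i`. -/
theorem le_div_sum_of_sizes {r : ℝ} (hr : 0 < r) (hn : ∀ i j, r ≤ (M.n i : ℝ) / (M.n j : ℝ))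
    {D : Fin m → ℝ} (h1 : ∀ i, (M.n i : ℝ) ≤ D i) (h2 : ∀ i, D i ≤ Δ * M.n i) (i : Fin m) :
    r / (Δ * m) ≤ D i / ∑ j, D j := by
  have hpos : ∀ i, (0 : ℝ) < M.n i := fun i => by exact_mod_cast M.n_pos i
  have hD0 : ∀ i, 0 < D i := fun i => (hpos i).trans_le (h1 i)
  have hsum : ∑ j, D j ≤ (Δ * m) * (M.n i / r) := by
    calc ∑ j, D j ≤ ∑ _j : Fin m, Δ * ((M.n i : ℝ) / r) := by
          refine Finset.sum_le_sum fun j _ => (h2 j).trans ?_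
          refine mul_le_mul_of_nonneg_left ?_ (Nat.cast_nonneg Δ)
          have := hn i j
          rw [le_div_iff₀ (hpos j)] at this
          rw [le_div_iff₀ hr]
          linarith
      _ = (Δ * m) * (M.n i / r) := by
          rw [Finset.sum_const, Finset.card_univ, Fintype.card_fin, nsmul_eq_mul]
          ring
  have hs0 : 0 < ∑ j, D j := (hD0 i).trans_le
    (Finset.single_le_sum (f := D) (fun j _ => (hD0 j).le) (Finset.mem_univ i))
  have hx : 0 < (Δ * m : ℝ) := by
    by_contra h
    have h0 : (Δ * m : ℝ) ≤ 0 := not_lt.1 h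
    have := mul_nonpos_of_nonpos_of_nonneg h0 (div_pos (hpos i) hr).le
    linarith
  rw [div_le_div_iff₀ hx hs0]
  have h4 := mul_le_mul_of_nonneg_left hsum hr.le
  have h5 : r * ((Δ * m) * (M.n i / r)) = (Δ * m) * M.n i := by
    field_simp
  have h6 := mul_le_mul_of_nonneg_left (h1 i) hx.le
  linarith

end Main

end MultiCommunity

end

/-! ### Proof of the proposition. -/

open MultiCommunity in
theorem proposition3p4 (m Δ : ℕ) (r : ℝ) (hr : 0 < r) :
    ∃ C : NNReal, ∀ (M : MultiCommunity.Model m) (πQ : Fin m → ℝ) (ν : PMF (Fin m)) (K : ℕ),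
      M.Q.IsIrreducible →
      MultiCommunity.IsInvariantDistribution M.Q πQ →
      (∀ i v, 3 ≤ M.degInt i v) →
      (∀ i v, M.deg i v ≤ Δ) →
      (∀ i j, r ≤ (M.n i : ℝ) / (M.n j : ℝ)) →
      MultiCommunity.typesChain M ν K ∈ Matrix.rowStochastic ℝ (Fin m) ∧
      ∃ π : Fin m → ℝ,
        MultiCommunity.IsInvariantDistribution (MultiCommunity.typesChain M ν K) π ∧
        (∀ π', MultiCommunity.IsInvariantDistribution (MultiCommunity.typesChain M ν K) π' →
          π' = π) ∧
        ((MultiCommunity.mixingTime (MultiCommunity.typesChain M ν K) π (1 / 4) : ℕ∞) : ENNReal)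
          ≤ (C : ENNReal) / MultiCommunity.cheeger M.Q πQ := by
  set c := (stepBound Δ).toReal with hc
  have hc0 : 0 < c := toReal_stepBound_pos Δ
  have hc1 : c ≤ 1 := toReal_stepBound_le_one Δ
  set p : ℝ := r / (Δ * m) with hp
  -- After the number of states come the lower bounds for the invariant distribution of the types
  -- chain, for its domination of `Q`, for its holding probabilities, and for `πQ`.
  refine ⟨(mixConst m (c / 4 * p) (c ^ 3 / 2) (c / 2) p).toNNReal, ?_⟩
  intro M πQ ν K hQ hπQ h3 hΔ hn
  obtain ⟨i₀, -⟩ := ν.support_nonempty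
  have : Nonempty (Fin m) := ⟨i₀⟩
  obtain ⟨hst, π, hπ, hπlow⟩ := typesChain_spec h3 hΔ hQ ν K
  obtain ⟨hδ, hdom⟩ := typesChain_dominates h3 hΔ hQ ν K
  have hEn : ∀ i, (M.n i : ℝ) ≤ M.E i i := fun i => by
    exact_mod_cast (by have := three_mul_n_le h3 i; omega : M.n i ≤ M.E i i)
  have hED : ∀ i, (M.E i i : ℝ) ≤ ∑ l, (M.E i l : ℝ) := fun i =>
    Finset.single_le_sum (f := fun l => (M.E i l : ℝ)) (fun _ _ => Nat.cast_nonneg _)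
      (Finset.mem_univ i)
  have hDn : ∀ i, ∑ l, (M.E i l : ℝ) ≤ Δ * M.n i := fun i => by exact_mod_cast sum_E_le hΔ i
  have hn0 : ∀ i, (0 : ℝ) < M.n i := fun i => by exact_mod_cast M.n_pos i
  have hD0 : ∀ i, 0 < ∑ l, (M.E i l : ℝ) := fun i => (hn0 i).trans_le ((hEn i).trans (hED i))
  have hp0 : 0 < p := by
    refine div_pos hr (mul_pos ?_ ?_)
    · by_contra h
      have := (hD0 i₀).trans_le (hDn i₀)
      have := mul_nonpos_of_nonpos_of_nonneg (not_lt.1 h) (hn0 i₀).le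
      linarith
    · exact_mod_cast Fin.pos i₀
  have hQrow : ∀ i, ∑ j, M.Q i j = 1 := fun i => by
    simp only [Model.Q, Matrix.of_apply]
    rw [← Finset.sum_div, div_self (hD0 i).ne']
  have hπQlow : ∀ i, p ≤ πQ i := by
    intro i
    -- Symmetry of `E` is detailed balance for `Q`, so `πQ` is proportional to the row sums.
    rw [invariant_eq_of_reversible hQ hQrow hD0 (fun i j => ?_) hπQ i]
    · exact le_div_sum_of_sizes hr hn (fun i => (hEn i).trans (hED i)) hDn i
    · have hi := (hD0 i).ne'
      have hj := (hD0 j).ne'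
      simp only [Model.Q, Matrix.of_apply]
      rw [mul_div_cancel₀ _ hi, mul_div_cancel₀ _ hj, M.E_symm]
  have hp1 : p ≤ 1 := by
    refine (hπQlow i₀).trans ?_
    rw [← hπQ.sum_eq_one]
    exact Finset.single_le_sum (fun i _ => hπQ.nonneg i) (Finset.mem_univ i₀)
  have hmix := mixing_of_dominates hst hπ hQ hQrow hπQ hp0 hp1 hπQlow
    (mul_pos (by linarith : 0 < c / 4) hp0) (by positivity : 0 < c ^ 3 / 2)
    (by have := pow_le_one₀ (n := 3) hc0.le hc1; linarith) (by linarith : 0 < c / 2)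
    (fun j => le_trans (mul_le_mul_of_nonneg_left
      (le_div_sum_of_sizes hr hn hEn (fun i => (hED i).trans (hDn i)) j) (by linarith)) (hπlow j))
    hdom hδ
  rw [Fintype.card_fin] at hmix
  exact ⟨hst, π, hπ, hmix.1, hmix.2⟩
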